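/- **Game.** Let $r_T,\rho_A,\rho_T>0$ and $0<\nu<1$ satisfy $$\max\Big\{\Big(1+\tfrac{2\nu}{1-\nu^2}\Big)\rho_A,\ \nu r_T+\tfrac{2\rho_A\nu^2}{1-\nu^2}\Big\}\le\rho_T ,$$ and put $R=r_T+\rho_T$, $\gamma=\nu/(1-\nu^2)$, $\beta=\nu^2/(1-\nu^2)$, $\hat{\mathbf u}(\theta)=(\cos\theta,\sin\theta)$. A defender (speed at most $1$) protects the disc $\{\|\mathbf x\|\le r_T\}$ against intruders (speed at most $\nu$) that arrive one after the other on the circle $\|\mathbf x\|=R$, at independent uniformly distributed angles; the next intruder arrives when the current game ends. An intruder moves radially inwards at speed $\nu$ until the defender is for the first time within distance $\rho_A$ (partial information phase); from then on it moves as it likes (full information phase). At each time the defender knows the past positions of the current intruder inside the disc of radius $R$, and a defender strategy chooses its position causally from them. A game ends with capture when the two positions coincide, and with breach when the intruder, uncaptured, reaches the target disc (reaching it simultaneously with being captured counts as capture); if it never ends, nothing more is captured. Let $V_0\equiv 0$ and let $V_{n+1}(\mathbf y)$ be the average over the arrival angle $\varphi\in(-\pi,\pi]$ of $$W_n(\varphi,\mathbf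 y)=\sup_\sigma\inf\big(\mathbf 1_{\rm capture}+V_n(\mathbf x_D(T))\big),$$ where $\sigma$ runs over the strategies of a defender starting at $\mathbf y$, the infimum is over all motions of the intruder allowed against $\sigma$, $T$ is the time at which the game ends, and the expression in brackets is $0$ if the game never ends. Thus $V_n$ is the optimal guaranteed expected number of captures among $n$ intruders. A strategy $\sigma$ is *optimal with $n$ further intruders to come* if its infimum equals $W_n(\varphi,\mathbf y)$. **Engagement.** Let the current intruder appear at $(R,0)$, so that $\mathbf x_A(\tau)=(R-\nu\tau,0)$ in the partial information phase. The engagement surface $S$ is the set of pairs $(\tau,\theta)$ with $0\le\tau\le\rho_T/\nu$ and $$\sin^2(\theta/2)=\frac{(r_T+\gamma\rho_A)^2-(R-\tau\nu-\beta\rho_A)^2}{4\beta\rho_A(R-\tau\nu)} .$$ For $r>0$ and $(\tau,\theta)\in S$ let $$\theta_{\max}(\tau,\theta,r)=\cos^{-1}\!\Big(\frac{r_e^2+r^2-\tau^2}{2r_er}\Big)+\sin^{-1}\!\Big(\frac{\rho_A\sin\theta}{r_e}\Big),\qquad r_e^2=(R-\tau\nu-\rho_A)^2+4(R-\tau\nu)\rho_A\cos^2(\theta/2),$$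 with $\cos^{-1}(s)=\pi$ for $s<-1$ (and a quotient with denominator $r_e=0$ read as $0$). Let $(\tau_{\rm eng},\theta_{\rm eng})$ maximize $\theta_{\max}(\cdot,\cdot,r)$ over those points of $S$ for which the argument of $\cos^{-1}$ is at most $1$, and write $\theta_{\max}$ for the maximum. **Proposition (Defender Strategy).** Let the defender be at $r\hat{\mathbf u}(\theta_D)$ when the intruder appears at $(R,0)$, where $0<r\le R-\rho_A$, $0\le\theta_D\le\pi$, and the distance from the defender to the intruder is initially larger than $\rho_A$. 1. If $\theta_D>\theta_{\max}$ and $r\le\rho_T/\nu$, then the strategy of going straight to the target center at speed $1$ and staying there is optimal, whatever the number $n\ge0$ of further intruders to come. 2. If $\theta_D\le\theta_{\max}$, then there is a strategy that is optimal for every number $n\ge 0$ of further intruders to come and that takes the defender, undetected before time $\tau_{\rm eng}$, to the engagement point: at time $\tau_{\rm eng}$ the intruder is at $\mathbf x_A(\tau_{\rm eng})$ and the defender at $\mathbf x_A(\tau_{\rm eng})+\rho_A\hat{\mathbf u}(\theta_{\rm eng})$, and the full information phase starts then. -/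

import Mathlib

open MeasureTheory Set

noncomputable section

namespace TargetDefense

/-- The plane with its Euclidean norm. -/
abbrev Plane := EuclideanSpace ℝ (Fin 2)

/-- The unit vector with polar angle `θ`. -/
def dir (θ : ℝ) : Plane := !₂[Real.cos θ, Real.sin θ]

/-- The data of the game: the target radius `rT`, the width `ρT` of the target sensing annulus,
the sensing radius `ρA` of the intruders and their maximal speed `ν`
(the maximal speed of the defender is `1`). -/
structure Params where
  rT : ℝ
  ρT : ℝ
  ρA : ℝ
  ν : ℝ

/-- Radius of the outer boundary of the target sensing region. -/
def Params.R (P : Params) : ℝ := P.rT + P.ρT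

def Params.γ (P : Params) : ℝ := P.ν / (1 - P.ν ^ 2)

def Params.β (P : Params) : ℝ := P.ν ^ 2 / (1 - P.ν ^ 2)

/-- The parameter regime. -/
structure Params.Regime (P : Params) : Prop where
  rT_pos : 0 < P.rT
  ρA_pos : 0 < P.ρA
  ν_pos : 0 < P.ν
  ν_lt_one : P.ν < 1
  large : max ((1 + 2 * P.ν / (1 - P.ν ^ 2)) * P.ρA)
    (P.ν * P.rT + 2 * P.ρA * P.ν ^ 2 / (1 - P.ν ^ 2)) ≤ P.ρT

/-! ### Motions, defender strategies and plays of one game -/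

/-- `x` is a motion, for times `t ≥ 0`, with speed at most `v`: the solutions of
`ẋ = w û(ψ)` with measurable controls `ψ` and `|w| ≤ v` are the `v`-Lipschitz curves. -/
def IsMotion (v : ℝ) (x : ℝ → Plane) : Prop :=
  ∀ s t : ℝ, 0 ≤ s → s ≤ t → ‖x t - x s‖ ≤ v * (t - s)

/-- Up to time `t`, the target's sensors cannot distinguish the intruder motions `x` and `x'`:
they see the position of an intruder exactly while it is in the disc of radius `R`. -/
def SameObs (P : Params) (t : ℝ) (x x' : ℝ → Plane) : Prop :=
  ∀ s : ℝ, 0 ≤ s → s ≤ t → (‖x s‖ ≤ P.R ∨ ‖x' s‖ ≤ P.R) → x s = x' s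

/-- A strategy, for one game, of a defender that is at `y` when the intruder appears: it
answers every motion of the intruder by a motion of speed at most `1`, and its position at time
`t` depends only on what has been observed of the intruder up to time `t`. -/
structure DefenderStrategy (P : Params) (y : Plane) where
  move : (ℝ → Plane) → ℝ → Plane
  start : ∀ x, IsMotion P.ν x → move x 0 = y
  speed : ∀ x, IsMotion P.ν x → IsMotion 1 (move x)
  causal : ∀ x x', IsMotion P.ν x → IsMotion P.ν x' → ∀ t : ℝ, 0 ≤ t → SameObs P t x x' →
    move x t = move x' t

/-- The radial approach, at full speed, of an intruder that appears at angle `φ`. -/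
def radial (P : Params) (φ t : ℝ) : Plane := (P.R - P.ν * t) • dir φ

/-- The motions `x` that an intruder appearing at angle `φ` may carry out against `σ`: it moves
radially at full speed until the defender is for the first time within distance `ρA` of it
(partial information phase); after that it is free (full information phase). -/
structure IsPlay (P : Params) (φ : ℝ) {y : Plane} (σ : DefenderStrategy P y)
    (x : ℝ → Plane) : Prop where
  motion : IsMotion P.ν x
  partialInfo : ∀ t : ℝ, 0 ≤ t →
    (∀ s : ℝ, 0 ≤ s → s < t → P.ρA < ‖x s - σ.move x s‖) → x t = radial P φ t

/-- Before time `T` the intruder has neither been captured nor has it reached the target. -/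
def Undecided (P : Params) (xA xD : ℝ → Plane) (T : ℝ) : Prop :=
  ∀ s : ℝ, 0 ≤ s → s < T → xA s ≠ xD s ∧ P.rT < ‖xA s‖

/-- The game ends at time `T` with the capture of the intruder. -/
def CaptureAt (P : Params) (xA xD : ℝ → Plane) (T : ℝ) : Prop :=
  0 ≤ T ∧ Undecided P xA xD T ∧ xA T = xD T

/-- The game ends at time `T` with a breach of the target. -/
def BreachAt (P : Params) (xA xD : ℝ → Plane) (T : ℝ) : Prop :=
  0 ≤ T ∧ Undecided P xA xD T ∧ xA T ≠ xD T ∧ ‖xA T‖ ≤ P.rT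

/-! ### The sequential game -/

/-- Number of captures from the current game on, if `U y` is the number of later captures when
the next game starts with the defender at `y`. The next game starts when the current one ends;
if it never ends, no further intruder appears and nothing more is captured. -/
def payoff (P : Params) (U : Plane → ENNReal) (xA xD : ℝ → Plane) : ENNReal :=
  (⨆ (T : ℝ) (_ : CaptureAt P xA xD T), (1 + U (xD T))) ⊔
    (⨆ (T : ℝ) (_ : BreachAt P xA xD T), U (xD T))

/-- What the strategy `σ` guarantees against an intruder appearing at angle `φ`. -/
def guarantee (P : Params) (U : Plane → ENNReal) (φ : ℝ) {y : Plane}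
    (σ : DefenderStrategy P y) : ENNReal :=
  ⨅ (x : ℝ → Plane) (_ : IsPlay P φ σ x), payoff P U x (σ.move x)

/-- The best guarantee of a defender at `y` against an intruder appearing at angle `φ`. -/
def stageValue (P : Params) (U : Plane → ENNReal) (φ : ℝ) (y : Plane) : ENNReal :=
  ⨆ σ : DefenderStrategy P y, guarantee P U φ σ

/-- The value, that is the optimal expected number of captures, of the game with `n` intruders
and with the defender initially at `y`; the arrival angles are independent and uniformly
distributed, the intruders minimize and the defender maximizes. -/
def value (P : Params) : ℕ → Plane → ENNReal
  | 0, _ => 0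
  | n + 1, y => (ENNReal.ofReal (2 * Real.pi))⁻¹ *
      ∫⁻ φ in Ioc (-Real.pi) Real.pi, stageValue P (value P n) φ y

/-- `σ` is an optimal strategy of the defender in the current game, against an intruder appearing
at angle `φ`, when `n` more intruders are to come after this one. -/
def IsOptimal (P : Params) (n : ℕ) (φ : ℝ) {y : Plane} (σ : DefenderStrategy P y) : Prop :=
  guarantee P (value P n) φ σ = stageValue P (value P n) φ y

/-! ### Going to the target center -/

/-- Straight motion from `y` to the origin with speed `1`, and rest at the origin afterwards. -/
def homePath (y : Plane) (t : ℝ) : Plane := max (1 - t / ‖y‖) 0 • y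

theorem homePath_zero (y : Plane) : homePath y 0 = y := by
  simp [homePath]

theorem homePath_isMotion (y : Plane) : IsMotion 1 (homePath y) := by
  intro s t _ hst
  rcases eq_or_ne y 0 with rfl | hy
  · simp only [homePath, smul_zero, sub_self, norm_zero]; linarith
  have hn : 0 < ‖y‖ := norm_pos_iff.mpr hy
  unfold homePath
  rw [← sub_smul, norm_smul, Real.norm_eq_abs]
  have h1 : |max (1 - t / ‖y‖) 0 - max (1 - s / ‖y‖) 0| ≤ |(1 - t / ‖y‖) - (1 - s / ‖y‖)| :=
    abs_max_sub_max_le_abs _ _ _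
  have h2 : (1 - t / ‖y‖) - (1 - s / ‖y‖) = -((t - s) / ‖y‖) := by ring
  rw [h2, abs_neg, abs_of_nonneg (div_nonneg (sub_nonneg.mpr hst) hn.le)] at h1
  calc _ ≤ (t - s) / ‖y‖ * ‖y‖ := mul_le_mul_of_nonneg_right h1 hn.le
    _ = 1 * (t - s) := by field_simp

/-- The strategy "go straight to the target center at full speed and stay there". -/
def goHome (P : Params) (y : Plane) : DefenderStrategy P y where
  move := fun _ => homePath y
  start := fun _ _ => homePath_zero y
  speed := fun _ _ => homePath_isMotion y
  causal := fun _ _ _ _ _ _ _ => rfl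

/-! ### Engagement surface and maximal angular separation -/

/-- The pairs `(τ, θ)` for which the Apollonius circle of the intruder at `radial P 0 τ` and the
defender at `radial P 0 τ + ρA û(θ)` is tangent to the target; `τ` runs over the times of the
radial approach at which the intruder has not entered the target. -/
def engagementSurface (P : Params) : Set (ℝ × ℝ) :=
  {p | 0 ≤ p.1 ∧ p.1 ≤ P.ρT / P.ν ∧
    Real.sin (p.2 / 2) ^ 2 =
      ((P.rT + P.γ * P.ρA) ^ 2 - (P.rT + P.ρT - p.1 * P.ν - P.β * P.ρA) ^ 2) /
        (4 * P.β * P.ρA * (P.rT + P.ρT - p.1 * P.ν))}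

/-- The engagement point belonging to `(τ, θ)`. -/
def engagementPoint (P : Params) (p : ℝ × ℝ) : Plane := radial P 0 p.1 + P.ρA • dir p.2

/-- Distance of the engagement point from the target center. -/
def rEng (P : Params) (p : ℝ × ℝ) : ℝ :=
  Real.sqrt ((P.rT + P.ρT - p.1 * P.ν - P.ρA) ^ 2 +
    4 * (P.rT + P.ρT - p.1 * P.ν) * P.ρA * Real.cos (p.2 / 2) ^ 2)

def φEng (P : Params) (p : ℝ × ℝ) : ℝ := Real.arcsin (P.ρA * Real.sin p.2 / rEng P p)

/-- The argument of the inverse cosine in `θmax`. -/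
def cosArg (P : Params) (r : ℝ) (p : ℝ × ℝ) : ℝ :=
  (rEng P p ^ 2 + r ^ 2 - p.1 ^ 2) / (2 * rEng P p * r)

/-- Maximal angular separation. For `cosArg < -1`, where the engagement point is in reach from
every angle, the inverse cosine is read as `π`, which is the value of `Real.arccos`. -/
def θmax (P : Params) (r : ℝ) (p : ℝ × ℝ) : ℝ := Real.arccos (cosArg P r p) + φEng P p

/-- `p` maximizes `θmax` over the points of the engagement surface. The points with `cosArg > 1`,
where the inverse cosine has no meaning and which are out of reach from every angle,
do not compete. -/
def IsBestEngagement (P : Params) (r : ℝ) (p : ℝ × ℝ) : Prop :=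
  p ∈ engagementSurface P ∧ cosArg P r p ≤ 1 ∧
    ∀ q ∈ engagementSurface P, cosArg P r q ≤ 1 → θmax P r q ≤ θmax P r p

/-- Against an intruder appearing at angle `0`, the strategy `σ` leads the defender, undetected,
to the engagement point of `p = (τ, θ)` at time `τ`, and the full information phase starts
there and then. -/
def EngagesAt (P : Params) {y : Plane} (σ : DefenderStrategy P y) (p : ℝ × ℝ) : Prop :=
  ∀ x, IsPlay P 0 σ x →
    (∀ t : ℝ, 0 ≤ t → t < p.1 → P.ρA < ‖x t - σ.move x t‖) ∧
    x p.1 = radial P 0 p.1 ∧ σ.move x p.1 = engagementPoint P p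

end TargetDefense

end

noncomputable section

namespace TargetDefense

/-! ### Coordinates in the plane -/

/-! Let contact occur at distance exactly `ρA`. The points which the intruder can reach no later
than the defender form the Apollonius disc, of radius `γρA`. If its centre is closer to the origin
than `rT + γρA`, some target point is strictly closer in time for the intruder, which then cannot be
stopped. Otherwise the disc extends to the circle of radius `c = rT + 2γρA`, and the intruder can
insist on not being captured anywhere else than at a point of that circle. The engagement surface
consists of the contacts whose disc is tangent to the target. From such a contact the defender keeps
the direction of the line of sight and spends its remaining speed on closing in; the intruder is
then captured inside the Apollonius disc, hence within distance `c` (`pursuit_outcome`).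

About the later games only one property is needed, `IsTargetLike`: the future value `U` is at least
some `m` on the disc of radius `c`, at most `m` outside it, largest at the centre, and `U 0 ≤ 1 +
m`. For such `U` no strategy guarantees more than `1 + m` (`guarantee_le_one_add`), and a tangent
engagement guarantees that much. If no point of the surface can be reached in time (negation of
`Reach`), every strategy can be held to `U 0` (`guarantee_le_of_not_reach`), which going home
secures (`le_guarantee_goHome`). Neither strategy refers to `m`, so each one serves every number of
further intruders.

That the values are target-like is proved by induction (`exists_isTargetLike_value`). The set of
positions satisfying `Reach` is star-shaped about the centre (`Reach.smul`), so at a fixed bearing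
it never hurts to be further in, and the average of the next game over positions on the circle of
radius `c` separates inside from outside.

Being in time is not enough: the defender must also arrive undetected (`Sneak`). The first-order
condition at a maximizer of `θmax` forces a best engagement point off the intruder's path and on the
near side of the centre to lie in front of the intruder, or beyond its tangent as seen from the
centre, and then one of a few explicit paths works (`sneak_of_best`). The law of cosines translates
between `Reach` and `θmax`. Small targets, `rT ≤ ρA`, are special: there every relevant position can
reach the front engagement point. -/

theorem Plane.norm_sq (x : Plane) : ‖x‖ ^ 2 = x 0 ^ 2 + x 1 ^ 2 := by
  rw [EuclideanSpace.norm_sq_eq]; simp [Fin.sum_univ_two]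

theorem Plane.norm_le_iff {x : Plane} {r : ℝ} (hr : 0 ≤ r) :
    ‖x‖ ≤ r ↔ x 0 ^ 2 + x 1 ^ 2 ≤ r ^ 2 := by
  rw [← Plane.norm_sq, sq_le_sq₀ (norm_nonneg _) hr]

theorem Plane.lt_norm_iff {x : Plane} {r : ℝ} (hr : 0 ≤ r) :
    r < ‖x‖ ↔ r ^ 2 < x 0 ^ 2 + x 1 ^ 2 := by
  rw [← Plane.norm_sq, sq_lt_sq₀ hr (norm_nonneg _)]

@[simp] theorem dir_apply_zero (θ : ℝ) : dir θ 0 = Real.cos θ := rfl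

@[simp] theorem dir_apply_one (θ : ℝ) : dir θ 1 = Real.sin θ := rfl

@[simp] theorem norm_dir (θ : ℝ) : ‖dir θ‖ = 1 := by
  have h := Plane.norm_sq (dir θ)
  simp only [dir_apply_zero, dir_apply_one, Real.cos_sq_add_sin_sq] at h
  nlinarith [norm_nonneg (dir θ)]

theorem Plane.ext {x y : Plane} (h0 : x 0 = y 0) (h1 : x 1 = y 1) : x = y := by
  ext i; fin_cases i <;> assumption

theorem Plane.exists_polar (y : Plane) : ∃ ψ : ℝ, y = ‖y‖ • dir ψ := by
  by_cases hy : y = 0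
  · exact ⟨0, by simp [hy]⟩
  have hr : 0 < ‖y‖ := norm_pos_iff.mpr hy
  set z : ℂ := ⟨y 0, y 1⟩ with hz
  have hzn : ‖z‖ = ‖y‖ := by
    have h1 : ‖z‖ ^ 2 = ‖y‖ ^ 2 := by
      rw [Plane.norm_sq, ← Complex.normSq_eq_norm_sq, Complex.normSq_apply]; simp [hz]; ring
    exact (sq_eq_sq₀ (norm_nonneg _) (norm_nonneg _)).1 h1
  refine ⟨Complex.arg z, Plane.ext ?_ ?_⟩
  · have := Complex.norm_mul_cos_arg z
    simp only [PiLp.smul_apply, smul_eq_mul, dir_apply_zero, ← hzn, this]; rfl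
  · have := Complex.norm_mul_sin_arg z
    simp only [PiLp.smul_apply, smul_eq_mul, dir_apply_one, ← hzn, this]; rfl

theorem dir_injOn : InjOn dir (Ioc (-Real.pi) Real.pi) := by
  intro φ hφ ψ hψ h
  have h0 := congrArg (fun x : Plane => x 0) h
  have h1 := congrArg (fun x : Plane => x 1) h
  simp only [dir_apply_zero, dir_apply_one] at h0 h1
  have := Real.Angle.cos_sin_inj h0 h1
  have h2 := congrArg Real.Angle.toReal this
  rwa [Real.Angle.toReal_coe_eq_self_iff.2 hφ, Real.Angle.toReal_coe_eq_self_iff.2 hψ] at h2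

/-! ### Motions -/

theorem IsMotion.continuousOn {v : ℝ} {x : ℝ → Plane} (h : IsMotion v x) :
    ContinuousOn x (Ici 0) := by
  have : LipschitzOnWith (Real.toNNReal v) x (Ici 0) := by
    refine LipschitzOnWith.of_dist_le_mul ?_
    have key : ∀ s t : ℝ, 0 ≤ s → s ≤ t → dist (x t) (x s) ≤ Real.toNNReal v * dist t s := by
      intro s t hs hst
      rw [dist_eq_norm, Real.dist_eq, abs_of_nonneg (sub_nonneg.2 hst)]
      exact (h s t hs hst).trans
        (mul_le_mul_of_nonneg_right (Real.le_coe_toNNReal v) (sub_nonneg.2 hst))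
    intro s hs t ht
    rcases le_total s t with hst | hst
    · rw [dist_comm, dist_comm s t]; exact key s t hs hst
    · exact key t s ht hst
  exact this.continuousOn

/-- Gluing two motions at time `T`. -/
theorem IsMotion.glue {v T : ℝ} {f g : ℝ → Plane}
    (hf : ∀ s t : ℝ, 0 ≤ s → s ≤ t → t ≤ T → ‖f t - f s‖ ≤ v * (t - s))
    (hg : ∀ s t : ℝ, T ≤ s → s ≤ t → ‖g t - g s‖ ≤ v * (t - s)) (hfg : f T = g T) :
    IsMotion v (fun t => if t ≤ T then f t else g t) := by
  intro s t hs hst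
  by_cases ht : t ≤ T
  · have hsT : s ≤ T := hst.trans ht
    simp only [ht, hsT, if_true]; exact hf s t hs hst ht
  · by_cases hsT : s ≤ T
    · simp only [ht, hsT, if_true, if_false]
      have ht' : T ≤ t := le_of_not_ge ht
      calc ‖g t - f s‖ = ‖(g t - g T) + (f T - f s)‖ := by rw [hfg]; congr 1; abel
        _ ≤ ‖g t - g T‖ + ‖f T - f s‖ := norm_add_le _ _
        _ ≤ v * (t - T) + v * (T - s) := add_le_add (hg T t le_rfl ht') (hf s T hs hsT le_rfl)
        _ = v * (t - s) := by ring
    · simp only [ht, hsT, if_false]; exact hg s t (le_of_not_ge hsT) hst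

/-- Uniform motion along a segment, traversed in the time interval `[t₀, t₁]`. -/
def segment (t₀ t₁ : ℝ) (p q : Plane) (t : ℝ) : Plane := p + ((t - t₀) / (t₁ - t₀)) • (q - p)

theorem segment_start (t₀ t₁ : ℝ) (p q : Plane) : segment t₀ t₁ p q t₀ = p := by
  simp [segment]

theorem segment_end {t₀ t₁ : ℝ} (h : t₀ < t₁) (p q : Plane) : segment t₀ t₁ p q t₁ = q := by
  simp [segment, div_self (sub_pos.2 h).ne']

theorem segment_speed {v t₀ t₁ : ℝ} (h : t₀ < t₁) {p q : Plane} (hpq : ‖q - p‖ ≤ v * (t₁ - t₀))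
    {s t : ℝ} (hst : s ≤ t) : ‖segment t₀ t₁ p q t - segment t₀ t₁ p q s‖ ≤ v * (t - s) := by
  have h0 := sub_pos.2 h
  have : segment t₀ t₁ p q t - segment t₀ t₁ p q s = ((t - s) / (t₁ - t₀)) • (q - p) := by
    simp only [segment, add_sub_add_left_eq_sub, ← sub_smul]; congr 1; ring
  rw [this, norm_smul, Real.norm_eq_abs, abs_of_nonneg (div_nonneg (sub_nonneg.2 hst) h0.le)]
  calc (t - s) / (t₁ - t₀) * ‖q - p‖ ≤ (t - s) / (t₁ - t₀) * (v * (t₁ - t₀)) :=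
        mul_le_mul_of_nonneg_left hpq (div_nonneg (sub_nonneg.2 hst) h0.le)
    _ = v * (t - s) := by field_simp

/-! ### Radial approach and first contact -/

theorem radial_isMotion (P : Params) (hν : 0 ≤ P.ν) (φ : ℝ) : IsMotion P.ν (radial P φ) := by
  intro s t _ hst
  have : radial P φ t - radial P φ s = (-(P.ν * (t - s))) • dir φ := by
    simp only [radial, ← sub_smul]; congr 1; ring
  rw [this, norm_smul, norm_dir, mul_one, Real.norm_eq_abs, abs_neg,
    abs_of_nonneg (mul_nonneg hν (sub_nonneg.2 hst))]

theorem norm_radial (P : Params) (φ t : ℝ) (h : P.ν * t ≤ P.R) :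
    ‖radial P φ t‖ = P.R - P.ν * t := by
  rw [radial, norm_smul, norm_dir, mul_one, Real.norm_eq_abs, abs_of_nonneg (by linarith)]

theorem radial_zero_apply_zero (P : Params) (t : ℝ) : radial P 0 t 0 = P.R - P.ν * t := by
  simp [radial]

theorem radial_zero_apply_one (P : Params) (t : ℝ) : radial P 0 t 1 = 0 := by
  simp [radial]

/-- If the distance of two motions is at most `ρ` at some time, there is a first such time. -/
theorem exists_first_contact {v w ρ t : ℝ} {x y : ℝ → Plane} (hx : IsMotion v x)
    (hy : IsMotion w y) (ht : 0 ≤ t) (h : ‖x t - y t‖ ≤ ρ) :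
    ∃ s, 0 ≤ s ∧ s ≤ t ∧ ‖x s - y s‖ ≤ ρ ∧ ∀ u, 0 ≤ u → u < s → ρ < ‖x u - y u‖ := by
  have hc : ContinuousOn (fun s => ‖x s - y s‖) (Icc 0 t) :=
    ((hx.continuousOn.sub hy.continuousOn).norm).mono Icc_subset_Ici_self
  have hcl : IsClosed (Icc 0 t ∩ (fun s => ‖x s - y s‖) ⁻¹' Iic ρ) :=
    hc.preimage_isClosed_of_isClosed isClosed_Icc isClosed_Iic
  have hcomp : IsCompact (Icc 0 t ∩ (fun s => ‖x s - y s‖) ⁻¹' Iic ρ) :=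
    isCompact_Icc.of_isClosed_subset hcl inter_subset_left
  obtain ⟨s, ⟨hs, hs'⟩, hmin⟩ := hcomp.exists_isLeast ⟨t, ⟨ht, le_rfl⟩, h⟩
  refine ⟨s, hs.1, hs.2, hs', fun u hu hus => ?_⟩
  by_contra hcon
  exact absurd (hmin ⟨⟨hu, hus.le.trans hs.2⟩, not_lt.1 hcon⟩) (not_le.2 hus)

/-- As long as the radial approach would not be detected, every play is the radial approach. -/
theorem IsPlay.eq_radial {P : Params} {φ : ℝ} {y : Plane} {σ : DefenderStrategy P y}
    {x : ℝ → Plane} (hx : IsPlay P φ σ x) {τ : ℝ}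
    (hfar : ∀ s, 0 ≤ s → s < τ → P.ρA < ‖radial P φ s - σ.move x s‖) :
    (∀ s, 0 ≤ s → s ≤ τ → x s = radial P φ s) ∧
      ∀ s, 0 ≤ s → s < τ → P.ρA < ‖x s - σ.move x s‖ := by
  have key : ∀ s, 0 ≤ s → s < τ → P.ρA < ‖x s - σ.move x s‖ := by
    intro s hs hsτ
    by_contra hcon
    -- At the first contact of the play the intruder is still on the radial approach, against
    -- `hfar`.
    obtain ⟨u, hu, hus, huc, hbef⟩ :=
      exists_first_contact hx.motion (σ.speed x hx.motion) hs (not_lt.1 hcon)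
    have h1 := hfar u hu (hus.trans_lt hsτ)
    rw [← hx.partialInfo u hu hbef] at h1
    linarith
  exact ⟨fun s hs hsτ => hx.partialInfo s hs fun u hu hus => key u hu (hus.trans_le hsτ), key⟩

theorem Undecided.le_of_norm_le {P : Params} {xA xD : ℝ → Plane} {T t : ℝ}
    (h : Undecided P xA xD T) (ht : 0 ≤ t) (hx : ‖xA t‖ ≤ P.rT) : T ≤ t := by
  by_contra hcon
  exact absurd (h t ht (not_le.1 hcon)).2 (not_lt.2 hx)

theorem payoff_le {P : Params} {U : Plane → ENNReal} {xA xD : ℝ → Plane} {B : ENNReal}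
    (h1 : ∀ T, CaptureAt P xA xD T → 1 + U (xD T) ≤ B)
    (h2 : ∀ T, BreachAt P xA xD T → U (xD T) ≤ B) : payoff P U xA xD ≤ B :=
  sup_le (iSup₂_le h1) (iSup₂_le h2)

theorem guarantee_le {P : Params} {U : Plane → ENNReal} {φ : ℝ} {y : Plane}
    {σ : DefenderStrategy P y} {x : ℝ → Plane} (hx : IsPlay P φ σ x) {B : ENNReal}
    (h1 : ∀ T, CaptureAt P x (σ.move x) T → 1 + U (σ.move x T) ≤ B)
    (h2 : ∀ T, BreachAt P x (σ.move x) T → U (σ.move x T) ≤ B) : guarantee P U φ σ ≤ B :=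
  (iInf₂_le x hx).trans (payoff_le h1 h2)

/-! ### Replies of the intruder -/

/-- Radial approach up to time `t`, then a straight run at full speed to `z`, where the intruder
stays. -/
def runPath (P : Params) (t : ℝ) (z : Plane) (s : ℝ) : Plane :=
  if s ≤ t then radial P 0 s else
    radial P 0 t + min 1 (P.ν * (s - t) / ‖z - radial P 0 t‖) • (z - radial P 0 t)

theorem runPath_of_le (P : Params) {t s : ℝ} (z : Plane) (h : s ≤ t) :
    runPath P t z s = radial P 0 s := if_pos h

theorem runPath_of_ge (P : Params) {t s : ℝ} (z : Plane) (h : t ≤ s) :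
    runPath P t z s =
      radial P 0 t + min 1 (P.ν * (s - t) / ‖z - radial P 0 t‖) • (z - radial P 0 t) := by
  rcases h.eq_or_lt with rfl | h
  · simp [runPath]
  · exact if_neg (not_le.2 h)

theorem runPath_isMotion (P : Params) (hν : 0 < P.ν) (t : ℝ) (z : Plane) :
    IsMotion P.ν (runPath P t z) := by
  refine IsMotion.glue (fun s u hs hsu _ => radial_isMotion P hν.le 0 s u hs hsu) ?_ (by simp)
  intro s u _ hsu
  rw [add_sub_add_left_eq_sub, ← sub_smul, norm_smul, Real.norm_eq_abs]
  set d := ‖z - radial P 0 t‖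
  have hnn : 0 ≤ P.ν * (u - s) := mul_nonneg hν.le (sub_nonneg.2 hsu)
  rcases (norm_nonneg (z - radial P 0 t)).eq_or_lt with h0 | hd
  · rw [show d = 0 from h0.symm, mul_zero]; exact hnn
  have hle : P.ν * (s - t) / d ≤ P.ν * (u - t) / d :=
    div_le_div_of_nonneg_right (mul_le_mul_of_nonneg_left (by linarith) hν.le) hd.le
  have h1 : |min 1 (P.ν * (u - t) / d) - min 1 (P.ν * (s - t) / d)| ≤
      |P.ν * (u - t) / d - P.ν * (s - t) / d| := by
    have := abs_min_sub_min_le_max 1 (P.ν * (u - t) / d) 1 (P.ν * (s - t) / d)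
    simpa using this
  rw [abs_of_nonneg (sub_nonneg.2 hle)] at h1
  calc _ ≤ (P.ν * (u - t) / d - P.ν * (s - t) / d) * d := mul_le_mul_of_nonneg_right h1 hd.le
    _ = P.ν * (u - s) := by have : d ≠ 0 := ne_of_gt hd
                            field_simp; ring

/-- Up to time `t` the run coincides with the radial approach, so causality fixes the defender's
answer; the contact at `t` releases the intruder. -/
theorem runPath_isPlay {P : Params} (hν : 0 < P.ν) {y : Plane} (σ : DefenderStrategy P y) {t : ℝ}
    (ht : 0 ≤ t) (hc : ‖radial P 0 t - σ.move (radial P 0) t‖ ≤ P.ρA) (z : Plane) :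
    IsPlay P 0 σ (runPath P t z) ∧
      ∀ s, 0 ≤ s → s ≤ t → σ.move (runPath P t z) s = σ.move (radial P 0) s := by
  have hm := runPath_isMotion P hν t z
  have hσ : ∀ s, 0 ≤ s → s ≤ t → σ.move (runPath P t z) s = σ.move (radial P 0) s :=
    fun s hs hst => σ.causal _ _ hm (radial_isMotion P hν.le 0) s hs fun u _ hus _ =>
      runPath_of_le P z (hus.trans hst)
  refine ⟨⟨hm, fun s hs hfar => ?_⟩, hσ⟩
  by_cases hst : s ≤ t
  · exact runPath_of_le P z hst
  · have := hfar t ht (not_le.1 hst)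
    rw [hσ t ht le_rfl, runPath_of_le P z le_rfl] at this
    linarith

theorem norm_sub_runPath {P : Params} (hν : 0 < P.ν) {t s : ℝ} {z : Plane} (hts : t ≤ s)
    (h : P.ν * (s - t) ≤ ‖z - radial P 0 t‖) :
    ‖z - runPath P t z s‖ = ‖z - radial P 0 t‖ - P.ν * (s - t) := by
  rw [runPath_of_ge P z hts]
  set d := ‖z - radial P 0 t‖ with hd
  rcases (norm_nonneg (z - radial P 0 t)).eq_or_lt with h0 | hdpos
  · have h1 : z - radial P 0 t = 0 := norm_eq_zero.1 h0.symm
    have h2 : 0 ≤ P.ν * (s - t) := mul_nonneg hν.le (sub_nonneg.2 hts)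
    have h3 : d = 0 := h0.symm
    rw [h1, smul_zero, add_zero, ← hd, h3]; linarith
  · have h1 : P.ν * (s - t) / d ≤ 1 := (div_le_one hdpos).2 h
    rw [min_eq_right h1, ← sub_sub]
    have : z - radial P 0 t - (P.ν * (s - t) / d) • (z - radial P 0 t) =
        (1 - P.ν * (s - t) / d) • (z - radial P 0 t) := by rw [sub_smul, one_smul]
    rw [this, norm_smul, Real.norm_eq_abs, abs_of_nonneg (by linarith), ← hd]
    have : d ≠ 0 := ne_of_gt hdpos
    field_simp

theorem runPath_late {P : Params} {t s : ℝ} {z : Plane} (hts : t ≤ s)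
    (h : ‖z - radial P 0 t‖ ≤ P.ν * (s - t)) : runPath P t z s = z := by
  rw [runPath_of_ge P z hts]
  rcases (norm_nonneg (z - radial P 0 t)).eq_or_lt with h0 | hdpos
  · have h1 : z - radial P 0 t = 0 := norm_eq_zero.1 h0.symm
    rw [h1, smul_zero, add_zero]; exact (sub_eq_zero.1 h1).symm
  · rw [min_eq_left ((one_le_div hdpos).2 h), one_smul]; abel

/-- If, at the first contact, the intruder is not later than the defender at `z`, then it can
force a capture at `z`, if there is any. -/
theorem guarantee_le_of_run {P : Params} (hν : 0 < P.ν) (hν1 : P.ν < 1) (hρ : 0 < P.ρA)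
    {U : Plane → ENNReal} {y : Plane} (σ : DefenderStrategy P y) {t : ℝ} (ht : 0 ≤ t)
    (hc : ‖radial P 0 t - σ.move (radial P 0) t‖ ≤ P.ρA)
    (hbef : ∀ u, 0 ≤ u → u < t → P.ρA < ‖radial P 0 u - σ.move (radial P 0) u‖) {z : Plane}
    (hz : ‖z - radial P 0 t‖ ≤ P.ν * ‖z - σ.move (radial P 0) t‖) {B : ENNReal}
    (hcap : 1 + U z ≤ B) (hbr : ∀ x, U x ≤ B) : guarantee P U 0 σ ≤ B := by
  obtain ⟨hplay, hσ⟩ := runPath_isPlay hν σ ht hc z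
  refine guarantee_le hplay (fun T hT => ?_) (fun T _ => hbr _)
  obtain ⟨hT0, -, hTeq⟩ := hT
  have hTt : t ≤ T := by
    by_contra hcon
    have hlt := not_le.1 hcon
    have := hbef T hT0 hlt
    rw [← hσ T hT0 hlt.le, ← hTeq, runPath_of_le P z hlt.le, sub_self, norm_zero] at this
    linarith
  rcases le_total ‖z - radial P 0 t‖ (P.ν * (T - t)) with h | h
  · rw [← hTeq, runPath_late hTt h]; exact hcap
  rcases h.eq_or_lt with h | h
  · rw [← hTeq, runPath_late hTt h.ge]; exact hcap
  -- A capture during the run puts the defender at distance `‖z - x‖ - ν (T - t)` from `z` at time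
  -- `T`. The triangle inequality together with `hz` and `ν < 1` then gives `‖z - x‖ ≤ ν (T - t)`,
  -- so the run would already be over.
  exfalso
  have h1 := norm_sub_runPath hν hTt h.le
  have h2 := σ.speed _ hplay.motion t T ht hTt
  rw [← hTeq, hσ t ht le_rfl] at h2
  have h3 : ‖z - σ.move (radial P 0) t‖ ≤
      ‖z - runPath P t z T‖ + ‖runPath P t z T - σ.move (radial P 0) t‖ := norm_sub_le_norm_sub_add_norm_sub _ _ _
  have h4 : P.ν * ‖z - σ.move (radial P 0) t‖ ≤
      P.ν * (‖z - radial P 0 t‖ - P.ν * (T - t) + 1 * (T - t)) :=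
    mul_le_mul_of_nonneg_left (by linarith) hν.le
  nlinarith

/-- If, at the first contact, the intruder is closer to a point of the target than the defender,
with speeds taken into account, then there is no capture. -/
theorem guarantee_le_of_breach {P : Params} (hν : 0 < P.ν) (hρ : 0 < P.ρA)
    {U : Plane → ENNReal} {y : Plane} (σ : DefenderStrategy P y) {t : ℝ} (ht : 0 ≤ t)
    (hν1 : P.ν < 1)
    (hc : ‖radial P 0 t - σ.move (radial P 0) t‖ ≤ P.ρA)
    (hbef : ∀ u, 0 ≤ u → u < t → P.ρA < ‖radial P 0 u - σ.move (radial P 0) u‖) {z : Plane}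
    (hz : ‖z - radial P 0 t‖ < P.ν * ‖z - σ.move (radial P 0) t‖) (hzT : ‖z‖ ≤ P.rT)
    {B : ENNReal} (hbr : ∀ x, U x ≤ B) : guarantee P U 0 σ ≤ B := by
  obtain ⟨hplay, hσ⟩ := runPath_isPlay hν σ ht hc z
  refine guarantee_le hplay (fun T hT => ?_) (fun T _ => hbr _)
  exfalso
  obtain ⟨hT0, hund, hTeq⟩ := hT
  have hTt : t ≤ T := by
    by_contra hcon
    have hlt := not_le.1 hcon
    have := hbef T hT0 hlt
    rw [← hσ T hT0 hlt.le, ← hTeq, runPath_of_le P z hlt.le, sub_self, norm_zero] at this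
    linarith
  -- Arrival at the target point `z` ends the game, so a capture has to occur during the run.
  have hT1 : P.ν * (T - t) ≤ ‖z - radial P 0 t‖ := by
    have hs : t ≤ t + ‖z - radial P 0 t‖ / P.ν := le_add_of_nonneg_right (by positivity)
    have := hund.le_of_norm_le (t := t + ‖z - radial P 0 t‖ / P.ν) (ht.trans hs) (by
      rw [runPath_late hs (by rw [add_sub_cancel_left]; exact (mul_div_cancel₀ _ hν.ne').ge)]
      exact hzT)
    calc P.ν * (T - t) ≤ P.ν * (‖z - radial P 0 t‖ / P.ν) :=
          mul_le_mul_of_nonneg_left (by linarith) hν.le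
      _ = _ := mul_div_cancel₀ _ hν.ne'
  have h1 := norm_sub_runPath hν hTt hT1
  have h2 := σ.speed _ hplay.motion t T ht hTt
  rw [← hTeq, hσ t ht le_rfl] at h2
  have h3 : ‖z - σ.move (radial P 0) t‖ ≤
      ‖z - runPath P t z T‖ + ‖runPath P t z T - σ.move (radial P 0) t‖ := norm_sub_le_norm_sub_add_norm_sub _ _ _
  have h4 : P.ν * ‖z - σ.move (radial P 0) t‖ ≤
      P.ν * (‖z - radial P 0 t‖ - P.ν * (T - t) + 1 * (T - t)) :=
    mul_le_mul_of_nonneg_left (by linarith) hν.le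
  nlinarith

theorem radial_isPlay {P : Params} (hν : 0 ≤ P.ν) {y : Plane} (φ : ℝ) (σ : DefenderStrategy P y) :
    IsPlay P φ σ (radial P φ) := ⟨radial_isMotion P hν φ, fun _ _ _ => rfl⟩

/-- If the radial approach is not detected before the target is reached, there is no capture. -/
theorem guarantee_le_of_undetected {P : Params} (hν : 0 < P.ν) (hρ : 0 < P.ρA) (hrT : 0 ≤ P.rT)
    {U : Plane → ENNReal} {y : Plane} (σ : DefenderStrategy P y) (hρT : 0 ≤ P.ρT)
    (hfar : ∀ u, 0 ≤ u → u ≤ P.ρT / P.ν → P.ρA < ‖radial P 0 u - σ.move (radial P 0) u‖)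
    {B : ENNReal} (hbr : ∀ x, U x ≤ B) : guarantee P U 0 σ ≤ B := by
  refine guarantee_le (radial_isPlay hν.le 0 σ) (fun T hT => ?_) (fun T _ => hbr _)
  exfalso
  obtain ⟨hT0, hund, hTeq⟩ := hT
  have hν' : P.ν * (P.ρT / P.ν) = P.ρT := mul_div_cancel₀ _ hν.ne'
  have := hund.le_of_norm_le (t := P.ρT / P.ν) (by positivity) (by
    rw [norm_radial _ _ _ (by rw [hν', Params.R]; linarith), hν', Params.R]; linarith)
  have := hfar T hT0 this
  rw [← hTeq, sub_self, norm_zero] at this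
  linarith

/-! ### Symmetries -/

/-- The image of a strategy under an isometry of the plane. -/
def DefenderStrategy.conj {P : Params} {y : Plane} (σ : DefenderStrategy P y)
    (g : Plane ≃ₗᵢ[ℝ] Plane) : DefenderStrategy P (g y) where
  move := fun x t => g (σ.move (fun s => g.symm (x s)) t)
  start := fun x hx => by
    rw [σ.start]; intro s t hs hst; rw [← map_sub, g.symm.norm_map]; exact hx s t hs hst
  speed := fun x hx s t hs hst => by
    rw [← map_sub, g.norm_map]
    refine σ.speed _ ?_ s t hs hst
    intro s t hs hst; rw [← map_sub, g.symm.norm_map]; exact hx s t hs hst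
  causal := fun x x' hx hx' t ht h => by
    congr 1
    refine σ.causal _ _ ?_ ?_ t ht ?_
    · intro s t hs hst; rw [← map_sub, g.symm.norm_map]; exact hx s t hs hst
    · intro s t hs hst; rw [← map_sub, g.symm.norm_map]; exact hx' s t hs hst
    · intro s hs hst hR
      simp only [g.symm.norm_map] at hR
      simp only [h s hs hst hR]

/-- Conjugating strategies by `g` turns plays against the image into plays against the original,
with the same outcome, because sensing and detection depend only on norms. One inequality suffices:
the other is the same statement for `g.symm`. -/
theorem stageValue_comp_le {P : Params} {U : Plane → ENNReal} {φ ψ : ℝ} (g : Plane ≃ₗᵢ[ℝ] Plane)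
    (hg : g (dir ψ) = dir φ) (y : Plane) :
    stageValue P (fun x => U (g x)) ψ y ≤ stageValue P U φ (g y) := by
  refine iSup_le fun σ => le_trans ?_ (le_iSup _ (σ.conj g))
  refine le_iInf₂ fun x hx => ?_
  have hsymm : g.symm (dir φ) = dir ψ := by rw [← hg, g.symm_apply_apply]
  have hx' : IsPlay P ψ σ (fun s => g.symm (x s)) := by
    refine ⟨?_, fun t ht hfar => ?_⟩
    · intro s t hs hst; rw [← map_sub, g.symm.norm_map]; exact hx.motion s t hs hst
    · have := hx.partialInfo t ht fun s hs hst => by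
        have h := hfar s hs hst
        rw [← g.norm_map, map_sub, g.apply_symm_apply] at h
        exact h
      simp only [this, radial, map_smul, hsymm]
  refine (iInf₂_le _ hx').trans ?_
  have hu : ∀ T, Undecided P (fun s => g.symm (x s)) (σ.move fun s => g.symm (x s)) T ↔
      Undecided P x ((σ.conj g).move x) T := by
    intro T
    refine forall_congr' fun s => forall_congr' fun _ => forall_congr' fun _ => ?_
    rw [g.symm.norm_map, Ne, LinearIsometryEquiv.symm_apply_eq]; rfl
  have he : ∀ T, g.symm (x T) = (σ.move fun s => g.symm (x s)) T ↔
      x T = (σ.conj g).move x T := fun T => by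
    rw [LinearIsometryEquiv.symm_apply_eq]; rfl
  refine payoff_le (fun T hT => ?_) (fun T hT => ?_)
  · refine le_trans ?_ le_sup_left
    exact le_iSup₂_of_le T ⟨hT.1, (hu T).1 hT.2.1, (he T).1 hT.2.2⟩ le_rfl
  · refine le_trans ?_ le_sup_right
    refine le_iSup₂_of_le T ⟨hT.1, (hu T).1 hT.2.1, fun h => hT.2.2.1 ((he T).2 h), ?_⟩ le_rfl
    have := hT.2.2.2
    rwa [g.symm.norm_map] at this

theorem stageValue_comp {P : Params} {U : Plane → ENNReal} {φ ψ : ℝ} (g : Plane ≃ₗᵢ[ℝ] Plane)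
    (hg : g (dir ψ) = dir φ) (y : Plane) :
    stageValue P U φ (g y) = stageValue P (fun x => U (g x)) ψ y := by
  refine le_antisymm ?_ (stageValue_comp_le g hg y)
  have := stageValue_comp_le (P := P) (U := fun x => U (g x)) (φ := ψ) (ψ := φ) g.symm
    (by rw [← hg, g.symm_apply_apply]) (g y)
  simpa using this

/-- The orthogonal map with matrix `!![c, -e * s; s, e * c]`. -/
def planeIsometry (c s e : ℝ) (h : c ^ 2 + s ^ 2 = 1) (he : e ^ 2 = 1) : Plane ≃ₗᵢ[ℝ] Plane :=
  LinearIsometry.toLinearIsometryEquiv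
    { toFun := fun x => !₂[c * x 0 - e * s * x 1, s * x 0 + e * c * x 1]
      map_add' := fun x y => by refine Plane.ext ?_ ?_ <;> simp <;> ring
      map_smul' := fun a x => by refine Plane.ext ?_ ?_ <;> simp <;> ring
      norm_map' := fun x => by
        refine (sq_eq_sq₀ (norm_nonneg _) (norm_nonneg _)).1 ?_
        rw [Plane.norm_sq, Plane.norm_sq]
        simp
        linear_combination (x 0 ^ 2 + e ^ 2 * x 1 ^ 2) * h + x 1 ^ 2 * he } rfl

theorem planeIsometry_apply (c s e : ℝ) (h : c ^ 2 + s ^ 2 = 1) (he : e ^ 2 = 1) (x : Plane) :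
    planeIsometry c s e h he x = !₂[c * x 0 - e * s * x 1, s * x 0 + e * c * x 1] := rfl

/-- Rotation by the angle `α`. -/
def rot (α : ℝ) : Plane ≃ₗᵢ[ℝ] Plane :=
  planeIsometry (Real.cos α) (Real.sin α) 1 (Real.cos_sq_add_sin_sq α) (by norm_num)

theorem rot_dir (α ψ : ℝ) : rot α (dir ψ) = dir (ψ + α) := by
  rw [rot, planeIsometry_apply]
  refine Plane.ext ?_ ?_
  · simp [Real.cos_add]; ring
  · simp [Real.sin_add]; ring

/-- Reflection in the first coordinate axis. -/
def refl : Plane ≃ₗᵢ[ℝ] Plane := planeIsometry 1 0 (-1) (by norm_num) (by norm_num)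

theorem refl_apply (x : Plane) : refl x = !₂[x 0, -x 1] := by
  rw [refl, planeIsometry_apply]; simp

theorem refl_dir (ψ : ℝ) : refl (dir ψ) = dir (-ψ) := by
  rw [refl_apply]; refine Plane.ext ?_ ?_ <;> simp

/-! ### Proper time of a one-dimensional motion -/

/-- Lorentzian length of a segment in space-time. -/
def lapse (b : ℝ → ℝ) (u v : ℝ) : ℝ := Real.sqrt ((v - u) ^ 2 - (b v - b u) ^ 2)

/-- `f` grows on `[τ, t]` at most as fast as the proper time along `b`. -/
def IsSubLapse (b : ℝ → ℝ) (τ t : ℝ) (f : ℝ → ℝ) : Prop :=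
  f τ = 0 ∧ ∀ u v, τ ≤ u → u ≤ v → v ≤ t → f v - f u ≤ lapse b u v

/-- Proper time along `b` between the times `τ` and `t`. -/
def properTime (b : ℝ → ℝ) (τ t : ℝ) : ℝ := sSup {r | ∃ f, IsSubLapse b τ t f ∧ f t = r}

theorem lapse_nonneg (b : ℝ → ℝ) (u v : ℝ) : 0 ≤ lapse b u v := Real.sqrt_nonneg _

theorem properTime_bddAbove (b : ℝ → ℝ) {τ t : ℝ} (h : τ ≤ t) :
    BddAbove {r | ∃ f, IsSubLapse b τ t f ∧ f t = r} := by
  refine ⟨lapse b τ t, ?_⟩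
  rintro _ ⟨f, hf, rfl⟩
  have := hf.2 τ t le_rfl h le_rfl
  rw [hf.1] at this
  linarith

theorem properTime_nonempty (b : ℝ → ℝ) (τ t : ℝ) :
    {r | ∃ f, IsSubLapse b τ t f ∧ f t = r}.Nonempty :=
  ⟨0, fun _ => 0, ⟨rfl, fun u v _ _ _ => by simpa using lapse_nonneg b u v⟩, rfl⟩

/-- Proper time is a supremum rather than an integral of `√(1 - b'²)`, so no derivatives are needed:
each admissible `f` is a test function giving a lower bound. -/
theorem IsSubLapse.le_properTime {b : ℝ → ℝ} {τ t : ℝ} {f : ℝ → ℝ} (hf : IsSubLapse b τ t f)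
    (h : τ ≤ t) : f t ≤ properTime b τ t :=
  le_csSup (properTime_bddAbove b h) ⟨f, hf, rfl⟩

theorem properTime_self (b : ℝ → ℝ) (τ : ℝ) : properTime b τ τ = 0 := by
  have : {r | ∃ f, IsSubLapse b τ τ f ∧ f τ = r} = {0} := by
    refine Subset.antisymm ?_ ?_
    · rintro _ ⟨f, hf, rfl⟩; exact hf.1
    · rintro _ rfl
      exact ⟨fun _ => 0, ⟨rfl, fun u v _ _ _ => by simpa using lapse_nonneg b u v⟩, rfl⟩
  rw [properTime, this, csSup_singleton]

/-- Only increments of `b` matter. Causality of the pursuit strategy rests on this. -/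
theorem properTime_congr {b b' : ℝ → ℝ} {τ t : ℝ}
    (h : ∀ u v, τ ≤ u → u ≤ v → v ≤ t → b v - b u = b' v - b' u) :
    properTime b τ t = properTime b' τ t := by
  have : ∀ f, IsSubLapse b τ t f ↔ IsSubLapse b' τ t f := fun f => by
    refine and_congr_right fun _ => forall_congr' fun u => forall_congr' fun v =>
      forall_congr' fun hu => forall_congr' fun huv => forall_congr' fun hv => ?_
    rw [lapse, lapse, h u v hu huv hv]
  simp only [properTime, this]

theorem properTime_le_add (b : ℝ → ℝ) {τ u v : ℝ} (hu : τ ≤ u) (huv : u ≤ v) :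
    properTime b τ v ≤ properTime b τ u + lapse b u v := by
  refine csSup_le (properTime_nonempty b τ v) ?_
  rintro _ ⟨f, hf, rfl⟩
  have h1 := hf.2 u v hu huv le_rfl
  have h2 : IsSubLapse b τ u f := ⟨hf.1, fun s t hs hst ht => hf.2 s t hs hst (ht.trans huv)⟩
  have h3 := h2.le_properTime hu
  linarith

/-- Reverse triangle inequality. -/
theorem lapse_mono {b : ℝ → ℝ} {s u v : ℝ}
    (h1 : |b u - b s| ≤ u - s) (h2 : |b v - b u| ≤ v - u) : lapse b s u ≤ lapse b s v := by
  refine Real.sqrt_le_sqrt ?_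
  obtain ⟨h1a, h1b⟩ := abs_le.1 h1
  obtain ⟨h2a, h2b⟩ := abs_le.1 h2
  have e1 : 0 ≤ (u - s) - (b u - b s) := by linarith
  have e2 : 0 ≤ (u - s) + (b u - b s) := by linarith
  have e3 : 0 ≤ (v - u) - (b v - b u) := by linarith
  have e4 : 0 ≤ (v - u) + (b v - b u) := by linarith
  nlinarith [mul_nonneg e1 e4, mul_nonneg e2 e3, mul_nonneg e3 e4]

theorem properTime_mono {b : ℝ → ℝ} {τ u v : ℝ}
    (hb : ∀ s t, τ ≤ s → s ≤ t → |b t - b s| ≤ t - s) (hu : τ ≤ u) (huv : u ≤ v) :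
    properTime b τ u ≤ properTime b τ v := by
  refine csSup_le (properTime_nonempty b τ u) ?_
  rintro _ ⟨f, hf, rfl⟩
  -- Freeze the test function at time `u`.
  have : IsSubLapse b τ v fun s => f (min s u) := by
    refine ⟨by simp only [min_eq_left hu]; exact hf.1, fun s t hs hst _ => ?_⟩
    rcases le_total t u with htu | htu
    · simp only [min_eq_left htu, min_eq_left (hst.trans htu)]; exact hf.2 s t hs hst htu
    · simp only [min_eq_right htu]
      rcases le_total s u with hsu | hsu
      · rw [min_eq_left hsu]
        exact (hf.2 s u hs hsu le_rfl).trans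
          (lapse_mono (hb s u hs hsu) (hb u t hu htu))
      · rw [min_eq_right hsu, sub_self]; exact lapse_nonneg _ _ _
  have := this.le_properTime (hu.trans huv)
  simpa only [min_eq_right huv] using this

/-- The speed budget of the pursuit: moving across the line of sight like `b` and along it by the
proper time together needs speed at most `1`. -/
theorem abs_properTime_sub_le {b : ℝ → ℝ} {τ u v : ℝ}
    (hb : ∀ s t, τ ≤ s → s ≤ t → |b t - b s| ≤ t - s) (hu : τ ≤ u) (huv : u ≤ v) :
    (b v - b u) ^ 2 + (properTime b τ v - properTime b τ u) ^ 2 ≤ (v - u) ^ 2 := by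
  have h1 := properTime_mono hb hu huv
  have h2 := properTime_le_add b hu huv
  have h3 : (properTime b τ v - properTime b τ u) ^ 2 ≤ lapse b u v ^ 2 :=
    pow_le_pow_left₀ (by linarith) (by linarith) 2
  have h4 : (b v - b u) ^ 2 ≤ (v - u) ^ 2 := by
    rw [← sq_abs]; exact pow_le_pow_left₀ (abs_nonneg _) (hb u v hu huv) 2
  rw [lapse, Real.sq_sqrt (by linarith)] at h3
  linarith

/-! ### The part of a motion that is observed -/

/-- Times up to which the motion has stayed in the sensing region. -/
def seenTimes (P : Params) (x : ℝ → Plane) (t : ℝ) : Set ℝ :=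
  {s | 0 ≤ s ∧ s ≤ t ∧ ∀ u, 0 ≤ u → u ≤ s → ‖x u‖ ≤ P.R}

/-- For a motion that starts outside the sensing region the set is empty, and the supremum is `0` by
default. -/
def lastSeen (P : Params) (x : ℝ → Plane) (t : ℝ) : ℝ := sSup (seenTimes P x t)

/-- The motion, stopped when it leaves the sensing region. -/
def stopped (P : Params) (x : ℝ → Plane) (t : ℝ) : Plane := x (lastSeen P x t)

theorem seenTimes_bddAbove (P : Params) (x : ℝ → Plane) (t : ℝ) : BddAbove (seenTimes P x t) :=
  ⟨t, fun _ h => h.2.1⟩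

theorem lastSeen_nonneg (P : Params) (x : ℝ → Plane) (t : ℝ) : 0 ≤ lastSeen P x t :=
  Real.sSup_nonneg fun _ h => h.1

theorem lastSeen_le (P : Params) (x : ℝ → Plane) {t : ℝ} (ht : 0 ≤ t) : lastSeen P x t ≤ t :=
  Real.sSup_le (fun _ h => h.2.1) ht

theorem lastSeen_eq {P : Params} {x : ℝ → Plane} {t : ℝ} (ht : 0 ≤ t)
    (h : ∀ u, 0 ≤ u → u ≤ t → ‖x u‖ ≤ P.R) : lastSeen P x t = t :=
  le_antisymm (lastSeen_le P x ht) (le_csSup (seenTimes_bddAbove P x t) ⟨ht, le_rfl, h⟩)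

theorem mem_seenTimes_of_lt {P : Params} {x : ℝ → Plane} {s t : ℝ} (hs : 0 ≤ s) (hst : s ≤ t)
    (h : s < lastSeen P x t) : s ∈ seenTimes P x t := by
  have hne : (seenTimes P x t).Nonempty := by
    by_contra hcon
    rw [lastSeen, not_nonempty_iff_eq_empty.1 hcon, Real.sSup_empty] at h
    linarith
  obtain ⟨u, hu, hsu⟩ := exists_lt_of_lt_csSup hne h
  exact ⟨hs, hst, fun w hw hws => hu.2.2 w hw (hws.trans hsu.le)⟩

theorem lastSeen_mono {P : Params} {x : ℝ → Plane} {s t : ℝ} (hst : s ≤ t) :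
    lastSeen P x s ≤ lastSeen P x t := by
  rcases (seenTimes P x s).eq_empty_or_nonempty with h | h
  · rw [lastSeen, h, Real.sSup_empty]; exact lastSeen_nonneg P x t
  · exact csSup_le_csSup (seenTimes_bddAbove P x t) h fun u hu => ⟨hu.1, hu.2.1.trans hst, hu.2.2⟩

/-- The stopping clock runs at most as fast as time, so stopping a motion preserves its speed bound.
-/
theorem lastSeen_sub_le {P : Params} {x : ℝ → Plane} {s t : ℝ} (hs : 0 ≤ s) (hst : s ≤ t) :
    lastSeen P x t - lastSeen P x s ≤ t - s := by
  rcases lt_or_ge s (lastSeen P x t) with h | h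
  · have h1 := mem_seenTimes_of_lt hs hst h
    have h2 : lastSeen P x s = s := lastSeen_eq hs h1.2.2
    have h3 := lastSeen_le P x (hs.trans hst)
    linarith
  · have : lastSeen P x t ≤ lastSeen P x s := by
      rcases (seenTimes P x t).eq_empty_or_nonempty with he | he
      · rw [lastSeen, he, Real.sSup_empty]; exact lastSeen_nonneg P x s
      · refine csSup_le_csSup (seenTimes_bddAbove P x s) he fun u hu => ?_
        exact ⟨hu.1, (le_csSup (seenTimes_bddAbove P x t) hu).trans h, hu.2.2⟩
    linarith

theorem stopped_isMotion {P : Params} {v : ℝ} (hv : 0 ≤ v) {x : ℝ → Plane} (hx : IsMotion v x) :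
    IsMotion v (stopped P x) := fun s _ hs hst =>
  (hx _ _ (lastSeen_nonneg P x s) (lastSeen_mono hst)).trans
    (mul_le_mul_of_nonneg_left (lastSeen_sub_le hs hst) hv)

/-- The supremum need not be known to be attained: the bound holds at all earlier times and passes
to the limit by continuity. -/
theorem norm_lastSeen_le {P : Params} {v : ℝ} {x : ℝ → Plane} (hx : IsMotion v x)
    (h0 : ‖x 0‖ ≤ P.R) (t : ℝ) : ‖x (lastSeen P x t)‖ ≤ P.R := by
  rcases (lastSeen_nonneg P x t).eq_or_lt with h | h
  · rw [← h]; exact h0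
  have hlt : ∀ s ∈ Ico 0 (lastSeen P x t), ‖x s‖ ≤ P.R := fun s hs => by
    have hne : (seenTimes P x t).Nonempty := by
      by_contra hcon
      rw [lastSeen, not_nonempty_iff_eq_empty.1 hcon, Real.sSup_empty] at h
      exact lt_irrefl _ h
    obtain ⟨u, hu, hsu⟩ := exists_lt_of_lt_csSup hne hs.2
    exact hu.2.2 s hs.1 hsu.le
  have hcl : lastSeen P x t ∈ closure (Ico 0 (lastSeen P x t)) := by
    rw [closure_Ico h.ne]; exact ⟨h.le, le_rfl⟩
  have hc : ContinuousWithinAt (fun s => ‖x s‖) (Ico 0 (lastSeen P x t)) (lastSeen P x t) :=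
    ((hx.continuousOn.norm) _ (lastSeen_nonneg P x t)).mono fun s hs => hs.1
  exact hc.closure_le hcl continuousWithinAt_const hlt

theorem SameObs.symm {P : Params} {t : ℝ} {x x' : ℝ → Plane} (h : SameObs P t x x') :
    SameObs P t x' x := fun s hs hst hR => (h s hs hst hR.symm).symm

theorem SameObs.seenTimes_subset {P : Params} {t : ℝ} {x x' : ℝ → Plane} (h : SameObs P t x x')
    {s : ℝ} (hst : s ≤ t) : seenTimes P x s ⊆ seenTimes P x' s := fun u hu =>
  ⟨hu.1, hu.2.1, fun w hw hwu => by
    rw [← h w hw (hwu.trans (hu.2.1.trans hst)) (Or.inl (hu.2.2 w hw hwu))]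
    exact hu.2.2 w hw hwu⟩

theorem SameObs.lastSeen_eq {P : Params} {t : ℝ} {x x' : ℝ → Plane} (h : SameObs P t x x')
    {s : ℝ} (hst : s ≤ t) : lastSeen P x s = lastSeen P x' s :=
  congrArg sSup (Subset.antisymm (h.seenTimes_subset hst) (h.symm.seenTimes_subset hst))

/-- Stated for differences because two motions that start outside the sensing region look alike but
are stopped at possibly different points; both stopped motions are then constant. -/
theorem SameObs.stopped_sub_eq {P : Params} {v t : ℝ} {x x' : ℝ → Plane} (h : SameObs P t x x')
    (hx : IsMotion v x) {s u : ℝ} (hs : 0 ≤ s) (hst : s ≤ t) (hu : 0 ≤ u) (hut : u ≤ t) :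
    stopped P x s - stopped P x u = stopped P x' s - stopped P x' u := by
  by_cases h0 : ‖x 0‖ ≤ P.R
  · have key : ∀ s, 0 ≤ s → s ≤ t → stopped P x s = stopped P x' s := fun s hs hst => by
      rw [stopped, stopped, ← h.lastSeen_eq hst]
      exact h _ (lastSeen_nonneg P x s) ((lastSeen_le P x hs).trans hst)
        (Or.inl (norm_lastSeen_le hx h0 s))
    rw [key s hs hst, key u hu hut]
  · have key : ∀ s, lastSeen P x s = 0 := fun s => by
      have : seenTimes P x s = ∅ :=
        eq_empty_of_forall_notMem fun u hu => h0 (hu.2.2 0 le_rfl hu.1)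
      rw [lastSeen, this, Real.sSup_empty]
    simp only [stopped, ← h.lastSeen_eq hst, ← h.lastSeen_eq hut, key, sub_self]

/-! ### Pursuit with constant direction of the line of sight -/

/-- Component of the observed motion orthogonal to `dir θ`. -/
def crossComp (P : Params) (θ : ℝ) (x : ℝ → Plane) (t : ℝ) : ℝ :=
  -Real.sin θ * stopped P x t 0 + Real.cos θ * stopped P x t 1

theorem crossComp_sub_le {P : Params} {θ v : ℝ} (hv : 0 ≤ v) (hv1 : v ≤ 1) {x : ℝ → Plane}
    (hx : IsMotion v x) (s t : ℝ) (hs : 0 ≤ s) (hst : s ≤ t) :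
    |crossComp P θ x t - crossComp P θ x s| ≤ t - s := by
  have h1 := stopped_isMotion (P := P) hv hx s t hs hst
  have h2 : v * (t - s) ≤ t - s := mul_le_of_le_one_left (sub_nonneg.2 hst) hv1
  have h3 := (Plane.norm_le_iff (sub_nonneg.2 hst)).1 (h1.trans h2)
  simp only [PiLp.sub_apply] at h3
  refine abs_le_of_sq_le_sq ?_ (sub_nonneg.2 hst)
  simp only [crossComp]
  nlinarith [Real.sin_sq_add_cos_sq θ, sq_nonneg (Real.cos θ * (stopped P x t 0 - stopped P x s 0) +
    Real.sin θ * (stopped P x t 1 - stopped P x s 1))]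

/-- Follow the path `p` until time `τ`; from then on, keep the direction `dir θ` of the line of
sight while making full use of the speed. -/
def pursuitMove (P : Params) (p : ℝ → Plane) (τ θ : ℝ) (x : ℝ → Plane) (t : ℝ) : Plane :=
  if t ≤ τ then p t else
    p τ + !₂[-Real.sin θ * (crossComp P θ x t - crossComp P θ x τ) -
        Real.cos θ * properTime (crossComp P θ x) τ t,
      Real.cos θ * (crossComp P θ x t - crossComp P θ x τ) -
        Real.sin θ * properTime (crossComp P θ x) τ t]

theorem pursuitMove_of_le (P : Params) (p : ℝ → Plane) {τ t : ℝ} (θ : ℝ) (x : ℝ → Plane)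
    (h : t ≤ τ) : pursuitMove P p τ θ x t = p t := if_pos h

theorem pursuitMove_of_ge (P : Params) (p : ℝ → Plane) {τ t : ℝ} (θ : ℝ) (x : ℝ → Plane)
    (h : τ ≤ t) : pursuitMove P p τ θ x t =
    p τ + !₂[-Real.sin θ * (crossComp P θ x t - crossComp P θ x τ) -
        Real.cos θ * properTime (crossComp P θ x) τ t,
      Real.cos θ * (crossComp P θ x t - crossComp P θ x τ) -
        Real.sin θ * properTime (crossComp P θ x) τ t] := by
  rcases h.eq_or_lt with rfl | h
  · rw [pursuitMove_of_le _ _ _ _ le_rfl, properTime_self]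
    refine Plane.ext ?_ ?_ <;> simp
  · exact if_neg (not_le.2 h)

/-- The strategy of following the path `p` until time `τ` and pursuing the intruder afterwards. -/
def pursuit (P : Params) (hν : 0 ≤ P.ν) (hν1 : P.ν ≤ 1) {y : Plane} (p : ℝ → Plane) {τ : ℝ}
    (hτ : 0 ≤ τ) (θ : ℝ) (hp0 : p 0 = y)
    (hp : ∀ s t : ℝ, 0 ≤ s → s ≤ t → t ≤ τ → ‖p t - p s‖ ≤ t - s) : DefenderStrategy P y where
  move := pursuitMove P p τ θ
  start := fun x _ => by rw [pursuitMove_of_le P p θ x hτ, hp0]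
  speed := fun x hx => by
    refine IsMotion.glue (fun s t hs hst ht => by rw [one_mul]; exact hp s t hs hst ht) ?_
      (by simp [properTime_self])
    intro s t hs hst
    rw [one_mul, add_sub_add_left_eq_sub, Plane.norm_le_iff (sub_nonneg.2 hst)]
    have h := abs_properTime_sub_le (b := crossComp P θ x) (τ := τ) (u := s) (v := t)
      (fun s t hs hst => crossComp_sub_le hν hν1 hx s t (hτ.trans hs) hst) hs hst
    refine le_trans (le_of_eq ?_) h
    simp
    linear_combination ((crossComp P θ x t - crossComp P θ x s) ^ 2 +
      (properTime (crossComp P θ x) τ t - properTime (crossComp P θ x) τ s) ^ 2) *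
      Real.sin_sq_add_cos_sq θ
  causal := fun x x' hx hx' t ht h => by
    rcases le_total t τ with htτ | htτ
    · rw [pursuitMove_of_le _ _ _ _ htτ, pursuitMove_of_le _ _ _ _ htτ]
    · have key : ∀ u v, τ ≤ u → u ≤ v → v ≤ t →
          crossComp P θ x v - crossComp P θ x u = crossComp P θ x' v - crossComp P θ x' u := by
        intro u v hu huv hv
        have e := h.stopped_sub_eq hx (hτ.trans (hu.trans huv)) hv (hτ.trans hu) (huv.trans hv)
        have e0 := congrArg (fun z : Plane => z 0) e
        have e1 := congrArg (fun z : Plane => z 1) e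
        simp only [PiLp.sub_apply] at e0 e1
        simp only [crossComp]
        linear_combination -Real.sin θ * e0 + Real.cos θ * e1
      rw [pursuitMove_of_ge _ _ _ _ htτ, pursuitMove_of_ge _ _ _ _ htτ, properTime_congr key,
        key τ t le_rfl htτ le_rfl]

/-! ### Parameters -/

/-- Largest distance from the center at which an intruder is captured. -/
def Params.c (P : Params) : ℝ := P.rT + 2 * P.γ * P.ρA

namespace Params.Regime

theorem k_pos {P : Params} (hP : P.Regime) : 0 < 1 - P.ν ^ 2 := by nlinarith [hP.ν_pos, hP.ν_lt_one]

theorem γ_mul {P : Params} (hP : P.Regime) : P.γ * (1 - P.ν ^ 2) = P.ν := div_mul_cancel₀ _ hP.k_pos.ne'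

theorem β_eq {P : Params} (_ : P.Regime) : P.β = P.ν * P.γ := by rw [Params.β, Params.γ]; ring

theorem γ_pos {P : Params} (hP : P.Regime) : 0 < P.γ := div_pos hP.ν_pos hP.k_pos

theorem β_pos {P : Params} (hP : P.Regime) : 0 < P.β := by rw [hP.β_eq]; exact mul_pos hP.ν_pos hP.γ_pos

theorem γ_eq {P : Params} (hP : P.Regime) : P.γ = P.ν * (1 + P.β) := by
  rw [hP.β_eq]; linear_combination hP.γ_mul

theorem γ_sq {P : Params} (hP : P.Regime) : P.γ ^ 2 = P.β ^ 2 + P.β := by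
  rw [hP.β_eq]; linear_combination P.γ * hP.γ_mul

theorem ρT_ge {P : Params} (hP : P.Regime) : (1 + 2 * P.γ) * P.ρA ≤ P.ρT := by
  refine le_trans (le_of_eq ?_) ((le_max_left _ _).trans hP.large)
  rw [Params.γ]; ring

theorem ρT_ge' {P : Params} (hP : P.Regime) : P.ν * P.rT + 2 * P.β * P.ρA ≤ P.ρT := by
  refine le_trans (le_of_eq ?_) ((le_max_right _ _).trans hP.large)
  rw [Params.β]; ring

theorem ρT_pos {P : Params} (hP : P.Regime) : 0 < P.ρT := by
  have := hP.ρT_ge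
  nlinarith [hP.ρA_pos, hP.γ_pos, mul_pos hP.γ_pos hP.ρA_pos]

theorem c_pos {P : Params} (hP : P.Regime) : 0 < P.c := by
  rw [Params.c]; nlinarith [hP.rT_pos, mul_pos hP.γ_pos hP.ρA_pos]

/-- First entry of the maximum in the regime: a defender that has just captured within distance `c`
is at distance at least `ρA` from every point of the arrival circle. -/
theorem c_le {P : Params} (hP : P.Regime) : P.c ≤ P.R - P.ρA := by
  rw [Params.c, Params.R]; linarith [hP.ρT_ge]

/-- Second entry of the maximum: from within distance `c` the defender is home before an undetected
intruder reaches the target. -/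
theorem c_le' {P : Params} (hP : P.Regime) : P.c ≤ P.ρT / P.ν := by
  rw [le_div_iff₀ hP.ν_pos, Params.c]
  have := hP.ρT_ge'
  rw [hP.β_eq] at this
  linarith

end Params.Regime

/-! ### Outcome of the pursuit -/

/-- In line-of-sight coordinates the intruder has moved by `(α, b)` and the defender started at
`(ρA, 0)`. The quadratic inequality describes the Apollonius disc, of centre `C` and radius `γρA`;
by `hC` this disc is tangent to the target from outside, so its points have norm between `rT` and
`rT + 2γρA`. -/
theorem norm_apollonius {P : Params} (hP : P.Regime) {a θ α b : ℝ}
    (hC : (a - P.β * P.ρA * Real.cos θ) ^ 2 + (P.β * P.ρA * Real.sin θ) ^ 2 =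
      (P.rT + P.γ * P.ρA) ^ 2) {w : Plane}
    (hw0 : w 0 = a + (Real.cos θ * α - Real.sin θ * b))
    (hw1 : w 1 = Real.sin θ * α + Real.cos θ * b) :
    (α ^ 2 + b ^ 2 ≤ P.ν ^ 2 * (b ^ 2 + (P.ρA - α) ^ 2) → P.rT ≤ ‖w‖ ∧ ‖w‖ ≤ P.c) ∧
    (α ^ 2 + b ^ 2 < P.ν ^ 2 * (b ^ 2 + (P.ρA - α) ^ 2) → P.rT < ‖w‖) := by
  have hγρ := mul_pos hP.γ_pos hP.ρA_pos
  set C : Plane := !₂[a - P.β * P.ρA * Real.cos θ, -(P.β * P.ρA * Real.sin θ)] with hCdef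
  have hCn : ‖C‖ = P.rT + P.γ * P.ρA := by
    refine (sq_eq_sq₀ (norm_nonneg _) (by linarith [hP.rT_pos])).1 ?_
    rw [Plane.norm_sq, ← hC]; simp [hCdef]
  have hk := hP.k_pos
  have hwC : ‖w - C‖ ^ 2 = α ^ 2 + b ^ 2 + 2 * P.β * P.ρA * α + P.β ^ 2 * P.ρA ^ 2 := by
    rw [Plane.norm_sq]
    simp only [PiLp.sub_apply, hw0, hw1]
    simp [hCdef]
    linear_combination (α ^ 2 + b ^ 2 + 2 * P.β * P.ρA * α + P.β ^ 2 * P.ρA ^ 2) *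
      Real.sin_sq_add_cos_sq θ
  have hβk : P.β * (1 - P.ν ^ 2) = P.ν ^ 2 := by
    rw [hP.β_eq]; linear_combination P.ν * hP.γ_mul
  have hid : (1 - P.ν ^ 2) * (‖w - C‖ ^ 2 - (P.γ * P.ρA) ^ 2) =
      α ^ 2 + b ^ 2 - P.ν ^ 2 * (b ^ 2 + (P.ρA - α) ^ 2) := by
    rw [hwC, mul_pow, hP.γ_sq]
    linear_combination (2 * P.ρA * α - P.ρA ^ 2) * hβk
  have h1 : ‖C‖ ≤ ‖w‖ + ‖w - C‖ := by
    have := norm_sub_le w (w - C); rwa [sub_sub_cancel] at this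
  have h2 : ‖w‖ ≤ ‖C‖ + ‖w - C‖ := by
    have := norm_add_le C (w - C); rwa [add_sub_cancel] at this
  constructor
  · intro h
    have h3 : ‖w - C‖ ≤ P.γ * P.ρA :=
      (sq_le_sq₀ (norm_nonneg _) hγρ.le).1 (by nlinarith)
    rw [Params.c]
    constructor <;> linarith
  · intro h
    have h3 : ‖w - C‖ < P.γ * P.ρA :=
      (sq_lt_sq₀ (norm_nonneg _) hγρ.le).1 (by nlinarith)
    linarith

/-- The test function is the norm of the vector `F = (α / ν, √(1/ν² - 1) b)`. An increment satisfies
`‖ΔF‖² = ‖Δz‖² / ν² - (Δb)²`, which the speed bound makes at most the squared lapse. -/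
theorem sqrt_le_properTime {P : Params} (hP : P.Regime) {z : ℝ → Plane} {τ θ : ℝ}
    (hz : ∀ s t, τ ≤ s → s ≤ t → ‖z t - z s‖ ≤ P.ν * (t - s)) (hz0 : z τ = 0) {t : ℝ} (ht : τ ≤ t) :
    Real.sqrt ((Real.cos θ * z t 0 + Real.sin θ * z t 1) ^ 2 / P.ν ^ 2 +
      (1 / P.ν ^ 2 - 1) * (-Real.sin θ * z t 0 + Real.cos θ * z t 1) ^ 2) ≤
    properTime (fun s => -Real.sin θ * z s 0 + Real.cos θ * z s 1) τ t := by
  have hν := hP.ν_pos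
  have hk : 0 ≤ 1 / P.ν ^ 2 - 1 := by
    rw [sub_nonneg, le_div_iff₀ (by positivity)]; linarith [hP.k_pos]
  set F : ℝ → Plane := fun s => !₂[(Real.cos θ * z s 0 + Real.sin θ * z s 1) / P.ν,
    Real.sqrt (1 / P.ν ^ 2 - 1) * (-Real.sin θ * z s 0 + Real.cos θ * z s 1)] with hF
  have hFt : ∀ s, ‖F s‖ = Real.sqrt ((Real.cos θ * z s 0 + Real.sin θ * z s 1) ^ 2 / P.ν ^ 2 +
      (1 / P.ν ^ 2 - 1) * (-Real.sin θ * z s 0 + Real.cos θ * z s 1) ^ 2) := fun s => by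
    rw [← Real.sqrt_sq (norm_nonneg (F s)), Plane.norm_sq]
    simp only [hF, PiLp.toLp_apply, Matrix.cons_val_zero, Matrix.cons_val_one, mul_pow,
      Real.sq_sqrt hk, div_pow]
  rw [← hFt]
  refine IsSubLapse.le_properTime (f := fun s => ‖F s‖) ⟨?_, fun u v hu huv _ => ?_⟩ ht
  · simp [hFt, hz0]
  · refine (norm_sub_norm_le _ _).trans ?_
    rw [lapse]
    refine Real.le_sqrt_of_sq_le ?_
    have h1 := (Plane.norm_le_iff (mul_nonneg hν.le (sub_nonneg.2 huv))).1 (hz u v hu huv)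
    simp only [PiLp.sub_apply] at h1
    rw [Plane.norm_sq]
    simp only [hF, PiLp.sub_apply, Matrix.cons_val_zero, Matrix.cons_val_one]
    have e : ((Real.cos θ * z v 0 + Real.sin θ * z v 1) / P.ν -
        (Real.cos θ * z u 0 + Real.sin θ * z u 1) / P.ν) ^ 2 +
        (Real.sqrt (1 / P.ν ^ 2 - 1) * (-Real.sin θ * z v 0 + Real.cos θ * z v 1) -
          Real.sqrt (1 / P.ν ^ 2 - 1) * (-Real.sin θ * z u 0 + Real.cos θ * z u 1)) ^ 2 =
        ((z v 0 - z u 0) ^ 2 + (z v 1 - z u 1) ^ 2) / P.ν ^ 2 -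
        ((-Real.sin θ * z v 0 + Real.cos θ * z v 1) -
          (-Real.sin θ * z u 0 + Real.cos θ * z u 1)) ^ 2 := by
      rw [← mul_sub (Real.sqrt _), mul_pow, Real.sq_sqrt hk]
      field_simp
      linear_combination ((z v 0 - z u 0) ^ 2 + (z v 1 - z u 1) ^ 2) * Real.sin_sq_add_cos_sq θ
    rw [e, sub_le_sub_iff_right, div_le_iff₀ (by positivity)]
    linarith

/-- The gap along the line of sight closes at rate at least `1 - ν`; this makes the capture time
finite. -/
theorem le_properTime_add {P : Params} (hP : P.Regime) {z : ℝ → Plane} {τ θ : ℝ}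
    (hz : ∀ s t, τ ≤ s → s ≤ t → ‖z t - z s‖ ≤ P.ν * (t - s)) (hz0 : z τ = 0) {t : ℝ} (ht : τ ≤ t) :
    (1 - P.ν) * (t - τ) - (Real.cos θ * z t 0 + Real.sin θ * z t 1) ≤
    properTime (fun s => -Real.sin θ * z s 0 + Real.cos θ * z s 1) τ t := by
  have hν := hP.ν_pos
  have hν1 := hP.ν_lt_one
  refine IsSubLapse.le_properTime
    (f := fun t => (1 - P.ν) * (t - τ) - (Real.cos θ * z t 0 + Real.sin θ * z t 1))
    ⟨by simp [hz0], fun u v hu huv _ => ?_⟩ ht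
  refine Real.le_sqrt_of_sq_le ?_ |>.trans le_rfl
  have h1 := (Plane.norm_le_iff (mul_nonneg hν.le (sub_nonneg.2 huv))).1 (hz u v hu huv)
  simp only [PiLp.sub_apply] at h1
  set T := v - u with hT
  have hT0 : 0 ≤ T := sub_nonneg.2 huv
  set A := Real.cos θ * (z v 0 - z u 0) + Real.sin θ * (z v 1 - z u 1) with hA
  set B := -Real.sin θ * (z v 0 - z u 0) + Real.cos θ * (z v 1 - z u 1) with hB
  have hAB : A ^ 2 + B ^ 2 ≤ (P.ν * T) ^ 2 := by
    refine le_trans (le_of_eq ?_) h1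
    simp only [hA, hB]
    linear_combination ((z v 0 - z u 0) ^ 2 + (z v 1 - z u 1) ^ 2) * Real.sin_sq_add_cos_sq θ
  have hAl : -(P.ν * T) ≤ A :=
    (abs_le.1 (abs_le_of_sq_le_sq (by nlinarith [sq_nonneg B]) (mul_nonneg hν.le hT0))).1
  have e1 : (1 - P.ν) * (v - τ) - (Real.cos θ * z v 0 + Real.sin θ * z v 1) -
      ((1 - P.ν) * (u - τ) - (Real.cos θ * z u 0 + Real.sin θ * z u 1)) = (1 - P.ν) * T - A := by
    simp only [hA, hT]; ring
  have e2 : -Real.sin θ * z v 0 + Real.cos θ * z v 1 -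
      (-Real.sin θ * z u 0 + Real.cos θ * z u 1) = B := by simp only [hB]; ring
  rw [e1, e2]
  nlinarith [mul_nonneg (sub_nonneg.2 hν1.le) hT0,
    mul_nonneg (mul_nonneg (sub_nonneg.2 hν1.le) hT0) (by linarith : 0 ≤ A + P.ν * T)]

/-- A stopped motion that stands strictly inside the sensing region cannot have been stopped: by
continuity it would have been seen a little longer. -/
theorem lastSeen_eq_of_lt {P : Params} {v t : ℝ} {x : ℝ → Plane} (hx : IsMotion v x)
    (ht : 0 ≤ t) (h : ‖stopped P x t‖ < P.R) : lastSeen P x t = t := by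
  by_contra hne
  have hlt : lastSeen P x t < t := lt_of_le_of_ne (lastSeen_le P x ht) hne
  have he := lastSeen_nonneg P x t
  have hc := (hx.continuousOn.norm) (lastSeen P x t) he
  obtain ⟨δ, hδ, hball⟩ := Metric.mem_nhdsWithin_iff.1 (hc (Iio_mem_nhds h))
  have hmem : min t (lastSeen P x t + δ / 2) ∈ seenTimes P x t := by
    refine ⟨le_min ht (by linarith), min_le_left _ _, fun u hu hut => ?_⟩
    rcases lt_or_ge u (lastSeen P x t) with hul | hul
    · exact (mem_seenTimes_of_lt hu (hul.le.trans hlt.le) hul).2.2 u hu le_rfl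
    · have : u ∈ Metric.ball (lastSeen P x t) δ ∩ Ici 0 := by
        refine ⟨?_, hu⟩
        rw [Metric.mem_ball, Real.dist_eq, abs_of_nonneg (by linarith)]
        linarith [hut.trans (min_le_right _ _)]
      exact (hball this).le
  have := le_csSup (seenTimes_bddAbove P x t) hmem
  have h2 : lastSeen P x t < min t (lastSeen P x t + δ / 2) := lt_min hlt (by linarith)
  exact absurd this (not_le.2 h2)

/-- The outcome of following the undetected path `p` to a point of tangency and pursuing from
there on. -/
theorem pursuit_outcome {P : Params} (hP : P.Regime) {y : Plane} {p : ℝ → Plane} {τ θ : ℝ}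
    (hτ : 0 ≤ τ) (hp0 : p 0 = y)
    (hp : ∀ s t : ℝ, 0 ≤ s → s ≤ t → t ≤ τ → ‖p t - p s‖ ≤ t - s)
    (hτT : P.ν * τ ≤ P.ρT)
    (hC : (P.R - P.ν * τ - P.β * P.ρA * Real.cos θ) ^ 2 + (P.β * P.ρA * Real.sin θ) ^ 2 =
      (P.rT + P.γ * P.ρA) ^ 2)
    (hfar : ∀ s, 0 ≤ s → s < τ → P.ρA < ‖radial P 0 s - p s‖)
    (hpτ : p τ = engagementPoint P (τ, θ)) :
    EngagesAt P (pursuit P hP.ν_pos.le hP.ν_lt_one.le p hτ θ hp0 hp) (τ, θ) ∧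
      ∀ (U : Plane → ENNReal) (m : ENNReal), (∀ x, ‖x‖ ≤ P.c → m ≤ U x) →
        1 + m ≤ guarantee P U 0 (pursuit P hP.ν_pos.le hP.ν_lt_one.le p hτ θ hp0 hp) := by
  have hν := hP.ν_pos
  have hρ := hP.ρA_pos
  set σ := pursuit P hP.ν_pos.le hP.ν_lt_one.le p hτ θ hp0 hp with hσ
  have hmove : ∀ x t, σ.move x t = pursuitMove P p τ θ x t := fun _ _ => rfl
  have hrad : ∀ x, IsPlay P 0 σ x → (∀ s, 0 ≤ s → s ≤ τ → x s = radial P 0 s) ∧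
      ∀ s, 0 ≤ s → s < τ → P.ρA < ‖x s - σ.move x s‖ := fun x hx =>
    hx.eq_radial fun s hs hsτ => by
      rw [hmove, pursuitMove_of_le _ _ _ _ hsτ.le]; exact hfar s hs hsτ
  refine ⟨fun x hx => ⟨(hrad x hx).2, (hrad x hx).1 τ hτ le_rfl, ?_⟩, fun U m hU => ?_⟩
  · rw [hmove, pursuitMove_of_le _ _ _ _ le_rfl, hpτ]
  refine le_iInf₂ fun x hx => ?_
  obtain ⟨hxr, hxfar⟩ := hrad x hx
  have hR : P.rT + P.ρT = P.R := rfl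
  have hnorm : ∀ s, 0 ≤ s → s ≤ τ → ‖x s‖ = P.R - P.ν * s := fun s hs hsτ => by
    have := mul_le_mul_of_nonneg_left hsτ hν.le
    rw [hxr s hs hsτ, norm_radial]
    linarith [hP.rT_pos]
  have hseen : ∀ s, 0 ≤ s → s ≤ τ → lastSeen P x s = s := fun s hs hsτ =>
    lastSeen_eq hs fun u hu hus => by
      rw [hnorm u hu (hus.trans hsτ)]; linarith [mul_nonneg hν.le hu]
  set w := stopped P x with hw
  have hwm : IsMotion P.ν w := stopped_isMotion hν.le hx.motion
  have hwτ : w τ = radial P 0 τ := by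
    rw [hw, stopped, hseen τ hτ le_rfl, hxr τ hτ le_rfl]
  set z : ℝ → Plane := fun s => w s - radial P 0 τ with hzdef
  have hz : ∀ s t, τ ≤ s → s ≤ t → ‖z t - z s‖ ≤ P.ν * (t - s) := fun s t hs hst => by
    simp only [hzdef, sub_sub_sub_cancel_right]; exact hwm s t (hτ.trans hs) hst
  have hz0 : z τ = 0 := by simp only [hzdef, hwτ, sub_self]
  set b : ℝ → ℝ := fun s => -Real.sin θ * z s 0 + Real.cos θ * z s 1 with hb
  set α : ℝ → ℝ := fun s => Real.cos θ * z s 0 + Real.sin θ * z s 1 with hα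
  have hbdiff : ∀ u v, crossComp P θ x v - crossComp P θ x u = b v - b u := fun u v => by
    simp only [crossComp, hb, hzdef, PiLp.sub_apply, hw]; ring
  have hbτ : b τ = 0 := by simp [hb, hz0]
  have hLeq : ∀ t, properTime (crossComp P θ x) τ t = properTime b τ t := fun t =>
    properTime_congr fun u v _ _ _ => hbdiff u v
  have hblip : ∀ s t, τ ≤ s → s ≤ t → |b t - b s| ≤ t - s := fun s t hs hst => by
    rw [← hbdiff]; exact crossComp_sub_le hν.le hP.ν_lt_one.le hx.motion s t (hτ.trans hs) hst
  -- Signed length of the line of sight: the defender stays at the intruder's position plus `lam •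
  -- dir θ`, as `hdiff` confirms once the intruder is known to be visible.
  set lam : ℝ → ℝ := fun s => P.ρA - properTime b τ s - α s with hlam
  have hlamc : ContinuousOn lam (Ici τ) := by
    have h1 : ContinuousOn (properTime b τ) (Ici τ) := by
      have : LipschitzOnWith 1 (properTime b τ) (Ici τ) := by
        refine LipschitzOnWith.of_dist_le_mul ?_
        have key : ∀ s t, τ ≤ s → s ≤ t →
            dist (properTime b τ t) (properTime b τ s) ≤ dist t s := fun s t hs hst => by
          have := abs_properTime_sub_le hblip hs hst
          rw [Real.dist_eq, Real.dist_eq]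
          exact sq_le_sq.1 (by nlinarith [sq_nonneg (b t - b s)])
        intro s hs t ht
        rw [NNReal.coe_one, one_mul]
        rcases le_total s t with hst | hst
        · rw [dist_comm, dist_comm s t]; exact key s t hs hst
        · exact key t s ht hst
      exact this.continuousOn
    have h2 : ContinuousOn w (Ici τ) := hwm.continuousOn.mono (Ici_subset_Ici.2 hτ)
    have h3 : ContinuousOn z (Ici τ) := h2.sub continuousOn_const
    have h4 : ∀ i : Fin 2, ContinuousOn (fun s => z s i) (Ici τ) := fun i =>
      (EuclideanSpace.proj (𝕜 := ℝ) i).continuous.comp_continuousOn h3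
    exact (continuousOn_const.sub h1).sub
      ((continuousOn_const.mul (h4 0)).add (continuousOn_const.mul (h4 1)))
  have hlamτ : lam τ = P.ρA := by simp [hlam, properTime_self, hα, hz0]
  -- the first zero of `lam`
  obtain ⟨T, hT1, hT2, hT3⟩ : ∃ T, τ ≤ T ∧ lam T = 0 ∧ ∀ s, τ ≤ s → s < T → 0 < lam s := by
    -- The gap is `ρA` at time `τ` and closes at rate at least `1 - ν`.
    set T' := τ + P.ρA / (1 - P.ν) with hT'
    have h1ν : 0 < 1 - P.ν := sub_pos.2 hP.ν_lt_one
    have hT'τ : τ ≤ T' := le_add_of_nonneg_right (div_nonneg hρ.le h1ν.le)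
    have hneg : lam T' ≤ 0 := by
      have := le_properTime_add hP hz hz0 (θ := θ) hT'τ
      have e : (1 - P.ν) * (T' - τ) = P.ρA := by
        rw [hT', add_sub_cancel_left]; exact mul_div_cancel₀ _ h1ν.ne'
      rw [e] at this
      simp only [hlam, hα]
      linarith
    have hcl : IsClosed (Icc τ T' ∩ lam ⁻¹' Iic 0) :=
      (hlamc.mono Icc_subset_Ici_self).preimage_isClosed_of_isClosed isClosed_Icc isClosed_Iic
    obtain ⟨T, ⟨hT, hTneg⟩, hmin⟩ :=
      (isCompact_Icc.of_isClosed_subset hcl inter_subset_left).exists_isLeast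
        ⟨T', ⟨hT'τ, le_rfl⟩, hneg⟩
    have hpos : ∀ s, τ ≤ s → s < T → 0 < lam s := fun s hs hsT => by
      by_contra hcon
      exact absurd (hmin ⟨⟨hs, hsT.le.trans hT.2⟩, not_lt.1 hcon⟩) (not_le.2 hsT)
    refine ⟨T, hT.1, le_antisymm hTneg ?_, hpos⟩
    have hlt : τ < T := by
      refine lt_of_le_of_ne hT.1 fun h => ?_
      have : lam T ≤ 0 := hTneg
      rw [← h, hlamτ] at this
      linarith
    have hcl' : T ∈ closure (Ico τ T) := by rw [closure_Ico hlt.ne]; exact ⟨hT.1, le_rfl⟩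
    exact ContinuousWithinAt.closure_le hcl' continuousWithinAt_const
      ((hlamc T hT.1).mono Ico_subset_Ici_self) fun s hs => (hpos s hs.1 hs.2).le
  have hlam0 : ∀ s, τ ≤ s → s ≤ T → 0 ≤ lam s := fun s hs hsT => by
    rcases hsT.eq_or_lt with rfl | h
    · exact hT2.ge
    · exact (hT3 s hs h).le
  -- A nonnegative gap bounds the proper time by `ρA - α`. Squaring the lower bound of
  -- `sqrt_le_properTime` gives exactly the Apollonius inequality.
  have happ : ∀ s, τ ≤ s → 0 ≤ lam s →
      (α s ^ 2 + b s ^ 2 ≤ P.ν ^ 2 * (b s ^ 2 + (P.ρA - α s) ^ 2)) ∧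
      (0 < lam s → α s ^ 2 + b s ^ 2 < P.ν ^ 2 * (b s ^ 2 + (P.ρA - α s) ^ 2)) := by
    intro s hs hl
    have h1 := sqrt_le_properTime hP hz hz0 (θ := θ) hs
    have h2 : (α s ^ 2 + b s ^ 2 - P.ν ^ 2 * b s ^ 2) / P.ν ^ 2 =
        α s ^ 2 / P.ν ^ 2 + (1 / P.ν ^ 2 - 1) * b s ^ 2 := by field_simp; ring
    have h3 := Real.sqrt_nonneg (α s ^ 2 / P.ν ^ 2 + (1 / P.ν ^ 2 - 1) * b s ^ 2)
    have h5 : Real.sqrt (α s ^ 2 / P.ν ^ 2 + (1 / P.ν ^ 2 - 1) * b s ^ 2) ≤ properTime b τ s := h1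
    have hn : 0 ≤ α s ^ 2 / P.ν ^ 2 + (1 / P.ν ^ 2 - 1) * b s ^ 2 := by
      have : 0 ≤ 1 / P.ν ^ 2 - 1 := by
        rw [sub_nonneg, le_div_iff₀ (by positivity)]; linarith [hP.k_pos]
      positivity
    have hν2 : 0 < P.ν ^ 2 := by positivity
    simp only [hlam] at hl ⊢
    constructor
    · have h4 := Real.sqrt_le_left (by linarith : 0 ≤ P.ρA - α s) |>.1 (by linarith : Real.sqrt
        (α s ^ 2 / P.ν ^ 2 + (1 / P.ν ^ 2 - 1) * b s ^ 2) ≤ P.ρA - α s)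
      rw [← h2, div_le_iff₀ hν2] at h4
      linarith
    · intro hpos
      have h4 := (Real.sqrt_lt' (by linarith : 0 < P.ρA - α s)).1 (by linarith : Real.sqrt
        (α s ^ 2 / P.ν ^ 2 + (1 / P.ν ^ 2 - 1) * b s ^ 2) < P.ρA - α s)
      rw [← h2, div_lt_iff₀ hν2] at h4
      linarith
  have hw0 : ∀ s, w s 0 = P.R - P.ν * τ + (Real.cos θ * α s - Real.sin θ * b s) := fun s => by
    simp only [hα, hb, hzdef, PiLp.sub_apply, radial_zero_apply_zero, radial_zero_apply_one]
    linear_combination (-(w s 0 - (P.R - P.ν * τ))) * Real.sin_sq_add_cos_sq θ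
  have hw1 : ∀ s, w s 1 = Real.sin θ * α s + Real.cos θ * b s := fun s => by
    simp only [hα, hb, hzdef, PiLp.sub_apply, radial_zero_apply_zero, radial_zero_apply_one]
    linear_combination (-(w s 1)) * Real.sin_sq_add_cos_sq θ
  have hin : ∀ s, τ ≤ s → s ≤ T → P.rT ≤ ‖w s‖ ∧ ‖w s‖ ≤ P.c := fun s hs hsT =>
    (norm_apollonius hP hC (hw0 s) (hw1 s)).1 (happ s hs (hlam0 s hs hsT)).1
  -- The strategy follows only the stopped motion `w`. Since `w` stays within `c < R`, nothing has
  -- been stopped, and `w` is the true intruder.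
  have hxw : ∀ s, τ ≤ s → s ≤ T → x s = w s := fun s hs hsT => by
    rw [hw, stopped, lastSeen_eq_of_lt hx.motion (hτ.trans hs)]
    refine (hin s hs hsT).2.trans_lt ?_
    linarith [hP.c_le]
  have hdiff : ∀ s, τ ≤ s → s ≤ T → x s - σ.move x s = (-lam s) • dir θ := fun s hs hsT => by
    rw [hxw s hs hsT, hmove, pursuitMove_of_ge _ _ _ _ hs, hbdiff, hbτ, hLeq, hpτ]
    refine Plane.ext ?_ ?_
    · simp only [PiLp.sub_apply, PiLp.add_apply, PiLp.smul_apply, smul_eq_mul, hw0,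
        engagementPoint, radial_zero_apply_zero, dir_apply_zero,
        Matrix.cons_val_zero, hlam]
      ring
    · simp only [PiLp.sub_apply, PiLp.add_apply, PiLp.smul_apply, smul_eq_mul, hw1,
        engagementPoint, radial_zero_apply_one, dir_apply_one, Matrix.cons_val_one, Matrix.cons_val_zero, hlam]
      ring
  have hcapT : x T = σ.move x T := by
    rw [← sub_eq_zero, hdiff T hT1 le_rfl, hT2, neg_zero, zero_smul]
  have hcap : CaptureAt P x (σ.move x) T := by
    refine ⟨hτ.trans hT1, fun s hs hsT => ?_, hcapT⟩
    rcases lt_or_ge s τ with hsτ | hsτ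
    · constructor
      · intro h
        have := hxfar s hs hsτ
        rw [h, sub_self, norm_zero] at this
        linarith
      · rw [hnorm s hs hsτ.le]
        have := mul_lt_mul_of_pos_left hsτ hν
        linarith
    · have hpos := hT3 s hsτ hsT
      constructor
      · intro h
        have h1 := hdiff s hsτ hsT.le
        rw [h, sub_self] at h1
        have h2 := congrArg norm h1
        rw [norm_smul, norm_dir, norm_zero, mul_one, norm_neg, Real.norm_eq_abs,
          abs_of_pos hpos] at h2
        linarith
      · rw [hxw s hsτ hsT.le]
        exact (norm_apollonius hP hC (hw0 s) (hw1 s)).2 ((happ s hsτ hpos.le).2 hpos)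
  refine le_trans ?_ le_sup_left
  refine le_iSup₂_of_le T hcap (add_le_add_right (hU _ ?_) 1)
  rw [← hcapT, hxw T hT1 le_rfl]
  exact (hin T hT1 le_rfl).2

/-! ### Geometry of the engagement surface -/

/-- The root in the formula for `engDist`. -/
def Params.engRoot (P : Params) (θ : ℝ) : ℝ :=
  Real.sqrt ((P.rT + P.γ * P.ρA) ^ 2 - (P.β * P.ρA * Real.sin θ) ^ 2)

/-- Distance of the intruder from the target center at the point of the engagement surface with
angle `θ`. -/
def Params.engDist (P : Params) (θ : ℝ) : ℝ := P.β * P.ρA * Real.cos θ + P.engRoot θ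

def Params.engTime (P : Params) (θ : ℝ) : ℝ := (P.R - P.engDist θ) / P.ν

def Params.engPt (P : Params) (θ : ℝ) : Plane :=
  !₂[P.engDist θ + P.ρA * Real.cos θ, P.ρA * Real.sin θ]

theorem Params.engPt_zero (P : Params) (θ : ℝ) :
    P.engPt θ 0 = P.engDist θ + P.ρA * Real.cos θ := rfl

theorem Params.engPt_one (P : Params) (θ : ℝ) : P.engPt θ 1 = P.ρA * Real.sin θ := rfl

theorem Params.engTime_mul {P : Params} (hP : P.Regime) (θ : ℝ) :
    P.ν * P.engTime θ = P.R - P.engDist θ := mul_div_cancel₀ _ hP.ν_pos.ne'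

namespace Params.Regime

theorem β_lt_γ {P : Params} (hP : P.Regime) : P.β < P.γ := by
  rw [hP.β_eq]; nlinarith [hP.γ_pos, hP.ν_lt_one]

theorem γρ_pos {P : Params} (hP : P.Regime) : 0 < P.γ * P.ρA := mul_pos hP.γ_pos hP.ρA_pos

theorem βρ_pos {P : Params} (hP : P.Regime) : 0 < P.β * P.ρA := mul_pos hP.β_pos hP.ρA_pos

theorem γ_sub_β {P : Params} (hP : P.Regime) : (P.γ - P.β) * (1 + P.ν) = P.ν := by
  rw [hP.β_eq]; linear_combination hP.γ_mul

theorem engRad_pos {P : Params} (hP : P.Regime) (θ : ℝ) :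
    0 < (P.rT + P.γ * P.ρA) ^ 2 - (P.β * P.ρA * Real.sin θ) ^ 2 := by
  have h1 : (P.β * P.ρA * Real.sin θ) ^ 2 ≤ (P.β * P.ρA) ^ 2 := by
    rw [mul_pow]
    exact mul_le_of_le_one_right (sq_nonneg _) (Real.sin_sq_le_one θ)
  have h2 : P.β * P.ρA < P.rT + P.γ * P.ρA := by
    have := mul_lt_mul_of_pos_right hP.β_lt_γ hP.ρA_pos
    linarith [hP.rT_pos]
  have h3 : (P.β * P.ρA) ^ 2 < (P.rT + P.γ * P.ρA) ^ 2 :=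
    pow_lt_pow_left₀ h2 hP.βρ_pos.le two_ne_zero
  linarith

theorem engRoot_pos {P : Params} (hP : P.Regime) (θ : ℝ) : 0 < P.engRoot θ :=
  Real.sqrt_pos.2 (hP.engRad_pos θ)

theorem engRoot_sq {P : Params} (hP : P.Regime) (θ : ℝ) :
    P.engRoot θ ^ 2 = (P.rT + P.γ * P.ρA) ^ 2 - (P.β * P.ρA * Real.sin θ) ^ 2 :=
  Real.sq_sqrt (hP.engRad_pos θ).le

theorem tangent_eq {P : Params} (hP : P.Regime) (θ : ℝ) :
    (P.engDist θ - P.β * P.ρA * Real.cos θ) ^ 2 + (P.β * P.ρA * Real.sin θ) ^ 2 =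
      (P.rT + P.γ * P.ρA) ^ 2 := by
  have := hP.engRoot_sq θ
  rw [Params.engDist, add_sub_cancel_left]; linarith

/-- Tangency as a quadratic equation whose roots have negative product. Hence the positive root is
unique, and sign comparisons locate any positive number relative to it. -/
theorem engDist_quad {P : Params} (hP : P.Regime) (θ : ℝ) :
    P.engDist θ ^ 2 - 2 * (P.β * P.ρA) * Real.cos θ * P.engDist θ =
      P.rT ^ 2 + 2 * P.γ * P.ρA * P.rT + P.β * P.ρA ^ 2 := by
  have h1 := hP.tangent_eq θ
  linear_combination h1 - (P.β * P.ρA) ^ 2 * Real.sin_sq_add_cos_sq θ + P.ρA ^ 2 * hP.γ_sq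

theorem quad_pos {P : Params} (hP : P.Regime) :
    0 < P.rT ^ 2 + 2 * P.γ * P.ρA * P.rT + P.β * P.ρA ^ 2 := by
  have := hP.rT_pos
  have := hP.β_pos
  have := hP.γ_pos
  have := hP.ρA_pos
  positivity

theorem engDist_pos {P : Params} (hP : P.Regime) (θ : ℝ) : 0 < P.engDist θ := by
  have h1 := hP.engDist_quad θ
  have h2 := hP.quad_pos
  have h3 := hP.engRoot_pos θ
  have h4 : P.engDist θ - P.β * P.ρA * Real.cos θ = P.engRoot θ := by rw [Params.engDist]; ring
  by_contra hcon
  push Not at hcon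
  nlinarith

/-- Comparison with the positive root of a quadratic equation. -/
theorem engDist_le_of {P : Params} (hP : P.Regime) {θ x : ℝ} (hx : 0 < x)
    (h : P.rT ^ 2 + 2 * P.γ * P.ρA * P.rT + P.β * P.ρA ^ 2 ≤
      x ^ 2 - 2 * (P.β * P.ρA) * Real.cos θ * x) : P.engDist θ ≤ x := by
  have h1 := hP.engDist_quad θ
  have h2 := hP.quad_pos
  have h3 := hP.engDist_pos θ
  by_contra hcon
  push Not at hcon
  nlinarith [mul_pos h3 hx, mul_pos (sub_pos.2 hcon) h3, mul_pos (sub_pos.2 hcon) hx]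

theorem le_engDist_of {P : Params} (hP : P.Regime) {θ x : ℝ} (hx : 0 < x)
    (h : x ^ 2 - 2 * (P.β * P.ρA) * Real.cos θ * x ≤
      P.rT ^ 2 + 2 * P.γ * P.ρA * P.rT + P.β * P.ρA ^ 2) : x ≤ P.engDist θ := by
  have h1 := hP.engDist_quad θ
  have h2 := hP.quad_pos
  have h3 := hP.engDist_pos θ
  by_contra hcon
  push Not at hcon
  nlinarith [mul_pos h3 hx, mul_pos (sub_pos.2 hcon) h3, mul_pos (sub_pos.2 hcon) hx]

theorem engDist_le {P : Params} (hP : P.Regime) (θ : ℝ) :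
    P.engDist θ ≤ P.rT + (P.γ + P.β * Real.cos θ) * P.ρA := by
  have h : P.engRoot θ ≤ P.rT + P.γ * P.ρA := by
    rw [Params.engRoot]
    refine Real.sqrt_le_left (by linarith [hP.rT_pos, hP.γρ_pos]) |>.2 ?_
    linarith [sq_nonneg (P.β * P.ρA * Real.sin θ)]
  rw [Params.engDist]; linarith

theorem le_engDist {P : Params} (hP : P.Regime) (θ : ℝ) :
    P.rT + (P.γ - P.β) * P.ρA ≤ P.engDist θ := by
  have h0 := mul_pos (sub_pos.2 hP.β_lt_γ) hP.ρA_pos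
  refine hP.le_engDist_of (by linarith [hP.rT_pos]) ?_
  have h1 : 0 ≤ P.β * P.ρA * (1 + Real.cos θ) * (P.rT + (P.γ - P.β) * P.ρA) :=
    mul_nonneg (mul_nonneg hP.βρ_pos.le (by linarith [Real.neg_one_le_cos θ]))
      (by linarith [hP.rT_pos])
  nlinarith [hP.γ_sq]

theorem rT_lt_engDist {P : Params} (hP : P.Regime) (θ : ℝ) : P.rT < P.engDist θ := by
  have := mul_pos (sub_pos.2 hP.β_lt_γ) hP.ρA_pos
  linarith [hP.le_engDist θ]

theorem engDist_pi {P : Params} (hP : P.Regime) {θ : ℝ} (h : Real.cos θ = -1) :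
    P.engDist θ = P.rT + (P.γ - P.β) * P.ρA := by
  refine le_antisymm ?_ (hP.le_engDist θ)
  have := hP.engDist_le θ
  rw [h] at this; linarith

/-- The distance on the engagement surface is monotone in `cos θ`. -/
theorem engDist_mono {P : Params} (hP : P.Regime) {θ θ' : ℝ} (h : Real.cos θ ≤ Real.cos θ') :
    P.engDist θ ≤ P.engDist θ' := by
  refine hP.engDist_le_of (hP.engDist_pos θ') ?_
  rw [← hP.engDist_quad θ]
  rw [hP.engDist_quad θ, ← hP.engDist_quad θ']
  nlinarith [mul_le_mul_of_nonneg_right (mul_le_mul_of_nonneg_left h hP.βρ_pos.le)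
    (hP.engDist_pos θ').le]

/-- This bound and the next one come from the two entries of the maximum in the regime. -/
theorem engTime_ge {P : Params} (hP : P.Regime) (θ : ℝ) :
    (1 + P.γ - P.β * Real.cos θ) * P.ρA ≤ P.ν * P.engTime θ := by
  rw [Params.engTime_mul hP, Params.R]
  linarith [hP.engDist_le θ, hP.ρT_ge]

theorem engTime_ge' {P : Params} (hP : P.Regime) (θ : ℝ) :
    P.ν * P.rT + 2 * P.β * P.ρA - (P.γ + P.β * Real.cos θ) * P.ρA ≤ P.ν * P.engTime θ := by
  rw [Params.engTime_mul hP, Params.R]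
  linarith [hP.engDist_le θ, hP.ρT_ge']

theorem engTime_le {P : Params} (hP : P.Regime) (θ : ℝ) : P.ν * P.engTime θ ≤ P.ρT := by
  rw [Params.engTime_mul hP, Params.R]; linarith [hP.rT_lt_engDist θ]

theorem ρ_lt_engTime {P : Params} (hP : P.Regime) (θ : ℝ) : P.ρA < P.engTime θ := by
  have h1 := hP.engTime_ge θ
  have h2 : P.β * Real.cos θ ≤ P.β := mul_le_of_le_one_right hP.β_pos.le (Real.cos_le_one θ)
  have h3 := mul_pos (sub_pos.2 hP.β_lt_γ) hP.ρA_pos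
  have h4 := hP.ν_lt_one
  have h5 := hP.ν_pos
  by_contra hcon
  push Not at hcon
  nlinarith [hP.ρA_pos, mul_le_mul_of_nonneg_left hcon h5.le]

theorem engTime_pos {P : Params} (hP : P.Regime) (θ : ℝ) : 0 < P.engTime θ :=
  hP.ρA_pos.trans (hP.ρ_lt_engTime θ)

/-- The surface is a graph over `θ`: by the half-angle formula its equation is the quadratic above
for the intruder's distance, which is positive for all times admitted. -/
theorem mem_engagementSurface {P : Params} (hP : P.Regime) {τ θ : ℝ} :
    (τ, θ) ∈ engagementSurface P ↔ τ = P.engTime θ := by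
  have hsin : Real.sin (θ / 2) ^ 2 = (1 - Real.cos θ) / 2 := by
    have h1 := Real.cos_sq (θ / 2)
    have h2 := Real.sin_sq_add_cos_sq (θ / 2)
    rw [mul_div_cancel₀ θ two_ne_zero] at h1
    linarith
  have hβρ := hP.βρ_pos
  have hmem : (τ, θ) ∈ engagementSurface P ↔ 0 ≤ τ ∧ τ ≤ P.ρT / P.ν ∧
      Real.sin (θ / 2) ^ 2 =
      ((P.rT + P.γ * P.ρA) ^ 2 - (P.rT + P.ρT - τ * P.ν - P.β * P.ρA) ^ 2) /
        (4 * P.β * P.ρA * (P.rT + P.ρT - τ * P.ν)) := Iff.rfl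
  have key : ∀ a : ℝ, 0 < a → ((1 - Real.cos θ) / 2 =
      ((P.rT + P.γ * P.ρA) ^ 2 - (a - P.β * P.ρA) ^ 2) / (4 * P.β * P.ρA * a) ↔
      a ^ 2 - 2 * (P.β * P.ρA) * Real.cos θ * a =
        P.rT ^ 2 + 2 * P.γ * P.ρA * P.rT + P.β * P.ρA ^ 2) := by
    intro a ha
    have hγ := hP.γ_sq
    have hne : 4 * P.β * P.ρA * a ≠ 0 := by
      have := mul_pos hβρ ha
      nlinarith
    rw [eq_div_iff hne]
    constructor <;> intro h
    · linear_combination h + P.ρA ^ 2 * hγ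
    · linear_combination h - P.ρA ^ 2 * hγ
  rw [hmem, hsin]
  constructor
  · rintro ⟨h0, h1, h2⟩
    have h3 : τ * P.ν ≤ P.ρT := (le_div_iff₀ hP.ν_pos).1 h1
    have ha : 0 < P.rT + P.ρT - τ * P.ν := by linarith [hP.rT_pos]
    have h4 := (key _ ha).1 h2
    have h5 : P.engDist θ = P.rT + P.ρT - τ * P.ν :=
      le_antisymm (hP.engDist_le_of ha h4.ge) (hP.le_engDist_of ha h4.le)
    rw [Params.engTime, h5, Params.R, eq_div_iff hP.ν_pos.ne']; ring
  · rintro rfl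
    have h5 : P.rT + P.ρT - P.engTime θ * P.ν = P.engDist θ := by
      have := Params.engTime_mul hP θ
      rw [Params.R] at this; linarith
    refine ⟨(hP.engTime_pos θ).le, ?_, ?_⟩
    · rw [le_div_iff₀ hP.ν_pos, mul_comm]; exact hP.engTime_le θ
    · rw [h5]; exact (key _ (hP.engDist_pos θ)).2 (hP.engDist_quad θ)

theorem engagementPoint_eq {P : Params} (hP : P.Regime) (θ : ℝ) :
    engagementPoint P (P.engTime θ, θ) = P.engPt θ := by
  have := Params.engTime_mul hP θ
  refine Plane.ext ?_ ?_
  · simp only [engagementPoint, PiLp.add_apply, radial_zero_apply_zero, PiLp.smul_apply,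
      smul_eq_mul, dir_apply_zero, Params.engPt_zero, this]; ring
  · simp only [engagementPoint, PiLp.add_apply, radial_zero_apply_one, PiLp.smul_apply,
      smul_eq_mul, dir_apply_one, Params.engPt_one]; ring

theorem rEng_eq {P : Params} (hP : P.Regime) (θ : ℝ) :
    rEng P (P.engTime θ, θ) = ‖P.engPt θ‖ := by
  have h := Params.engTime_mul hP θ
  rw [Params.R] at h
  have h5 : P.rT + P.ρT - P.engTime θ * P.ν = P.engDist θ := by linarith
  rw [rEng, ← Real.sqrt_sq (norm_nonneg (P.engPt θ)), Plane.norm_sq, Params.engPt_zero,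
    Params.engPt_one]
  simp only [h5]
  have h1 := Real.cos_sq (θ / 2)
  rw [mul_div_cancel₀ θ two_ne_zero] at h1
  congr 1
  rw [h1]
  linear_combination (-P.ρA ^ 2) * Real.sin_sq_add_cos_sq θ

/-- Eliminating `cos θ` through the quadratic ties the norm of the engagement point to `engDist`
alone, so it inherits monotonicity in `cos θ`. -/
theorem norm_engPt_sq {P : Params} (hP : P.Regime) (θ : ℝ) :
    P.ν ^ 2 * ‖P.engPt θ‖ ^ 2 =
      P.engDist θ ^ 2 - (1 - P.ν ^ 2) * P.rT ^ 2 - 2 * P.ν * P.ρA * P.rT := by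
  rw [Plane.norm_sq, Params.engPt_zero, Params.engPt_one]
  have h1 := hP.engDist_quad θ
  have hβ : P.β * (1 - P.ν ^ 2) = P.ν ^ 2 := by
    rw [hP.β_eq]; linear_combination P.ν * hP.γ_mul
  linear_combination (-(1 - P.ν ^ 2)) * h1 + P.ν ^ 2 * P.ρA ^ 2 * Real.sin_sq_add_cos_sq θ -
    (2 * P.ρA * Real.cos θ * P.engDist θ + P.ρA ^ 2) * hβ - 2 * P.ρA * P.rT * hP.γ_mul

theorem norm_engPt_mono {P : Params} (hP : P.Regime) {θ θ' : ℝ} (h : Real.cos θ ≤ Real.cos θ') :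
    ‖P.engPt θ‖ ≤ ‖P.engPt θ'‖ := by
  have h1 := hP.engDist_mono h
  have h2 := hP.norm_engPt_sq θ
  have h3 := hP.norm_engPt_sq θ'
  have h4 : P.engDist θ ^ 2 ≤ P.engDist θ' ^ 2 := pow_le_pow_left₀ (hP.engDist_pos θ).le h1 2
  refine (sq_le_sq₀ (norm_nonneg _) (norm_nonneg _)).1 ?_
  have : 0 < P.ν ^ 2 := by have := hP.ν_pos; positivity
  nlinarith

theorem engTime_anti {P : Params} (hP : P.Regime) {θ θ' : ℝ} (h : Real.cos θ ≤ Real.cos θ') :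
    P.engTime θ' ≤ P.engTime θ :=
  div_le_div_of_nonneg_right (by linarith [hP.engDist_mono h]) hP.ν_pos.le

end Params.Regime

theorem hasDerivAt_engDist {P : Params} (hP : P.Regime) (θ : ℝ) :
    HasDerivAt P.engDist
      (-(P.β * P.ρA * Real.sin θ * P.engDist θ / P.engRoot θ)) θ := by
  have hpos := hP.engRad_pos θ
  have h1 : HasDerivAt (fun θ => (P.rT + P.γ * P.ρA) ^ 2 - (P.β * P.ρA * Real.sin θ) ^ 2)
      (-(2 * (P.β * P.ρA) ^ 2 * Real.sin θ * Real.cos θ)) θ := by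
    have := (((Real.hasDerivAt_sin θ).const_mul (P.β * P.ρA)).pow 2).const_sub
      ((P.rT + P.γ * P.ρA) ^ 2)
    refine this.congr_deriv ?_
    push_cast
    ring
  have h2 := h1.sqrt hpos.ne'
  have h3 := ((Real.hasDerivAt_cos θ).const_mul (P.β * P.ρA)).add h2
  refine h3.congr_deriv ?_
  have hQ := hP.engRoot_pos θ
  change _ * _ + _ / (2 * P.engRoot θ) = _
  rw [Params.engDist]
  field_simp
  ring

/-! ### Undetected paths of the defender -/

/-- The defender can go from `y` at time `t₀` to `z` at time `t₁`, undetected before `t₁`. -/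
def Sneak (P : Params) (t₀ : ℝ) (y : Plane) (t₁ : ℝ) (z : Plane) : Prop :=
  ∃ p : ℝ → Plane, p t₀ = y ∧ p t₁ = z ∧
    (∀ s t : ℝ, t₀ ≤ s → s ≤ t → t ≤ t₁ → ‖p t - p s‖ ≤ t - s) ∧
    ∀ s, t₀ ≤ s → s < t₁ → P.ρA < ‖radial P 0 s - p s‖

theorem Sneak.trans {P : Params} {t₀ t₁ t₂ : ℝ} {x y z : Plane} (h01 : t₀ ≤ t₁) (h12 : t₁ ≤ t₂)
    (h : Sneak P t₀ x t₁ y) (h' : Sneak P t₁ y t₂ z) : Sneak P t₀ x t₂ z := by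
  obtain ⟨p, hp0, hp1, hp, hpf⟩ := h
  obtain ⟨q, hq1, hq2, hq, hqf⟩ := h'
  have hge : ∀ t, t₁ ≤ t → (if t ≤ t₁ then p t else q t) = q t := fun t ht => by
    rcases ht.eq_or_lt with rfl | h
    · rw [if_pos le_rfl, hp1, hq1]
    · rw [if_neg (not_le.2 h)]
  refine ⟨fun t => if t ≤ t₁ then p t else q t, ?_, ?_, ?_, ?_⟩
  · simp only [h01, if_true, hp0]
  · beta_reduce; rw [hge t₂ h12, hq2]
  · intro s t hs hst ht
    beta_reduce
    rcases le_total t t₁ with h1 | h1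
    · simp only [h1, hst.trans h1, if_true]; exact hp s t hs hst h1
    · rw [hge t h1]
      rcases le_total s t₁ with h2 | h2
      · simp only [h2, if_true]
        calc ‖q t - p s‖ = ‖(q t - q t₁) + (p t₁ - p s)‖ := by rw [hp1, hq1]; congr 1; abel
          _ ≤ ‖q t - q t₁‖ + ‖p t₁ - p s‖ := norm_add_le _ _
          _ ≤ (t - t₁) + (t₁ - s) := add_le_add (hq t₁ t le_rfl h1 ht) (hp s t₁ hs h2 le_rfl)
          _ = t - s := by ring
      · rw [hge s h2]; exact hq s t h2 hst ht
  · intro s hs hs2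
    rcases lt_or_ge s t₁ with h | h
    · simp only [h.le, if_true]; exact hpf s hs h
    · simp only [hge s h]; exact hqf s h hs2

theorem sneak_segment {P : Params} {t₀ t₁ : ℝ} {y z : Plane} (h : t₀ < t₁)
    (hd : ‖z - y‖ ≤ t₁ - t₀)
    (hfar : ∀ l : ℝ, 0 ≤ l → l < 1 →
      P.ρA < ‖radial P 0 (t₀ + l * (t₁ - t₀)) - (y + l • (z - y))‖) : Sneak P t₀ y t₁ z := by
  refine ⟨segment t₀ t₁ y z, segment_start _ _ _ _, segment_end h _ _, fun s t _ hst _ => ?_,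
    fun s hs hs1 => ?_⟩
  · have := segment_speed h (by rwa [one_mul]) hst (v := 1) (p := y) (q := z)
    rwa [one_mul] at this
  · have h0 := sub_pos.2 h
    have := hfar ((s - t₀) / (t₁ - t₀)) (div_nonneg (sub_nonneg.2 hs) h0.le)
      ((div_lt_one h0).2 (by linarith))
    rwa [div_mul_cancel₀ _ h0.ne', add_sub_cancel] at this

theorem sneak_segment_coord {P : Params} (hρ : 0 ≤ P.ρA) {t₀ t₁ : ℝ} {y z : Plane} (h : t₀ < t₁)
    (hd : (z 0 - y 0) ^ 2 + (z 1 - y 1) ^ 2 ≤ (t₁ - t₀) ^ 2)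
    (hfar : ∀ l : ℝ, 0 ≤ l → l < 1 → P.ρA ^ 2 <
      (P.R - P.ν * (t₀ + l * (t₁ - t₀)) - (y 0 + l * (z 0 - y 0))) ^ 2 +
        (y 1 + l * (z 1 - y 1)) ^ 2) : Sneak P t₀ y t₁ z := by
  refine sneak_segment h ((Plane.norm_le_iff (sub_pos.2 h).le).2 hd) fun l hl hl1 => ?_
  rw [Plane.lt_norm_iff hρ]
  refine (hfar l hl hl1).trans_le (le_of_eq ?_)
  simp only [PiLp.sub_apply, PiLp.add_apply, PiLp.smul_apply, smul_eq_mul, radial_zero_apply_zero,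
    radial_zero_apply_one]
  ring

/-- Straight uniform motion to a point of engagement. -/
theorem sneak_straight {P : Params} (hP : P.Regime) {θ : ℝ} {y : Plane}
    (hsep : P.ρA ^ 2 < (P.R - y 0) ^ 2 + y 1 ^ 2)
    (hq : P.ρA ≤ (y 0 - P.R) * Real.cos θ + y 1 * Real.sin θ)
    (hd : ‖P.engPt θ - y‖ ≤ P.engTime θ) : Sneak P 0 y (P.engTime θ) (P.engPt θ) := by
  have ht := hP.engTime_pos θ
  refine sneak_segment_coord hP.ρA_pos.le ht ?_ fun l hl hl1 => ?_
  · have := (Plane.norm_le_iff ht.le).1 hd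
    simpa using this
  · have hm := Params.engTime_mul hP θ
    set c := Real.cos θ
    set s := Real.sin θ
    -- Relative to the intruder the path is a segment ending at `ρA • dir θ`. `A` and `B` are the
    -- coordinates of its start measured from that end point, along and across `dir θ`; `A ≥ 0`
    -- keeps the segment beyond the tangent to the detection circle.
    set A := (y 0 - P.R) * c + y 1 * s - P.ρA with hA
    set B := -((y 0 - P.R) * s) + y 1 * c with hB
    have hS : s ^ 2 + c ^ 2 = 1 := Real.sin_sq_add_cos_sq θ
    have e : (P.R - P.ν * (0 + l * (P.engTime θ - 0)) - (y 0 + l * (P.engPt θ 0 - y 0))) ^ 2 +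
        (y 1 + l * (P.engPt θ 1 - y 1)) ^ 2 =
        P.ρA ^ 2 + 2 * P.ρA * (1 - l) * A + (1 - l) ^ 2 * (A ^ 2 + B ^ 2) := by
      have e1 : P.R - P.ν * (0 + l * (P.engTime θ - 0)) - (y 0 + l * (P.engPt θ 0 - y 0)) =
          -((1 - l) * (y 0 - P.R) + l * (P.ρA * c)) := by
        rw [Params.engPt_zero]; linear_combination (-l) * hm
      rw [e1, Params.engPt_one]
      simp only [hA, hB]
      linear_combination (l ^ 2 * P.ρA ^ 2 - (1 - l) ^ 2 * ((y 0 - P.R) ^ 2 + y 1 ^ 2)) * hS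
    rw [e]
    have hpos : 0 < 2 * P.ρA * A + (A ^ 2 + B ^ 2) := by
      have : 2 * P.ρA * A + (A ^ 2 + B ^ 2) = (P.R - y 0) ^ 2 + y 1 ^ 2 - P.ρA ^ 2 := by
        simp only [hA, hB]
        linear_combination ((y 0 - P.R) ^ 2 + y 1 ^ 2) * hS
      rw [this]; linarith
    have hA0 : 0 ≤ A := by simp only [hA]; linarith
    have h1l : 0 < 1 - l := by linarith
    have h2 : 0 < (1 - l) ^ 2 * (2 * P.ρA * A + (A ^ 2 + B ^ 2)) := by positivity
    have h3 : 0 ≤ 2 * P.ρA * A * (1 - l) * l :=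
      mul_nonneg (mul_nonneg (mul_nonneg (by linarith [hP.ρA_pos]) hA0) h1l.le) hl
    nlinarith

/-- Approach of a point of engagement parallel to the path of the intruder. -/
theorem sneak_horizontal {P : Params} (hP : P.Regime) {θ t₁ x : ℝ} (hc : Real.cos θ ≤ 0)
    (ht : t₁ < P.engTime θ) (hd : |P.engPt θ 0 - x| ≤ P.engTime θ - t₁)
    (hx : -(P.ρA * Real.cos θ) < P.R - P.ν * t₁ - x) :
    Sneak P t₁ !₂[x, P.engPt θ 1] (P.engTime θ) (P.engPt θ) := by
  refine sneak_segment_coord hP.ρA_pos.le ht ?_ fun l hl hl1 => ?_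
  · have : (P.engPt θ 0 - x) ^ 2 ≤ (P.engTime θ - t₁) ^ 2 := by
      rw [← sq_abs]; exact pow_le_pow_left₀ (abs_nonneg _) hd 2
    simpa using this
  · have hm := Params.engTime_mul hP θ
    have hS := Real.sin_sq_add_cos_sq θ
    simp only [Matrix.cons_val_zero, Matrix.cons_val_one, sub_self, mul_zero,
      add_zero]
    have e1 : P.R - P.ν * (t₁ + l * (P.engTime θ - t₁)) - (x + l * (P.engPt θ 0 - x)) =
        (1 - l) * (P.R - P.ν * t₁ - x) + l * (-(P.ρA * Real.cos θ)) := by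
      rw [Params.engPt_zero]; linear_combination (-l) * hm
    have h0 : 0 ≤ -(P.ρA * Real.cos θ) := by nlinarith [hP.ρA_pos]
    have h1 : -(P.ρA * Real.cos θ) <
        (1 - l) * (P.R - P.ν * t₁ - x) + l * (-(P.ρA * Real.cos θ)) := by nlinarith
    have h2 := pow_lt_pow_left₀ h1 h0 two_ne_zero
    rw [e1, Params.engPt_one]
    nlinarith

/-- The defender climbs with velocity `(-ν, √(1 - ν²))`, so its horizontal gap to the intruder stays
constant while the vertical one grows; at the height of the engagement point it proceeds
horizontally. -/
theorem sneak_over {P : Params} (hP : P.Regime) {θ : ℝ} {y : Plane} (hc : Real.cos θ ≤ 0)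
    (hs : 0 < Real.sin θ) (hsep : P.ρA ^ 2 < (P.R - y 0) ^ 2 + y 1 ^ 2) (hy1 : 0 ≤ y 1)
    (hy1' : y 1 < P.engPt θ 1) (hy0 : y 0 ≤ P.R - P.ρA) (hy0' : P.engPt θ 0 ≤ y 0) :
    Sneak P 0 y (P.engTime θ) (P.engPt θ) := by
  have hν := hP.ν_pos
  have hρ := hP.ρA_pos
  have hγ := hP.γ_pos
  have ht := hP.engTime_pos θ
  set q := Real.sqrt (1 - P.ν ^ 2) with hq
  have hq0 : 0 < q := Real.sqrt_pos.2 hP.k_pos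
  have hq2 : q ^ 2 = 1 - P.ν ^ 2 := Real.sq_sqrt hP.k_pos.le
  set s₁ := (P.engPt θ 1 - y 1) / q with hs₁
  have hqs : q * s₁ = P.engPt θ 1 - y 1 := mul_div_cancel₀ _ hq0.ne'
  have hs₁0 : 0 < s₁ := div_pos (sub_pos.2 hy1') hq0
  have hE1 : P.engPt θ 1 ≤ P.ρA := by
    rw [Params.engPt_one]; exact mul_le_of_le_one_right hρ.le (Real.sin_le_one θ)
  -- The factor `1 + ν` allows for the climb carrying the defender past the engagement point, by at
  -- most `ν s₁`, which it must run back.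
  have hs₁t : (1 + P.ν) * s₁ ≤ P.engTime θ := by
    have h1 : P.ν * (1 + P.ν) ≤ (1 + P.γ) * q := by
      refine (sq_le_sq₀ (by positivity) (by positivity)).1 ?_
      rw [mul_pow, mul_pow, hq2]
      -- From `(1 + γ)² ≥ 4γ` and `γ (1 - ν²) = ν`.
      have h2 : 4 * P.ν ≤ (1 + P.γ) ^ 2 * (1 - P.ν ^ 2) := by
        have := hP.γ_mul
        nlinarith [mul_nonneg (sq_nonneg (1 - P.γ)) hP.k_pos.le]
      refine le_trans ?_ h2
      have := hP.ν_lt_one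
      have h3 : (1 + P.ν) ^ 2 ≤ 2 ^ 2 := pow_le_pow_left₀ (by linarith) (by linarith) 2
      have h4 : P.ν ^ 2 ≤ P.ν := by nlinarith
      nlinarith [mul_le_mul h4 h3 (by positivity) hν.le]
    have h2 : (1 + P.γ) * P.ρA ≤ P.ν * P.engTime θ := by
      have := hP.engTime_ge θ
      nlinarith [mul_nonneg hP.βρ_pos.le (neg_nonneg.2 hc)]
    have h3 : q * s₁ ≤ P.ρA := by linarith
    have h4 : P.ν * q * ((1 + P.ν) * s₁) ≤ P.ν * q * P.engTime θ := by
      calc P.ν * q * ((1 + P.ν) * s₁) = P.ν * (1 + P.ν) * (q * s₁) := by ring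
        _ ≤ (1 + P.γ) * q * P.ρA :=
          mul_le_mul h1 h3 (by positivity) (by positivity)
        _ = q * ((1 + P.γ) * P.ρA) := by ring
        _ ≤ q * (P.ν * P.engTime θ) := mul_le_mul_of_nonneg_left h2 hq0.le
        _ = _ := by ring
    exact le_of_mul_le_mul_left h4 (by positivity)
  have hνs : 0 < P.ν * s₁ := mul_pos hν hs₁0
  have hs₁lt : s₁ < P.engTime θ := by linarith
  have hm := Params.engTime_mul hP θ
  have hE0 := P.engPt_zero θ
  have hc1 : -1 < Real.cos θ := by
    by_contra hcon
    nlinarith [Real.sin_sq_add_cos_sq θ]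
  refine Sneak.trans (t₁ := s₁) (y := !₂[y 0 - P.ν * s₁, P.engPt θ 1]) hs₁0.le hs₁lt.le ?_ ?_
  · refine sneak_segment_coord hρ.le hs₁0 ?_ fun l hl hl1 => ?_
    · simp only [Matrix.cons_val_zero, Matrix.cons_val_one, ← hqs]
      refine le_of_eq ?_
      linear_combination s₁ ^ 2 * hq2
    · simp only [Matrix.cons_val_zero, Matrix.cons_val_one]
      have e1 : P.R - P.ν * (0 + l * (s₁ - 0)) - (y 0 + l * (y 0 - P.ν * s₁ - y 0)) =
          P.R - y 0 := by ring
      have h1 : y 1 ^ 2 ≤ (y 1 + l * (P.engPt θ 1 - y 1)) ^ 2 :=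
        pow_le_pow_left₀ hy1 (by nlinarith) 2
      rw [e1]; linarith
  · refine sneak_horizontal hP hc hs₁lt ?_ ?_
    · rw [abs_le]
      constructor
      · have : P.ν * (P.engTime θ - s₁) ≤ P.engTime θ - s₁ :=
          mul_le_of_le_one_left (by linarith) hP.ν_lt_one.le
        nlinarith
      · linarith
    · nlinarith

/-- Vertical climb, then a horizontal run, hence the `ℓ¹` distance in `hd`. The climb takes at most
time `ρA`, and the horizontal gap to the intruder exceeds `ρA` meanwhile. -/
theorem sneak_up {P : Params} (hP : P.Regime) {θ : ℝ} {y : Plane} (hc : Real.cos θ ≤ 0)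
    (hy1' : y 1 < P.engPt θ 1) (hy1 : 0 ≤ y 1) (hy0' : y 0 ≤ P.engPt θ 0)
    (hd : P.engPt θ 0 - y 0 + (P.engPt θ 1 - y 1) ≤ P.engTime θ) :
    Sneak P 0 y (P.engTime θ) (P.engPt θ) := by
  have hν := hP.ν_pos
  have hρ := hP.ρA_pos
  have ht := hP.ρ_lt_engTime θ
  have hm := Params.engTime_mul hP θ
  have hE0 := P.engPt_zero θ
  have hE1 : P.engPt θ 1 ≤ P.ρA := by
    rw [Params.engPt_one]; exact mul_le_of_le_one_right hρ.le (Real.sin_le_one θ)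
  have hν1 := hP.ν_lt_one
  have h1 : P.ρA < P.ν * P.engTime θ - P.ν * P.ρA := by
    have h2 := hP.engTime_ge θ
    have h3 := mul_nonneg hP.βρ_pos.le (neg_nonneg.2 hc)
    have h4 : P.ν < P.γ := by rw [hP.γ_eq]; nlinarith [mul_pos hν hP.β_pos]
    nlinarith
  have hκ : 0 ≤ -(P.ρA * Real.cos θ) := by nlinarith
  set s₁ := P.engPt θ 1 - y 1 with hs₁
  have hs₁0 : 0 < s₁ := sub_pos.2 hy1'
  have hs₁ρ : s₁ ≤ P.ρA := by linarith
  have hνs : P.ν * s₁ ≤ P.ν * P.ρA := mul_le_mul_of_nonneg_left hs₁ρ hν.le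
  refine Sneak.trans (t₁ := s₁) (y := !₂[y 0, P.engPt θ 1]) hs₁0.le (by linarith) ?_ ?_
  · refine sneak_segment_coord hρ.le hs₁0 ?_ fun l hl hl1 => ?_
    · simp [← hs₁]
    · simp only [Matrix.cons_val_zero, Matrix.cons_val_one, sub_self, mul_zero,
        add_zero, sub_zero, zero_add]
      have h2 : P.ν * (l * s₁) ≤ P.ν * s₁ :=
        mul_le_mul_of_nonneg_left (mul_le_of_le_one_left hs₁0.le hl1.le) hν.le
      have h3 : P.ρA < P.R - P.ν * (l * s₁) - y 0 := by linarith
      have h4 := pow_lt_pow_left₀ h3 hρ.le two_ne_zero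
      nlinarith [sq_nonneg (y 1 + l * (P.engPt θ 1 - y 1))]
  · refine sneak_horizontal hP hc (by linarith) ?_ (by linarith)
    rw [abs_of_nonneg (by linarith)]
    linarith

/-- Going to the center first, if the center is on the far side of the tangent at the point of
engagement. -/
theorem sneak_home {P : Params} (hP : P.Regime) {θ : ℝ} {y : Plane} (hy : 0 < ‖y‖)
    (hyR : ‖y‖ ≤ P.R - P.ρA) (hsep : P.ρA < ‖radial P 0 0 - y‖) (hE : 0 < ‖P.engPt θ‖)
    (hd : ‖y‖ + ‖P.engPt θ‖ ≤ P.engTime θ) (hc : P.engDist θ * Real.cos θ + P.ρA ≤ 0) :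
    Sneak P 0 y (P.engTime θ) (P.engPt θ) := by
  have hν := hP.ν_pos
  have hρ := hP.ρA_pos
  have ha := hP.engDist_pos θ
  have hm := Params.engTime_mul hP θ
  have hcneg : Real.cos θ < 0 := by
    by_contra hcon
    nlinarith [mul_nonneg ha.le (not_lt.1 hcon)]
  have hlt : ‖y‖ < P.engTime θ := by linarith
  refine Sneak.trans (t₁ := ‖y‖) (y := 0) hy.le hlt.le ?_ ?_
  · refine sneak_segment hy (by simp) fun l hl hl1 => ?_
    rcases hl.eq_or_lt with rfl | hl0
    · simpa using hsep
    have e : y + l • (0 - y) = (1 - l) • y := by rw [sub_smul, one_smul]; simp [sub_eq_add_neg]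
    rw [e]
    have h1 : P.ν * (0 + l * (‖y‖ - 0)) ≤ l * ‖y‖ := by
      have := mul_nonneg hl hy.le
      nlinarith [hP.ν_lt_one]
    have h2 : l * ‖y‖ ≤ ‖y‖ := mul_le_of_le_one_left hy.le hl1.le
    have h3 : ‖radial P 0 (0 + l * (‖y‖ - 0))‖ = P.R - P.ν * (0 + l * (‖y‖ - 0)) :=
      norm_radial _ _ _ (by linarith)
    have h4 : ‖(1 - l) • y‖ = (1 - l) * ‖y‖ := by
      rw [norm_smul, Real.norm_eq_abs, abs_of_nonneg (by linarith)]
    have h5 := norm_sub_norm_le (radial P 0 (0 + l * (‖y‖ - 0))) ((1 - l) • y)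
    have h6 := mul_pos (mul_pos hl0 hy) (sub_pos.2 hP.ν_lt_one)
    nlinarith
  · refine sneak_segment_coord hρ.le hlt ?_ fun l hl hl1 => ?_
    · have h1 : ‖P.engPt θ‖ ^ 2 ≤ (P.engTime θ - ‖y‖) ^ 2 :=
        pow_le_pow_left₀ hE.le (by linarith) 2
      rw [Plane.norm_sq] at h1
      simpa using h1
    · have hS := Real.sin_sq_add_cos_sq θ
      simp only [PiLp.zero_apply, sub_zero, zero_add]
      set X := P.R - P.ν * (‖y‖ + l * (P.engTime θ - ‖y‖)) - l * P.engPt θ 0 with hX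
      set Y := l * P.engPt θ 1 with hY
      -- On the way out the defender must stay beyond the line perpendicular to `dir θ` at distance
      -- `ρA` from the intruder. At the end it is on that line; `hc` says that the centre is not on
      -- the wrong side of it at the engagement, and earlier intruder positions only help as `cos θ
      -- < 0`.
      have e : X * Real.cos θ - Y * Real.sin θ = -P.ρA +
          (1 - l) * (P.engDist θ * Real.cos θ + P.ρA) +
          P.ν * ((1 - l) * (P.engTime θ - ‖y‖)) * Real.cos θ := by
        simp only [hX, hY, Params.engPt_zero, Params.engPt_one]
        linear_combination (-Real.cos θ) * hm - l * P.ρA * hS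
      have h1l : 0 < 1 - l := by linarith
      have h1 : P.ν * ((1 - l) * (P.engTime θ - ‖y‖)) * Real.cos θ < 0 :=
        mul_neg_of_pos_of_neg (mul_pos hν (mul_pos h1l (sub_pos.2 hlt))) hcneg
      have h2 : (1 - l) * (P.engDist θ * Real.cos θ + P.ρA) ≤ 0 :=
        mul_nonpos_of_nonneg_of_nonpos h1l.le hc
      have h3 : P.ρA < -(X * Real.cos θ - Y * Real.sin θ) := by rw [e]; linarith
      have h4 := pow_lt_pow_left₀ h3 hρ.le two_ne_zero
      have h5 : (X * Real.cos θ - Y * Real.sin θ) ^ 2 + (X * Real.sin θ + Y * Real.cos θ) ^ 2 =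
          X ^ 2 + Y ^ 2 := by linear_combination (X ^ 2 + Y ^ 2) * hS
      nlinarith [sq_nonneg (X * Real.sin θ + Y * Real.cos θ)]

/-- Paths to engagement points in front of the intruder. -/
theorem sneak_front {P : Params} (hP : P.Regime) {θ : ℝ} {y : Plane} (hc : Real.cos θ ≤ 0)
    (hs : 0 ≤ Real.sin θ) (hsep : P.ρA < ‖radial P 0 0 - y‖) (hy1 : 0 ≤ y 1)
    (hy0 : y 0 ≤ P.R - P.ρA) (h1 : P.engPt θ 1 ≤ y 1 → ‖P.engPt θ - y‖ ≤ P.engTime θ)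
    (h2 : y 1 < P.engPt θ 1 → y 0 ≤ P.engPt θ 0 →
      P.engPt θ 0 - y 0 + (P.engPt θ 1 - y 1) ≤ P.engTime θ) :
    Sneak P 0 y (P.engTime θ) (P.engPt θ) := by
  have hρ := hP.ρA_pos
  have hsep' : P.ρA ^ 2 < (P.R - y 0) ^ 2 + y 1 ^ 2 := by
    have := (Plane.lt_norm_iff hρ.le).1 hsep
    simp only [PiLp.sub_apply, radial_zero_apply_zero, radial_zero_apply_one] at this
    nlinarith
  rcases le_or_gt (P.engPt θ 1) (y 1) with h | h
  · refine sneak_straight hP hsep' ?_ (h1 h)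
    rw [Params.engPt_one] at h
    have h3 := mul_le_mul_of_nonneg_right h hs
    have h4 : P.ρA * -Real.cos θ ≤ (P.R - y 0) * -Real.cos θ :=
      mul_le_mul_of_nonneg_right (by linarith) (by linarith)
    have h5 : 0 ≤ -Real.cos θ * (1 + Real.cos θ) :=
      mul_nonneg (by linarith) (by linarith [Real.neg_one_le_cos θ])
    nlinarith [Real.sin_sq_add_cos_sq θ]
  · have hs' : 0 < Real.sin θ := by
      rw [Params.engPt_one] at h
      by_contra hcon
      nlinarith
    rcases le_total (P.engPt θ 0) (y 0) with h0 | h0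
    · exact sneak_over hP hc hs' hsep' hy1 h hy0 h0
    · exact sneak_up hP hc h hy1 h0 (h2 h h0)

/-! ### Positions from which the engagement surface can be reached -/

/-- From `y` some point of the engagement surface can be reached in time. -/
def Reach (P : Params) (y : Plane) : Prop := ∃ θ, ‖P.engPt θ - y‖ ≤ P.engTime θ

theorem engDist_neg (P : Params) (θ : ℝ) : P.engDist (-θ) = P.engDist θ := by
  simp [Params.engDist, Params.engRoot]

theorem engTime_neg (P : Params) (θ : ℝ) : P.engTime (-θ) = P.engTime θ := by
  rw [Params.engTime, engDist_neg]; rfl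

theorem engPt_neg (P : Params) (θ : ℝ) : P.engPt (-θ) = refl (P.engPt θ) := by
  rw [refl_apply]
  refine Plane.ext ?_ ?_ <;> simp [Params.engPt, engDist_neg]

theorem refl_refl (y : Plane) : refl (refl y) = y := by
  simp only [refl_apply]; refine Plane.ext ?_ ?_ <;> simp

theorem Reach.refl {P : Params} {y : Plane} (h : Reach P y) : Reach P (refl y) := by
  obtain ⟨θ, hθ⟩ := h
  refine ⟨-θ, ?_⟩
  rw [engPt_neg, ← map_sub, LinearIsometryEquiv.norm_map, engTime_neg]; exact hθ

theorem engPt_pi (P : Params) {θ : ℝ} (hP : P.Regime) (h : Real.cos θ = -1) :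
    P.engPt θ 0 = P.rT + (P.γ - P.β) * P.ρA - P.ρA ∧ P.engPt θ 1 = 0 := by
  have hs : Real.sin θ = 0 := by
    have := Real.sin_sq_add_cos_sq θ
    rw [h] at this
    exact pow_eq_zero_iff two_ne_zero |>.1 (by linarith)
  rw [Params.engPt_zero, Params.engPt_one, hP.engDist_pi h, h, hs]
  constructor <;> ring

theorem norm_engPt_pi (P : Params) {θ : ℝ} (hP : P.Regime) (h : Real.cos θ = -1) :
    ‖P.engPt θ‖ = |P.rT + (P.γ - P.β) * P.ρA - P.ρA| := by
  obtain ⟨h0, h1⟩ := engPt_pi P hP h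
  rw [← abs_norm, ← sq_eq_sq_iff_abs_eq_abs, Plane.norm_sq, h0, h1]; ring

/-- If the target is small, then every position of interest reaches the front engagement point. -/
theorem norm_add_lt_engTime {P : Params} (hP : P.Regime) (hrT : P.rT ≤ P.ρA) {r : ℝ}
    (hr : r ≤ P.R - P.ρA) {θ : ℝ} (hθ : Real.cos θ = -1) :
    r + ‖P.engPt θ‖ < P.engTime θ := by
  have hν := hP.ν_pos
  have hν1 := hP.ν_lt_one
  have hρ := hP.ρA_pos
  have hm := Params.engTime_mul hP θ
  have hg := hP.γ_sub_β
  have hg0 := sub_pos.2 hP.β_lt_γ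
  have h1 := hP.ρT_ge
  have h2 : 2 * P.γ * (1 - P.ν) = 2 * (P.γ - P.β) := by
    rw [hP.β_eq]; ring
  rw [hP.engDist_pi hθ, Params.R] at hm
  rw [Params.R] at hr
  rw [norm_engPt_pi P hP hθ]
  set g := P.γ - P.β
  have hgν : g ≤ P.ν := by nlinarith [mul_pos hg0 hν]
  have hgρ := mul_pos hg0 hρ
  have hγρ := hP.γρ_pos
  have hρT : g * P.ρA < P.ρT := by nlinarith
  refine lt_of_mul_lt_mul_left (a := P.ν) ?_ hν.le
  rw [hm]
  have hνr := mul_le_mul_of_nonneg_left hr hν.le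
  -- The sign tells whether the front engagement point lies past the centre.
  rcases le_total (P.rT + g * P.ρA - P.ρA) 0 with h | h
  · rw [abs_of_nonpos h]
    nlinarith [mul_pos (sub_pos.2 hν1) (sub_pos.2 hρT)]
  · rw [abs_of_nonneg h]
    have h3 : (1 - P.ν + 2 * g) * P.ρA ≤ (1 - P.ν) * P.ρT := by
      calc (1 - P.ν + 2 * g) * P.ρA = (1 - P.ν) * ((1 + 2 * P.γ) * P.ρA) := by
            linear_combination (-P.ρA) * h2
        _ ≤ _ := mul_le_mul_of_nonneg_left h1 (sub_nonneg.2 hν1.le)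
    have h4 : P.ν * P.rT ≤ P.ν * P.ρA := mul_le_mul_of_nonneg_left hrT hν.le
    have h5 : 0 < 1 - P.ν + 2 * g - P.ν := by nlinarith
    have h6 := mul_pos h5 hρ
    have h7 : g * (1 + P.ν) * P.ρA = P.ν * P.ρA := by rw [hg]
    nlinarith

theorem reach_of_small {P : Params} (hP : P.Regime) (hrT : P.rT ≤ P.ρA) {y : Plane}
    (hy : ‖y‖ ≤ P.R - P.ρA) : Reach P y := by
  refine ⟨Real.pi, ?_⟩
  have := norm_add_lt_engTime hP hrT hy Real.cos_pi
  linarith [norm_sub_le (P.engPt Real.pi) y]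

theorem norm_engPt_pi_le {P : Params} (hP : P.Regime) (hrT : P.ρA ≤ P.rT) {θ : ℝ}
    (hθ : Real.cos θ = -1) : ‖P.engPt θ‖ ≤ P.engTime θ := by
  have hρ := hP.ρA_pos
  have hg := hP.γ_sub_β
  have hg0 := mul_pos (sub_pos.2 hP.β_lt_γ) hρ
  have h1 := hP.engTime_ge' θ
  rw [norm_engPt_pi P hP hθ, abs_of_nonneg (by linarith)]
  rw [hθ] at h1
  refine le_of_mul_le_mul_left (a := P.ν) ?_ hP.ν_pos
  have := hP.βρ_pos
  have h7 : (P.γ - P.β) * (1 + P.ν) * P.ρA = P.ν * P.ρA := by rw [hg]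
  nlinarith

theorem reach_zero {P : Params} (hP : P.Regime) : Reach P 0 := by
  rcases le_total P.rT P.ρA with h | h
  · exact reach_of_small hP h (by rw [norm_zero]; linarith [hP.c_le, hP.c_pos])
  · exact ⟨Real.pi, by rw [sub_zero]; exact norm_engPt_pi_le hP h Real.cos_pi⟩

/-- Positions close to the point of arrival of the intruder. -/
theorem reach_of_near {P : Params} (hP : P.Regime) {z : Plane} (hz : P.c ≤ ‖z‖)
    (hnear : ‖radial P 0 0 - z‖ ≤ P.ρA) : Reach P ((P.c / ‖z‖) • z) := by
  have hc := hP.c_pos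
  have hzpos : 0 < ‖z‖ := hc.trans_le hz
  have hρ := hP.ρA_pos
  set y := (P.c / ‖z‖) • z with hy
  refine ⟨Real.pi, ?_⟩
  -- `e` and `y` are the radial projections of the arrival point and of `z` to the circle of radius
  -- `c`. Both originals lie on or outside it, so projecting does not increase their distance.
  set e : Plane := !₂[P.c, 0] with he
  have h1 : ‖e - y‖ ≤ P.ρA := by
    rw [Plane.norm_le_iff hρ.le]
    have h2 := (Plane.norm_le_iff hρ.le).1 hnear
    have h3 := Plane.norm_sq z
    simp only [PiLp.sub_apply, radial_zero_apply_zero, radial_zero_apply_one, mul_zero,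
      sub_zero] at h2
    refine le_trans ?_ h2
    have hR : P.c ≤ P.R := by linarith [hP.c_le]
    have hz0 : z 0 ≤ ‖z‖ := le_of_abs_le (abs_le_of_sq_le_sq (by nlinarith) hzpos.le)
    have e0 : y 0 = P.c * (z 0 / ‖z‖) := by simp [hy]; ring
    have e1 : y 1 = P.c * (z 1 / ‖z‖) := by simp [hy]; ring
    set C := z 0 / ‖z‖ with hC
    set S := z 1 / ‖z‖ with hS
    have hz0' : z 0 = ‖z‖ * C := (mul_div_cancel₀ _ hzpos.ne').symm
    have hz1' : z 1 = ‖z‖ * S := (mul_div_cancel₀ _ hzpos.ne').symm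
    have hCS : C ^ 2 + S ^ 2 = 1 := by
      rw [hC, hS, div_pow, div_pow, ← add_div, ← h3, div_self (pow_ne_zero 2 hzpos.ne')]
    have hC1 : C ≤ 1 := (div_le_one hzpos).2 hz0
    have hprod : P.c * P.c ≤ ‖z‖ * P.R := mul_le_mul hz hR hc.le hzpos.le
    simp only [PiLp.sub_apply, he, e0, e1, hz0', hz1', Matrix.cons_val_zero,
      Matrix.cons_val_one]
    have key : (P.R - ‖z‖ * C) ^ 2 + (0 - ‖z‖ * S) ^ 2 - ((P.c - P.c * C) ^ 2 +
        (0 - P.c * S) ^ 2) = (‖z‖ - P.R) ^ 2 + 2 * (‖z‖ * P.R - P.c * P.c) * (1 - C) := by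
      linear_combination (‖z‖ ^ 2 - P.c ^ 2) * hCS
    have := mul_nonneg (sub_nonneg.2 hprod) (sub_nonneg.2 hC1)
    nlinarith [sq_nonneg (‖z‖ - P.R)]
  obtain ⟨h0, h1'⟩ := engPt_pi P hP Real.cos_pi
  have hg := hP.γ_sub_β
  have hg0 := sub_pos.2 hP.β_lt_γ
  have hγβ : P.γ - P.β < P.γ := by linarith [hP.β_pos]
  have h2 : ‖P.engPt Real.pi - e‖ = P.c - (P.rT + (P.γ - P.β) * P.ρA - P.ρA) := by
    have hpos : 0 ≤ P.c - (P.rT + (P.γ - P.β) * P.ρA - P.ρA) := by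
      rw [Params.c]; nlinarith [hP.γρ_pos]
    rw [← abs_of_nonneg hpos, ← abs_norm, ← sq_eq_sq_iff_abs_eq_abs, Plane.norm_sq]
    simp only [PiLp.sub_apply, h0, h1', he, Matrix.cons_val_zero,
      Matrix.cons_val_one]
    ring
  have h3 := norm_sub_le_norm_sub_add_norm_sub (P.engPt Real.pi) e y
  refine h3.trans ((add_le_add_right h1 _).trans ?_)
  rw [h2, Params.c]
  refine le_of_mul_le_mul_left (a := P.ν) ?_ hP.ν_pos
  have hm := hP.engDist_pi Real.cos_pi
  rw [Params.engTime_mul hP, hm, Params.R]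
  have h5 := hP.ρT_ge
  have h6 : 2 * P.γ * (1 - P.ν) = 2 * (P.γ - P.β) := by rw [hP.β_eq]; ring
  have h7 : (P.γ - P.β) * (1 + P.ν) * P.ρA = P.ν * P.ρA := by rw [hg]
  have h8 : 2 * P.γ * (1 - P.ν) * P.ρA = 2 * (P.γ - P.β) * P.ρA := by rw [h6]
  have h9 := mul_pos (sub_pos.2 hP.ν_lt_one) hρ
  nlinarith

/-! ### The set of these positions is star-shaped -/

theorem hasDerivAt_engTime {P : Params} (hP : P.Regime) (θ : ℝ) :
    HasDerivAt P.engTime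
      (P.γ * P.ρA * Real.sin θ * P.engDist θ / P.engRoot θ) θ := by
  have h := ((hasDerivAt_engDist hP θ).const_sub P.R).div_const P.ν
  refine h.congr_deriv ?_
  have := hP.engRoot_pos θ
  have := hP.ν_pos
  rw [hP.β_eq]; field_simp

theorem hasDerivAt_engPt_zero {P : Params} (hP : P.Regime) (θ : ℝ) :
    HasDerivAt (fun θ => P.engPt θ 0)
      (-(P.β * P.ρA * Real.sin θ * P.engDist θ / P.engRoot θ) - P.ρA * Real.sin θ) θ := by
  have h := (hasDerivAt_engDist hP θ).add ((Real.hasDerivAt_cos θ).const_mul P.ρA)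
  refine h.congr_deriv ?_
  ring

theorem hasDerivAt_engPt_one (P : Params) (θ : ℝ) :
    HasDerivAt (fun θ => P.engPt θ 1) (P.ρA * Real.cos θ) θ :=
  (Real.hasDerivAt_sin θ).const_mul P.ρA

theorem continuous_engTime {P : Params} (hP : P.Regime) : Continuous P.engTime :=
  continuous_iff_continuousAt.2 fun θ => (hasDerivAt_engTime hP θ).continuousAt

theorem continuous_engPt_zero {P : Params} (hP : P.Regime) : Continuous fun θ => P.engPt θ 0 :=
  continuous_iff_continuousAt.2 fun θ => (hasDerivAt_engPt_zero hP θ).continuousAt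

theorem continuous_engPt_one (P : Params) : Continuous fun θ => P.engPt θ 1 :=
  continuous_iff_continuousAt.2 fun θ => (hasDerivAt_engPt_one P θ).continuousAt

theorem engPt_zero_pos {P : Params} (hP : P.Regime) (hrT : P.ρA ≤ P.rT) (θ : ℝ) :
    0 < P.engPt θ 0 := by
  rw [Params.engPt_zero]
  nlinarith [hP.rT_lt_engDist θ, Real.neg_one_le_cos θ, hP.ρA_pos]

theorem eq_of_cos_eq {P : Params} {θ θ' : ℝ} (h : Real.cos θ = Real.cos θ') :
    P.engDist θ = P.engDist θ' ∧ P.engTime θ = P.engTime θ' ∧ P.engPt θ 0 = P.engPt θ' 0 := by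
  have hs : Real.sin θ ^ 2 = Real.sin θ' ^ 2 := by rw [Real.sin_sq, Real.sin_sq, h]
  have h1 : P.engDist θ = P.engDist θ' := by
    rw [Params.engDist, Params.engDist, Params.engRoot, Params.engRoot, mul_pow, hs, ← mul_pow, h]
  exact ⟨h1, by rw [Params.engTime, h1]; rfl, by rw [Params.engPt_zero, Params.engPt_zero, h1, h]⟩

/-- A ray that touches the disc of reach of an engagement point from above leaves the intruder's
circle there. -/
theorem tangent_ray_nonneg {P : Params} (hP : P.Regime) (hrT : P.ρA ≤ P.rT) {θ u₀ u₁ : ℝ}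
    (hs : 0 ≤ Real.sin θ) (hu : u₀ ^ 2 + u₁ ^ 2 = 1) (hu1 : 0 ≤ u₁)
    (hp : 0 < P.engPt θ 0 * u₀ + P.engPt θ 1 * u₁)
    (hd : P.engPt θ 0 * u₁ - P.engPt θ 1 * u₀ = P.engTime θ) :
    0 ≤ Real.sin θ * u₁ + Real.cos θ * u₀ := by
  have hρ := hP.ρA_pos
  have hν := hP.ν_pos
  have ha := hP.engDist_pos θ
  rw [Params.engPt_zero, Params.engPt_one] at hp hd
  rcases lt_or_ge u₀ 0 with h0 | h0
  · have h1 : 0 < P.ρA * (Real.sin θ * u₁ + Real.cos θ * u₀) := by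
      nlinarith [mul_neg_of_pos_of_neg ha h0]
    exact (pos_of_mul_pos_right h1 hρ.le).le
  -- Otherwise the contact is in front (`κ > 0`) with `u₁ ≤ κ`, and the bound `ν rT + 2βρA ≤ ρT`
  -- leads to `2β ≤ νβ`.
  by_contra hcon
  push Not at hcon
  set κ := -Real.cos θ with hκ
  set s := Real.sin θ
  have hcos : Real.cos θ = -κ := by rw [hκ, neg_neg]
  have hS : s ^ 2 + κ ^ 2 = 1 := by rw [hκ, neg_sq]; exact Real.sin_sq_add_cos_sq θ
  rw [hcos] at hcon hd
  have hκ1 : κ ≤ 1 := by nlinarith [sq_nonneg s]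
  have hsu : 0 ≤ s * u₁ := mul_nonneg hs hu1
  have hκu : s * u₁ < κ * u₀ := by linarith
  have hκ0 : 0 < κ := by
    by_contra h
    nlinarith [mul_nonneg (neg_nonneg.2 (not_lt.1 h)) h0]
  have hκu1 : u₁ ≤ κ := by
    have h1 := pow_lt_pow_left₀ hκu hsu two_ne_zero
    exact (sq_le_sq₀ hu1 hκ0.le).1 (by nlinarith)
  have hX : u₁ ≤ κ * u₁ + s * u₀ := by
    have h1 : (κ * u₁ + s * u₀) ^ 2 + (κ * u₀ - s * u₁) ^ 2 = 1 := by
      linear_combination (s ^ 2 + κ ^ 2) * hu + hS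
    have h2 : κ * u₀ ≤ u₀ := mul_le_of_le_one_left h0 hκ1
    have h3 : (κ * u₀ - s * u₁) ^ 2 ≤ u₀ ^ 2 :=
      pow_le_pow_left₀ (by linarith) (by linarith) 2
    exact (sq_le_sq₀ hu1 (add_nonneg (mul_nonneg hκ0.le hu1) (mul_nonneg hs h0))).1 (by linarith)
  have hale := hP.engDist_le θ
  rw [hcos] at hale
  have ht := Params.engTime_mul hP θ
  rw [Params.R] at ht
  have hρT := hP.ρT_ge'
  have h1 : (1 + P.ν) * P.rT + 2 * P.β * P.ρA + P.ν * P.ρA * (κ * u₁ + s * u₀) ≤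
      P.engDist θ * (1 + P.ν * u₁) := by
    rw [← hd] at ht
    nlinarith
  have hu1' : u₁ ≤ 1 := hκu1.trans hκ1
  have h2 : P.engDist θ * (1 + P.ν * u₁) ≤
      (P.rT + (P.γ - P.β * κ) * P.ρA) * (1 + P.ν * u₁) :=
    mul_le_mul_of_nonneg_right (by linarith) (by nlinarith [mul_nonneg hν.le hu1])
  have h3 : P.ν * P.ρA * u₁ ≤ P.ν * P.ρA * (κ * u₁ + s * u₀) :=
    mul_le_mul_of_nonneg_left hX (mul_pos hν hρ).le
  have h4 : P.ν * (1 - u₁) * P.ρA ≤ P.ν * (1 - u₁) * P.rT :=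
    mul_le_mul_of_nonneg_left hrT (mul_nonneg hν.le (by linarith))
  have h5 : (P.ν + 2 * P.β) * P.ρA ≤ (P.γ - P.β * κ) * (1 + P.ν * u₁) * P.ρA := by nlinarith
  have h6 := le_of_mul_le_mul_right h5 hρ
  have h7 : (P.γ - P.β * κ) * (1 + P.ν * u₁) ≤ P.γ := by
    rw [hP.β_eq]
    have e : (P.γ - P.ν * P.γ * κ) * (1 + P.ν * u₁) =
        P.γ - P.γ * P.ν * (κ - u₁) - P.γ * P.ν ^ 2 * (κ * u₁) := by ring
    rw [e]
    have := mul_nonneg (mul_pos hP.γ_pos hν).le (sub_nonneg.2 hκu1)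
    have := mul_nonneg (mul_pos hP.γ_pos (pow_pos hν 2)).le (mul_nonneg hκ0.le hu1)
    linarith
  have h8 := hP.γ_eq
  have h9 := mul_lt_mul_of_pos_right hP.ν_lt_one hP.β_pos
  linarith [hP.β_pos]

/-- By `tangent_ray_nonneg` the derivative of radius of reach minus offset from the ray is positive
at a tangency, so increasing `θ` moves the ray strictly into the discs of reach. -/
theorem eventually_cross_lt_engTime {P : Params} (hP : P.Regime) (hrT : P.ρA ≤ P.rT)
    {φ u₀ u₁ : ℝ} (hφ0 : 0 ≤ φ) (hφπ : φ < Real.pi) (hu : u₀ ^ 2 + u₁ ^ 2 = 1) (hu1 : 0 ≤ u₁)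
    (hp : 0 < P.engPt φ 0 * u₀ + P.engPt φ 1 * u₁)
    (hd : P.engPt φ 0 * u₁ - P.engPt φ 1 * u₀ = P.engTime φ) :
    ∀ᶠ θ in nhdsWithin φ (Ioi φ), P.engPt θ 0 * u₁ - P.engPt θ 1 * u₀ < P.engTime θ := by
  have hsφ : 0 ≤ Real.sin φ := Real.sin_nonneg_of_nonneg_of_le_pi hφ0 hφπ.le
  have hnn := tangent_ray_nonneg hP hrT hsφ hu hu1 hp hd
  have hder := (hasDerivAt_engTime hP φ).sub
    (((hasDerivAt_engPt_zero hP φ).mul_const u₁).sub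
      ((hasDerivAt_engPt_one P φ).mul_const u₀))
  set D := P.γ * P.ρA * Real.sin φ * P.engDist φ / P.engRoot φ -
    ((-(P.β * P.ρA * Real.sin φ * P.engDist φ / P.engRoot φ) - P.ρA * Real.sin φ) * u₁ -
      P.ρA * Real.cos φ * u₀) with hD
  have hDpos : 0 < D := by
    have e : D = P.ρA * Real.sin φ * (P.engDist φ / P.engRoot φ) * (P.γ + P.β * u₁) +
        P.ρA * (Real.sin φ * u₁ + Real.cos φ * u₀) := by rw [hD]; ring
    rw [e]
    have hρ := hP.ρA_pos
    have hγ := hP.γ_pos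
    have hβ := hP.β_pos
    have hq : 0 < P.engDist φ / P.engRoot φ := div_pos (hP.engDist_pos φ) (hP.engRoot_pos φ)
    have hgb : 0 < P.γ + P.β * u₁ := add_pos_of_pos_of_nonneg hγ (mul_nonneg hβ.le hu1)
    rcases hsφ.eq_or_lt with h0 | h0
    · have hcφ : Real.cos φ = 1 := by
        have h1 := Real.sin_sq_add_cos_sq φ
        rw [← h0] at h1
        have h2 : -1 < Real.cos φ := by
          rw [← Real.cos_pi]; exact Real.cos_lt_cos_of_nonneg_of_le_pi hφ0 le_rfl hφπ
        nlinarith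
      rw [Params.engPt_one, ← h0, mul_zero, zero_mul, add_zero] at hp
      have h4 : 0 < u₀ := pos_of_mul_pos_right hp (engPt_zero_pos hP hrT φ).le
      rw [← h0, hcφ]
      simp only [mul_zero, zero_mul, zero_add, one_mul]
      positivity
    · have h1 := mul_nonneg hρ.le hnn
      have h2 := mul_pos (mul_pos (mul_pos hρ h0) hq) hgb
      linarith
  have hslope := (hasDerivAt_iff_tendsto_slope.1 hder).eventually (lt_mem_nhds hDpos)
  have hsub : nhdsWithin φ (Ioi φ) ≤ nhdsWithin φ {φ}ᶜ :=
    nhdsWithin_mono _ fun x hx => ne_of_gt hx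
  filter_upwards [hsub hslope, self_mem_nhdsWithin] with θ h1 h2
  rw [slope_def_field] at h1
  have h3 := (div_pos_iff_of_pos_right (sub_pos.2 h2)).1 h1
  simp only [Pi.sub_apply] at h3
  linarith

/-- Suppose that `l • y` lies in no disc of reach. Among the angles whose disc meets the line
through `y` with its centre projecting beyond `l • y`, take the largest one up to `π`. It is not
`π`, since the front disc contains the origin and would contain `l • y`; but slightly larger angles
still qualify, by `eventually_cross_lt_engTime` in the tangent case. -/
theorem reach_smul_of_nonneg {P : Params} (hP : P.Regime) (hrT : P.ρA ≤ P.rT) {y : Plane}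
    (hy1 : 0 ≤ y 1) (hy : Reach P y) {l : ℝ} (hl : 0 ≤ l) (hl1 : l ≤ 1) : Reach P (l • y) := by
  rcases eq_or_ne y 0 with rfl | hy0
  · rwa [smul_zero]
  have hr : 0 < ‖y‖ := norm_pos_iff.2 hy0
  set r := ‖y‖ with hrdef
  set u₀ := y 0 / r with hu₀
  set u₁ := y 1 / r with hu₁
  have hy0' : y 0 = r * u₀ := (mul_div_cancel₀ _ hr.ne').symm
  have hy1' : y 1 = r * u₁ := (mul_div_cancel₀ _ hr.ne').symm
  have hu : u₀ ^ 2 + u₁ ^ 2 = 1 := by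
    have h3 := Plane.norm_sq y
    rw [hu₀, hu₁, div_pow, div_pow, ← add_div, ← h3, div_self (pow_ne_zero 2 hr.ne')]
  have hu1 : 0 ≤ u₁ := div_nonneg hy1 hr.le
  have hu0 : u₀ ≤ 1 := by nlinarith [sq_nonneg u₁]
  by_contra hcon
  simp only [Reach, not_exists, not_le] at hcon
  set p : ℝ → ℝ := fun θ => P.engPt θ 0 * u₀ + P.engPt θ 1 * u₁ with hp
  set d : ℝ → ℝ := fun θ => P.engPt θ 0 * u₁ - P.engPt θ 1 * u₀ with hd
  have hpd : ∀ θ, p θ ^ 2 + d θ ^ 2 = ‖P.engPt θ‖ ^ 2 := fun θ => by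
    rw [Plane.norm_sq]
    simp only [hp, hd]
    linear_combination (P.engPt θ 0 ^ 2 + P.engPt θ 1 ^ 2) * hu
  have hdist : ∀ k θ, ‖P.engPt θ - k • y‖ ^ 2 = (k * r - p θ) ^ 2 + d θ ^ 2 := fun k θ => by
    rw [Plane.norm_sq]
    simp only [PiLp.sub_apply, PiLp.smul_apply, smul_eq_mul, hy0', hy1', hp, hd]
    linear_combination (k ^ 2 * r ^ 2 - (P.engPt θ 0 ^ 2 + P.engPt θ 1 ^ 2)) * hu
  have ht0 : ∀ θ, 0 < P.engTime θ := hP.engTime_pos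
  have hout : ∀ θ, P.engTime θ ^ 2 < (l * r - p θ) ^ 2 + d θ ^ 2 := fun θ => by
    rw [← hdist]; exact pow_lt_pow_left₀ (hcon θ) (ht0 θ).le two_ne_zero
  have hlr : 0 ≤ l * r := mul_nonneg hl hr.le
  obtain ⟨θ₀, hθ₀⟩ := hy
  -- Folding the angle into `[0, π]` moves the engagement point to the side of `y`, which does not
  -- increase the distance.
  set θ₁ := Real.arccos (Real.cos θ₀) with hθ₁
  have hcos : Real.cos θ₁ = Real.cos θ₀ :=
    Real.cos_arccos (Real.neg_one_le_cos _) (Real.cos_le_one _)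
  have hsin : 0 ≤ Real.sin θ₁ :=
    Real.sin_nonneg_of_nonneg_of_le_pi (Real.arccos_nonneg _) (Real.arccos_le_pi _)
  have hin : (r - p θ₁) ^ 2 + d θ₁ ^ 2 ≤ P.engTime θ₁ ^ 2 := by
    obtain ⟨-, e2, e3⟩ := eq_of_cos_eq (P := P) hcos
    have h1 := hdist 1 θ₁
    rw [one_mul, one_smul] at h1
    rw [← h1, e2]
    refine le_trans ?_ (pow_le_pow_left₀ (norm_nonneg _) hθ₀ 2)
    rw [Plane.norm_sq, Plane.norm_sq]
    simp only [PiLp.sub_apply, e3, Params.engPt_one]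
    have hss : Real.sin θ₁ ^ 2 = Real.sin θ₀ ^ 2 := by rw [Real.sin_sq, Real.sin_sq, hcos]
    have hle : Real.sin θ₀ ≤ Real.sin θ₁ :=
      le_of_abs_le (abs_le_of_sq_le_sq hss.ge hsin)
    have h2 := mul_nonneg (mul_nonneg hP.ρA_pos.le hy1) (sub_nonneg.2 hle)
    have h3 : (P.ρA * Real.sin θ₁) ^ 2 = (P.ρA * Real.sin θ₀) ^ 2 := by
      rw [mul_pow, mul_pow, hss]
    nlinarith only [h2, h3]
  have hmem₁ : |d θ₁| ≤ P.engTime θ₁ ∧ l * r ≤ p θ₁ := by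
    refine ⟨abs_le_of_sq_le_sq (by nlinarith [sq_nonneg (r - p θ₁)]) (ht0 _).le, ?_⟩
    by_contra h
    push Not at h
    have h1 : l * r ≤ r := mul_le_of_le_one_left hr.le hl1
    have h2 : (l * r - p θ₁) ^ 2 ≤ (r - p θ₁) ^ 2 :=
      pow_le_pow_left₀ (by linarith) (by linarith) 2
    linarith [hout θ₁]
  have hpc : Continuous p :=
    ((continuous_engPt_zero hP).mul continuous_const).add
      ((continuous_engPt_one P).mul continuous_const)
  have hdc : Continuous d :=
    ((continuous_engPt_zero hP).mul continuous_const).sub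
      ((continuous_engPt_one P).mul continuous_const)
  have htc := continuous_engTime hP
  have hcl : IsClosed {θ | |d θ| ≤ P.engTime θ ∧ l * r ≤ p θ} :=
    (isClosed_le hdc.abs htc).inter (isClosed_le continuous_const hpc)
  obtain ⟨φ, ⟨hφ, hφd, hφp⟩, hmax⟩ := (isCompact_Icc.inter_right hcl (s := Icc θ₁ Real.pi)).exists_isGreatest
    ⟨θ₁, ⟨le_rfl, Real.arccos_le_pi _⟩, hmem₁⟩
  have hφ0 : 0 ≤ φ := (Real.arccos_nonneg _).trans hφ.1
  have hsφ : 0 ≤ Real.sin φ := Real.sin_nonneg_of_nonneg_of_le_pi hφ0 hφ.2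
  have hplt : l * r < p φ := by
    refine lt_of_le_of_ne hφp fun h => ?_
    have h1 := hout φ
    rw [h, sub_self] at h1
    have h2 : d φ ^ 2 ≤ P.engTime φ ^ 2 := by
      rw [← sq_abs]; exact pow_le_pow_left₀ (abs_nonneg _) hφd 2
    linarith
  have hφπ : φ < Real.pi := by
    refine lt_of_le_of_ne hφ.2 fun h => ?_
    have h1 := norm_engPt_pi_le hP hrT (θ := φ) (by rw [h, Real.cos_pi])
    have h2 := hpd φ
    have h3 := pow_le_pow_left₀ (norm_nonneg _) h1 2
    have h4 : (p φ - l * r) ^ 2 ≤ p φ ^ 2 :=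
      pow_le_pow_left₀ (by linarith) (by linarith) 2
    nlinarith [hout φ]
  have hdlow : -P.engTime φ < d φ := by
    have h1 := hP.ρ_lt_engTime φ
    have h2 := mul_nonneg (engPt_zero_pos hP hrT φ).le hu1
    have h3 : P.engPt φ 1 * u₀ ≤ P.ρA := by
      rw [Params.engPt_one]
      have h4 := mul_le_mul_of_nonneg_left (Real.sin_le_one φ) hP.ρA_pos.le
      have h5 := mul_le_mul_of_nonneg_left hu0 (mul_nonneg hP.ρA_pos.le hsφ)
      linarith
    simp only [hd]; linarith
  have hdle : d φ ≤ P.engTime φ := (abs_le.1 hφd).2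
  have hright : ∀ᶠ θ in nhdsWithin φ (Ioi φ), d θ < P.engTime θ := by
    rcases hdle.eq_or_lt with heq | hlt
    · exact eventually_cross_lt_engTime hP hrT hφ0 hφπ hu hu1 (hlr.trans_lt hplt) heq
    · exact mem_nhdsWithin_of_mem_nhds
        (hdc.continuousAt.eventually_lt htc.continuousAt hlt)
  have h2 : ∀ᶠ θ in nhdsWithin φ (Ioi φ), -P.engTime θ < d θ := mem_nhdsWithin_of_mem_nhds
    (htc.neg.continuousAt.eventually_lt hdc.continuousAt hdlow)
  have h3 : ∀ᶠ θ in nhdsWithin φ (Ioi φ), l * r < p θ := mem_nhdsWithin_of_mem_nhds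
    (continuousAt_const.eventually_lt hpc.continuousAt hplt)
  have h4 : ∀ᶠ θ in nhdsWithin φ (Ioi φ), θ < Real.pi := mem_nhdsWithin_of_mem_nhds
    (Iio_mem_nhds hφπ)
  obtain ⟨θ, ⟨⟨⟨g1, g2⟩, g3⟩, g4⟩, g5⟩ :=
    ((((hright.and h2).and h3).and h4).and self_mem_nhdsWithin).exists
  have : θ ≤ φ := hmax ⟨⟨hφ.1.trans (le_of_lt g5), g4.le⟩, abs_le.2 ⟨g2.le, g1.le⟩, g3.le⟩
  exact absurd g5 (not_lt.2 this)

theorem Reach.smul {P : Params} (hP : P.Regime) (hrT : P.ρA ≤ P.rT) {y : Plane} (hy : Reach P y)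
    {l : ℝ} (hl : 0 ≤ l) (hl1 : l ≤ 1) : Reach P (l • y) := by
  rcases le_total 0 (y 1) with h | h
  · exact reach_smul_of_nonneg hP hrT h hy hl hl1
  · have h1 := reach_smul_of_nonneg hP hrT (y := TargetDefense.refl y)
      (by rw [refl_apply]; simpa using h) hy.refl hl hl1
    have h2 := h1.refl
    rwa [map_smul, refl_refl] at h2

/-! ### Upper bounds for the guarantee of a strategy -/

theorem IsMotion.le_norm_sub_of_lt {v w ρ s : ℝ} {x y : ℝ → Plane} (hx : IsMotion v x)
    (hy : IsMotion w y) (hs : 0 < s) (h : ∀ u, 0 ≤ u → u < s → ρ < ‖x u - y u‖) :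
    ρ ≤ ‖x s - y s‖ := by
  have hc : ContinuousOn (fun u => ‖x u - y u‖) (Ici 0) :=
    (hx.continuousOn.sub hy.continuousOn).norm
  have h1 : Filter.Tendsto (fun u => ‖x u - y u‖) (nhdsWithin s (Ioo 0 s)) (nhds ‖x s - y s‖) :=
    (hc s hs.le).mono_left (nhdsWithin_mono _ fun u hu => hu.1.le)
  have : (nhdsWithin s (Ioo 0 s)).NeBot := right_nhdsWithin_Ioo_neBot hs
  refine ge_of_tendsto h1 ?_
  filter_upwards [self_mem_nhdsWithin] with u hu
  exact (h u hu.1.le hu.2).le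

/-! ### The Apollonius disc at first contact -/

/-- Center of the Apollonius disc of an intruder at `x` and a defender at `d`. -/
def apolloniusCenter (P : Params) (x d : Plane) : Plane := x - P.β • (d - x)

theorem apollonius_identity {P : Params} (hP : P.Regime) {x d : Plane} (h : ‖d - x‖ = P.ρA)
    (z : Plane) :
    (1 - P.ν ^ 2) * (‖z - apolloniusCenter P x d‖ ^ 2 - (P.γ * P.ρA) ^ 2) =
      ‖z - x‖ ^ 2 - P.ν ^ 2 * ‖z - d‖ ^ 2 := by
  have h1 := Plane.norm_sq (d - x)
  rw [h] at h1
  simp only [Plane.norm_sq, apolloniusCenter, PiLp.sub_apply, PiLp.smul_apply, smul_eq_mul] at h1 ⊢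
  have h2 : P.β * (1 - P.ν ^ 2) = P.ν ^ 2 := by
    rw [hP.β_eq]; linear_combination P.ν * hP.γ_mul
  have h3 := hP.γ_sq
  linear_combination (2 * ((z 0 - x 0) * (d 0 - x 0) + (z 1 - x 1) * (d 1 - x 1)) - P.ρA ^ 2) * h2 -
    (1 - P.ν ^ 2) * P.ρA ^ 2 * h3 - ((1 - P.ν ^ 2) * P.β ^ 2 + P.ν ^ 2) * h1

theorem le_of_mem_apollonius {P : Params} (hP : P.Regime) {x d z : Plane} (h : ‖d - x‖ = P.ρA)
    (hz : ‖z - apolloniusCenter P x d‖ ≤ P.γ * P.ρA) : ‖z - x‖ ≤ P.ν * ‖z - d‖ := by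
  have h1 := apollonius_identity hP h z
  have h2 := pow_le_pow_left₀ (norm_nonneg _) hz 2
  refine (sq_le_sq₀ (norm_nonneg _) (mul_nonneg hP.ν_pos.le (norm_nonneg _))).1 ?_
  rw [mul_pow]
  nlinarith [mul_nonneg hP.k_pos.le (sub_nonneg.2 h2)]

theorem lt_of_mem_apollonius {P : Params} (hP : P.Regime) {x d z : Plane} (h : ‖d - x‖ = P.ρA)
    (hz : ‖z - apolloniusCenter P x d‖ < P.γ * P.ρA) : ‖z - x‖ < P.ν * ‖z - d‖ := by
  have h1 := apollonius_identity hP h z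
  have h2 := pow_lt_pow_left₀ hz (norm_nonneg _) two_ne_zero
  refine (sq_lt_sq₀ (norm_nonneg _) (mul_nonneg hP.ν_pos.le (norm_nonneg _))).1 ?_
  rw [mul_pow]
  nlinarith [mul_pos hP.k_pos (sub_pos.2 h2)]

/-- The open Apollonius disc meets the target; the witness is the point of the target nearest to the
centre of the disc. -/
theorem exists_breach_point {P : Params} (hP : P.Regime) {x d : Plane} (h : ‖d - x‖ = P.ρA)
    (hC : ‖apolloniusCenter P x d‖ < P.rT + P.γ * P.ρA) :
    ∃ z : Plane, ‖z‖ ≤ P.rT ∧ ‖z - x‖ < P.ν * ‖z - d‖ := by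
  set C := apolloniusCenter P x d with hCdef
  rcases le_or_gt ‖C‖ P.rT with h1 | h1
  · refine ⟨C, h1, lt_of_mem_apollonius hP h ?_⟩
    rw [← hCdef, sub_self, norm_zero]; exact hP.γρ_pos
  · have hC0 : 0 < ‖C‖ := hP.rT_pos.trans h1
    refine ⟨(P.rT / ‖C‖) • C, ?_, lt_of_mem_apollonius hP h ?_⟩
    · rw [norm_smul, Real.norm_of_nonneg (div_pos hP.rT_pos hC0).le, div_mul_cancel₀ _ hC0.ne']
    · have e : (P.rT / ‖C‖) • C - C = (-((‖C‖ - P.rT) / ‖C‖)) • C := by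
        rw [sub_div, div_self hC0.ne']; module
      rw [← hCdef, e, norm_smul, norm_neg,
        Real.norm_of_nonneg (div_nonneg (sub_nonneg.2 h1.le) hC0.le), div_mul_cancel₀ _ hC0.ne']
      linarith

/-- The closed disc contains `x`, of norm at most `c`, and its centre pushed outwards by `γρA`, of
norm at least `c`. The segment between them lies in the disc by convexity and crosses the circle of
radius `c`. -/
theorem exists_far_point {P : Params} (hP : P.Regime) {x d : Plane} (h : ‖d - x‖ = P.ρA)
    (hx : ‖x‖ ≤ P.c) (hC : P.rT + P.γ * P.ρA ≤ ‖apolloniusCenter P x d‖) :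
    ∃ z : Plane, ‖z‖ = P.c ∧ ‖z - x‖ ≤ P.ν * ‖z - d‖ := by
  set C := apolloniusCenter P x d with hCdef
  have hγρ := hP.γρ_pos
  have hC0 : 0 < ‖C‖ := by linarith [hP.rT_pos]
  set w : Plane := (1 + P.γ * P.ρA / ‖C‖) • C with hw
  have hwn : P.c ≤ ‖w‖ := by
    rw [hw, norm_smul, Real.norm_of_nonneg (by positivity), add_mul, div_mul_cancel₀ _ hC0.ne',
      Params.c]
    linarith
  have hwC : w ∈ Metric.closedBall C (P.γ * P.ρA) := by
    have e : w - C = (P.γ * P.ρA / ‖C‖) • C := by rw [hw]; module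
    rw [mem_closedBall_iff_norm, e, norm_smul, Real.norm_of_nonneg (by positivity),
      div_mul_cancel₀ _ hC0.ne']
  have hxC : x ∈ Metric.closedBall C (P.γ * P.ρA) := by
    have e : x - C = P.β • (d - x) := by rw [hCdef, apolloniusCenter]; module
    rw [mem_closedBall_iff_norm, e, norm_smul, Real.norm_of_nonneg hP.β_pos.le, h]
    exact mul_le_mul_of_nonneg_right hP.β_lt_γ.le hP.ρA_pos.le
  have hcont : ContinuousOn (fun l : ℝ => ‖x + l • (w - x)‖) (Icc 0 1) := by fun_prop
  obtain ⟨l, hl, hlc⟩ := intermediate_value_Icc zero_le_one hcont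
    (show P.c ∈ Icc _ _ from ⟨by simpa using hx, by simpa using hwn⟩)
  refine ⟨x + l • (w - x), hlc, le_of_mem_apollonius hP h ?_⟩
  rw [← mem_closedBall_iff_norm]
  exact (convex_closedBall C _).add_smul_sub_mem hxC hwC hl

theorem norm_apolloniusCenter_lt {P : Params} (hP : P.Regime) {t θ : ℝ} {d : Plane}
    (hd : d - radial P 0 t = P.ρA • dir θ) (ha : 0 < P.R - P.ν * t)
    (h : P.R - P.ν * t < P.engDist θ) :
    ‖apolloniusCenter P (radial P 0 t) d‖ < P.rT + P.γ * P.ρA := by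
  have h1 : ¬ _ := fun h' => absurd h (not_lt.2 (hP.engDist_le_of ha h'))
  rw [not_le] at h1
  refine (sq_lt_sq₀ (norm_nonneg _) (add_pos hP.rT_pos hP.γρ_pos).le).1 ?_
  rw [Plane.norm_sq, apolloniusCenter, hd]
  simp only [PiLp.sub_apply, PiLp.smul_apply, smul_eq_mul, radial_zero_apply_zero,
    radial_zero_apply_one, dir, Matrix.cons_val_zero, Matrix.cons_val_one]
  have h2 := hP.γ_sq
  have h3 := Real.sin_sq_add_cos_sq θ
  have h4 : (P.rT + P.γ * P.ρA) ^ 2 - ((P.R - P.ν * t - P.β * (P.ρA * Real.cos θ)) ^ 2 +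
      (0 - P.β * (P.ρA * Real.sin θ)) ^ 2) =
      P.rT ^ 2 + 2 * P.γ * P.ρA * P.rT + P.β * P.ρA ^ 2 -
        ((P.R - P.ν * t) ^ 2 - 2 * (P.β * P.ρA) * Real.cos θ * (P.R - P.ν * t)) := by
    linear_combination P.ρA ^ 2 * h2 - P.β ^ 2 * P.ρA ^ 2 * h3
  linarith

/-- The first contact on the radial approach. -/
theorem contact_or_undetected {P : Params} (hP : P.Regime) {y : Plane}
    (σ : DefenderStrategy P y) :
    (∀ u, 0 ≤ u → u ≤ P.ρT / P.ν → P.ρA < ‖radial P 0 u - σ.move (radial P 0) u‖) ∨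
    ∃ t, 0 ≤ t ∧ P.ν * t ≤ P.ρT ∧ ‖radial P 0 t - σ.move (radial P 0) t‖ ≤ P.ρA ∧
      (∀ u, 0 ≤ u → u < t → P.ρA < ‖radial P 0 u - σ.move (radial P 0) u‖) ∧
      (0 < t → ‖radial P 0 t - σ.move (radial P 0) t‖ = P.ρA) := by
  by_cases h : ∀ u, 0 ≤ u → u ≤ P.ρT / P.ν → P.ρA < ‖radial P 0 u - σ.move (radial P 0) u‖
  · exact Or.inl h
  push Not at h
  obtain ⟨u, hu0, hu1, hu2⟩ := h
  have hx := radial_isMotion P hP.ν_pos.le 0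
  have hy := σ.speed _ hx
  obtain ⟨t, ht0, htu, htc, hbef⟩ := exists_first_contact hx hy hu0 hu2
  refine Or.inr ⟨t, ht0, ?_, htc, hbef, fun ht => le_antisymm htc (hx.le_norm_sub_of_lt hy ht hbef)⟩
  rw [mul_comm]
  exact (le_div_iff₀ hP.ν_pos).1 (htu.trans hu1)

/-- The intruder breaches if the Apollonius disc meets the target properly, and otherwise insists on
a point at distance at least `c`, where the future is worth at most `m`. Without capture the payoff
is covered by `h2`. -/
theorem guarantee_le_one_add {P : Params} (hP : P.Regime) {U : Plane → ENNReal} {m : ENNReal}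
    (h1 : ∀ x, P.c ≤ ‖x‖ → U x ≤ m) (h2 : ∀ x, U x ≤ 1 + m) {y : Plane}
    (σ : DefenderStrategy P y) : guarantee P U 0 σ ≤ 1 + m := by
  rcases contact_or_undetected hP σ with h | ⟨t, ht, htT, hc, hbef, heq⟩
  · exact guarantee_le_of_undetected hP.ν_pos hP.ρA_pos hP.rT_pos.le σ hP.ρT_pos.le h h2
  have hcR : P.c ≤ P.R := by linarith [hP.c_le, hP.ρA_pos]
  have hn := norm_radial P 0 t (by rw [Params.R]; linarith [hP.rT_pos])
  rcases le_or_gt P.c (P.R - P.ν * t) with ha | ha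
  -- If contact occurs at distance at least `c`, the intruder simply stops where it is.
  · refine guarantee_le_of_run hP.ν_pos hP.ν_lt_one hP.ρA_pos σ ht hc hbef (z := radial P 0 t) ?_
      (by gcongr; exact h1 _ (by rw [hn]; exact ha)) h2
    rw [sub_self, norm_zero]
    exact mul_nonneg hP.ν_pos.le (norm_nonneg _)
  have htpos : 0 < t := by
    by_contra h
    have : t = 0 := le_antisymm (not_lt.1 h) ht
    rw [this] at ha; linarith
  have hd : ‖σ.move (radial P 0) t - radial P 0 t‖ = P.ρA := by rw [norm_sub_rev]; exact heq htpos
  rcases lt_or_ge ‖apolloniusCenter P (radial P 0 t) (σ.move (radial P 0) t)‖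
    (P.rT + P.γ * P.ρA) with hC | hC
  · obtain ⟨z, hz1, hz2⟩ := exists_breach_point hP hd hC
    exact guarantee_le_of_breach hP.ν_pos hP.ρA_pos σ ht hP.ν_lt_one hc hbef hz2 hz1 h2
  · obtain ⟨z, hz1, hz2⟩ := exists_far_point hP hd (by rw [hn]; exact ha.le) hC
    exact guarantee_le_of_run hP.ν_pos hP.ν_lt_one hP.ρA_pos σ ht hc hbef hz2
      (by gcongr; exact h1 _ hz1.ge) h2

/-- Every contact comes too late: the intruder has already passed the surface, its Apollonius disc
meets the target properly, and it breaches. -/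
theorem guarantee_le_of_not_reach {P : Params} (hP : P.Regime) {U : Plane → ENNReal} {B : ENNReal}
    (hU : ∀ x, U x ≤ B) {y : Plane} (hsep : P.ρA < ‖radial P 0 0 - y‖) (hy : ¬ Reach P y)
    (σ : DefenderStrategy P y) : guarantee P U 0 σ ≤ B := by
  rcases contact_or_undetected hP σ with h | ⟨t, ht, htT, hc, hbef, heq⟩
  · exact guarantee_le_of_undetected hP.ν_pos hP.ρA_pos hP.rT_pos.le σ hP.ρT_pos.le h hU
  have hx := radial_isMotion P hP.ν_pos.le 0
  have htpos : 0 < t := by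
    by_contra h
    have h0 : t = 0 := le_antisymm (not_lt.1 h) ht
    rw [h0, σ.start _ hx] at hc; linarith
  have hd : ‖σ.move (radial P 0) t - radial P 0 t‖ = P.ρA := by rw [norm_sub_rev]; exact heq htpos
  obtain ⟨θ, hθ⟩ := Plane.exists_polar (σ.move (radial P 0) t - radial P 0 t)
  rw [hd] at hθ
  -- Otherwise a defender drifting inwards with the intruder at speed `ν`, at the fixed offset `ρA •
  -- dir θ`, would be at `engPt θ` in time.
  have ha : P.R - P.ν * t < P.engDist θ := by
    by_contra hcon
    push Not at hcon
    refine hy ⟨θ, ?_⟩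
    have hm := Params.engTime_mul hP θ
    have e : P.engPt θ - σ.move (radial P 0) t = (-(P.R - P.ν * t - P.engDist θ)) • dir 0 := by
      rw [← sub_add_cancel (σ.move (radial P 0) t) (radial P 0 t), hθ]
      refine Plane.ext ?_ ?_ <;>
        simp [Params.engPt, radial, dir]
      ring
    have h1 : ‖P.engPt θ - σ.move (radial P 0) t‖ = P.R - P.ν * t - P.engDist θ := by
      rw [e, norm_smul, norm_dir, norm_neg, Real.norm_of_nonneg (by linarith), mul_one]
    have h2 := σ.speed _ hx 0 t le_rfl ht
    rw [σ.start _ hx] at h2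
    have h3 := norm_sub_le_norm_sub_add_norm_sub (P.engPt θ) (σ.move (radial P 0) t) y
    have h4 : P.ν * t ≤ P.ν * P.engTime θ := by linarith
    have h5 := le_of_mul_le_mul_left h4 hP.ν_pos
    nlinarith [hP.ν_lt_one]
  obtain ⟨z, hz1, hz2⟩ := exists_breach_point hP hd
    (norm_apolloniusCenter_lt hP hθ (by rw [Params.R]; linarith [hP.rT_pos]) ha)
  exact guarantee_le_of_breach hP.ν_pos hP.ρA_pos σ ht hP.ν_lt_one hc hbef hz2 hz1 hU

/-! ### Lower bounds -/

theorem exists_strategy_of_sneak {P : Params} (hP : P.Regime) {y : Plane} {θ : ℝ}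
    (h : Sneak P 0 y (P.engTime θ) (P.engPt θ)) :
    ∃ σ : DefenderStrategy P y, EngagesAt P σ (P.engTime θ, θ) ∧
      ∀ (U : Plane → ENNReal) (m : ENNReal), (∀ x, ‖x‖ ≤ P.c → m ≤ U x) →
        1 + m ≤ guarantee P U 0 σ := by
  obtain ⟨p, hp0, hp1, hp, hfar⟩ := h
  have hm := Params.engTime_mul hP θ
  have hC := hP.tangent_eq θ
  rw [show P.engDist θ = P.R - P.ν * P.engTime θ by linarith] at hC
  exact ⟨_, pursuit_outcome hP (hP.engTime_pos θ).le hp0 hp (hP.engTime_le θ) hC hfar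
    (hp1.trans (hP.engagementPoint_eq θ).symm)⟩

/-- On the way home the radial gap only grows, since the defender is faster; at the centre it stays
undetected because `ρA < rT`. So the intruder breaches with the defender already at the origin. -/
theorem le_guarantee_goHome {P : Params} (hP : P.Regime) (hrT : P.ρA < P.rT) {y : Plane}
    (hy : ‖y‖ ≤ P.R - P.ρA) (hsep : P.ρA < ‖radial P 0 0 - y‖) (hyT : ‖y‖ ≤ P.ρT / P.ν)
    (U : Plane → ENNReal) : U 0 ≤ guarantee P U 0 (goHome P y) := by
  have hν := hP.ν_pos
  refine le_iInf₂ fun x hx => ?_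
  set T := P.ρT / P.ν with hT
  have hT0 : 0 ≤ T := (norm_nonneg _).trans hyT
  have hνT : P.ν * T = P.ρT := mul_div_cancel₀ _ hν.ne'
  have hhome : ∀ s, 0 ≤ s → ‖homePath y s‖ ≤ max (‖y‖ - s) 0 := fun s hs => by
    rcases eq_or_ne y 0 with rfl | hy0
    · simp [homePath]
    have hn : 0 < ‖y‖ := norm_pos_iff.2 hy0
    rw [homePath, norm_smul, Real.norm_of_nonneg (le_max_right _ _), max_mul_of_nonneg _ _ hn.le,
      sub_mul, div_mul_cancel₀ _ hn.ne', one_mul, zero_mul]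
  have hfar : ∀ s, 0 ≤ s → s ≤ T → P.ρA < ‖radial P 0 s - homePath y s‖ := fun s hs hsT => by
    rcases hs.eq_or_lt with rfl | hs'
    · rw [homePath_zero]; exact hsep
    have h1 : P.ν * s ≤ P.ρT := by rw [← hνT]; exact mul_le_mul_of_nonneg_left hsT hν.le
    have h2 := norm_sub_norm_le (radial P 0 s) (homePath y s)
    rw [norm_radial P 0 s (by rw [Params.R]; linarith [hP.rT_pos])] at h2
    have h3 := hhome s hs
    rw [Params.R] at *
    rcases le_max_iff.1 h3 with h4 | h4
    · nlinarith [mul_pos (sub_pos.2 hP.ν_lt_one) hs']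
    · linarith
  have hmove : (goHome P y).move x = homePath y := rfl
  obtain ⟨h1, h2⟩ := hx.eq_radial (τ := T) fun s hs hsT => by rw [hmove]; exact hfar s hs hsT.le
  have hTT := h1 T hT0 le_rfl
  have hzero : homePath y T = 0 := by
    have := hhome T hT0
    rw [max_eq_right (by linarith)] at this
    exact norm_le_zero_iff.1 this
  have hb : BreachAt P x ((goHome P y).move x) T := by
    refine ⟨hT0, fun s hs hsT => ⟨fun h => ?_, ?_⟩, fun h => ?_, ?_⟩
    · have := h2 s hs hsT
      rw [h, sub_self, norm_zero] at this
      linarith [hP.ρA_pos]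
    · have h3 : P.ν * s < P.ρT := by rw [← hνT]; exact mul_lt_mul_of_pos_left hsT hν
      rw [h1 s hs hsT.le, norm_radial P 0 s (by rw [Params.R]; linarith [hP.rT_pos]), Params.R]
      linarith
    · have := hfar T hT0 le_rfl
      rw [← hTT, h, hmove, sub_self, norm_zero] at this
      linarith [hP.ρA_pos]
    · rw [hTT, norm_radial P 0 T (by rw [Params.R]; linarith [hP.rT_pos]), Params.R]
      linarith
  have h3 : U ((goHome P y).move x T) ≤ payoff P U x ((goHome P y).move x) :=
    le_sup_of_le_right (le_iSup₂_of_le T hb le_rfl)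
  rwa [hmove, hzero] at h3

/-! ### The maximal angular separation on the engagement surface -/

theorem cosArg_eq {P : Params} (hP : P.Regime) (r θ : ℝ) :
    cosArg P r (P.engTime θ, θ) =
      (‖P.engPt θ‖ ^ 2 + r ^ 2 - P.engTime θ ^ 2) / (2 * ‖P.engPt θ‖ * r) := by
  rw [cosArg, hP.rEng_eq]

theorem φEng_eq {P : Params} (hP : P.Regime) (θ : ℝ) :
    φEng P (P.engTime θ, θ) = Real.arcsin (P.engPt θ 1 / ‖P.engPt θ‖) := by
  rw [φEng, hP.rEng_eq]; rfl

theorem abs_engPt_one_div_le (P : Params) (θ : ℝ) : |P.engPt θ 1 / ‖P.engPt θ‖| ≤ 1 := by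
  rw [abs_div, abs_norm]
  refine div_le_one_of_le₀ (abs_le_of_sq_le_sq ?_ (norm_nonneg _)) (norm_nonneg _)
  rw [Plane.norm_sq]; nlinarith [sq_nonneg (P.engPt θ 0)]

theorem norm_mul_sin_φEng {P : Params} (hP : P.Regime) {θ : ℝ} (hE : 0 < ‖P.engPt θ‖) :
    ‖P.engPt θ‖ * Real.sin (φEng P (P.engTime θ, θ)) = P.engPt θ 1 := by
  obtain ⟨h1, h2⟩ := abs_le.1 (abs_engPt_one_div_le P θ)
  rw [φEng_eq hP, Real.sin_arcsin h1 h2, mul_div_cancel₀ _ hE.ne']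

/-- Being an arcsine, `φEng` is the polar angle of the engagement point only in the right
half-plane, hence `h0`. The law of cosines below depends on this. -/
theorem norm_mul_cos_φEng {P : Params} (hP : P.Regime) {θ : ℝ} (hE : 0 < ‖P.engPt θ‖)
    (h0 : 0 ≤ P.engPt θ 0) :
    ‖P.engPt θ‖ * Real.cos (φEng P (P.engTime θ, θ)) = P.engPt θ 0 := by
  have h1 : 0 ≤ Real.cos (φEng P (P.engTime θ, θ)) := Real.cos_arcsin_nonneg _
  have h2 := norm_mul_sin_φEng hP hE
  refine (sq_eq_sq₀ (mul_nonneg hE.le h1) h0).1 ?_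
  have h3 := Plane.norm_sq (P.engPt θ)
  rw [← h2] at h3
  have h4 := Real.sin_sq_add_cos_sq (φEng P (P.engTime θ, θ))
  linear_combination h3 + ‖P.engPt θ‖ ^ 2 * h4

theorem norm_engPt_sub_sq {P : Params} (hP : P.Regime) {θ : ℝ} (hE : 0 < ‖P.engPt θ‖)
    (h0 : 0 ≤ P.engPt θ 0) (r Θ : ℝ) :
    ‖P.engPt θ - r • dir Θ‖ ^ 2 = ‖P.engPt θ‖ ^ 2 + r ^ 2 -
      2 * ‖P.engPt θ‖ * r * Real.cos (Θ - φEng P (P.engTime θ, θ)) := by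
  have h1 := norm_mul_sin_φEng hP hE
  have h2 := norm_mul_cos_φEng hP hE h0
  rw [Plane.norm_sq, Plane.norm_sq (P.engPt θ), Real.cos_sub]
  simp only [PiLp.sub_apply, PiLp.smul_apply, smul_eq_mul, dir, Matrix.cons_val_zero,
    Matrix.cons_val_one]
  have h3 := Real.sin_sq_add_cos_sq Θ
  linear_combination r ^ 2 * h3 + 2 * r * Real.cos Θ * h2 + 2 * r * Real.sin Θ * h1

theorem norm_engPt_sub_le_iff {P : Params} (hP : P.Regime) {θ : ℝ} (hE : 0 < ‖P.engPt θ‖)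
    (h0 : 0 ≤ P.engPt θ 0) {r : ℝ} (hr : 0 < r) (Θ : ℝ) :
    ‖P.engPt θ - r • dir Θ‖ ≤ P.engTime θ ↔
      cosArg P r (P.engTime θ, θ) ≤ Real.cos (Θ - φEng P (P.engTime θ, θ)) := by
  rw [← sq_le_sq₀ (norm_nonneg _) (hP.engTime_pos θ).le, norm_engPt_sub_sq hP hE h0, cosArg_eq hP,
    div_le_iff₀ (by positivity)]
  constructor <;> intro h <;> linarith

theorem cosArg_le_neg_one_iff {P : Params} (hP : P.Regime) {θ : ℝ} (hE : 0 < ‖P.engPt θ‖)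
    {r : ℝ} (hr : 0 < r) :
    cosArg P r (P.engTime θ, θ) ≤ -1 ↔ r + ‖P.engPt θ‖ ≤ P.engTime θ := by
  rw [← sq_le_sq₀ (by positivity) (hP.engTime_pos θ).le, cosArg_eq hP, div_le_iff₀ (by positivity)]
  constructor <;> intro h <;> linarith

theorem φEng_nonneg {P : Params} (hP : P.Regime) {θ : ℝ} (hs : 0 ≤ Real.sin θ) :
    0 ≤ φEng P (P.engTime θ, θ) := by
  rw [φEng_eq hP, Params.engPt_one]
  exact Real.arcsin_nonneg.2 (div_nonneg (mul_nonneg hP.ρA_pos.le hs) (norm_nonneg _))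

theorem φEng_le (P : Params) (p : ℝ × ℝ) : φEng P p ≤ Real.pi / 2 := Real.arcsin_le_pi_div_two _

theorem engTime_mem {P : Params} (hP : P.Regime) (θ : ℝ) :
    (P.engTime θ, θ) ∈ engagementSurface P := hP.mem_engagementSurface.2 rfl

theorem norm_engPt_pos {P : Params} {θ : ℝ} (h : 0 < P.engPt θ 0) : 0 < ‖P.engPt θ‖ := by
  refine norm_pos_iff.2 fun h' => ?_
  rw [h'] at h; simp at h

theorem norm_engPt_eq_of_cos_eq {P : Params} {θ θ' : ℝ} (h : Real.cos θ = Real.cos θ') :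
    ‖P.engPt θ‖ = ‖P.engPt θ'‖ := by
  have hs : Real.sin θ ^ 2 = Real.sin θ' ^ 2 := by rw [Real.sin_sq, Real.sin_sq, h]
  rw [← sq_eq_sq₀ (norm_nonneg _) (norm_nonneg _), Plane.norm_sq, Plane.norm_sq,
    (eq_of_cos_eq (P := P) h).2.2, Params.engPt_one, Params.engPt_one, mul_pow, mul_pow, hs]

theorem cosArg_eq_of_cos_eq {P : Params} (hP : P.Regime) {θ θ' r : ℝ}
    (h : Real.cos θ = Real.cos θ') :
    cosArg P r (P.engTime θ, θ) = cosArg P r (P.engTime θ', θ') := by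
  rw [cosArg_eq hP, cosArg_eq hP, norm_engPt_eq_of_cos_eq h, (eq_of_cos_eq h).2.1]

theorem continuous_norm_engPt {P : Params} (hP : P.Regime) : Continuous fun θ => ‖P.engPt θ‖ := by
  have h : ∀ θ, ‖P.engPt θ‖ = Real.sqrt (P.engPt θ 0 ^ 2 + P.engPt θ 1 ^ 2) := fun θ => by
    rw [← Plane.norm_sq, Real.sqrt_sq (norm_nonneg _)]
  simp only [h]
  exact (((continuous_engPt_zero hP).pow 2).add ((continuous_engPt_one P).pow 2)).sqrt

theorem continuousAt_φEng {P : Params} (hP : P.Regime) {θ : ℝ} (hE : 0 < ‖P.engPt θ‖) :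
    ContinuousAt (fun θ => φEng P (P.engTime θ, θ)) θ := by
  simp only [φEng_eq hP]
  exact Real.continuous_arcsin.continuousAt.comp
    ((continuous_engPt_one P).continuousAt.div (continuous_norm_engPt hP).continuousAt hE.ne')

/-! ### Properties of best engagement points -/

/-- Replacing `θ` by `-θ` flips the sign of `φEng` and leaves the arccosine alone. -/
theorem IsBestEngagement.sin_nonneg {P : Params} (hP : P.Regime) {r θ : ℝ}
    (h : IsBestEngagement P r (P.engTime θ, θ)) (hE : 0 < ‖P.engPt θ‖) : 0 ≤ Real.sin θ := by
  have hc : cosArg P r (P.engTime (-θ), -θ) = cosArg P r (P.engTime θ, θ) :=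
    cosArg_eq_of_cos_eq hP (Real.cos_neg θ)
  have h1 := h.2.2 _ (engTime_mem hP (-θ)) (by rw [hc]; exact h.2.1)
  have h2 : φEng P (P.engTime (-θ), -θ) = -φEng P (P.engTime θ, θ) := by
    rw [φEng_eq hP, φEng_eq hP, norm_engPt_eq_of_cos_eq (Real.cos_neg θ), Params.engPt_one,
      Params.engPt_one, Real.sin_neg, mul_neg, neg_div, Real.arcsin_neg]
  rw [θmax, θmax, hc, h2, φEng_eq hP] at h1
  have h3 : 0 ≤ Real.arcsin (P.engPt θ 1 / ‖P.engPt θ‖) := by linarith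
  rw [Real.arcsin_nonneg, le_div_iff₀ hE, zero_mul, Params.engPt_one] at h3
  exact nonneg_of_mul_nonneg_right h3 hP.ρA_pos

/-- A function that does not exceed its value at `x` to the right of `x`. -/
theorem deriv_nonpos_of_eventually_le {f : ℝ → ℝ} {f' x : ℝ} (hf : HasDerivAt f f' x)
    (h : ∀ᶠ y in nhdsWithin x (Ioi x), f y ≤ f x) : f' ≤ 0 := by
  have h1 : Filter.Tendsto (slope f x) (nhdsWithin x (Ioi x)) (nhds f') :=
    (hasDerivAt_iff_tendsto_slope.1 hf).mono_left (nhdsWithin_mono _ fun y hy => ne_of_gt hy)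
  refine le_of_tendsto h1 ?_
  filter_upwards [h, self_mem_nhdsWithin] with y h1 h2
  rw [slope_def_field]
  exact div_nonpos_of_nonpos_of_nonneg (sub_nonpos.2 h1) (sub_pos.2 h2).le

theorem eventually_cos_le {θ : ℝ} (hs : 0 ≤ Real.sin θ) (hc : -1 < Real.cos θ) :
    ∀ᶠ θ' in nhdsWithin θ (Ioi θ), Real.cos θ' ≤ Real.cos θ := by
  rcases hs.eq_or_lt with h | h
  · have h1 : Real.cos θ = 1 := by
      have := Real.sin_sq_add_cos_sq θ
      rw [← h] at this
      nlinarith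
    rw [h1]
    exact Filter.Eventually.of_forall fun θ' => Real.cos_le_one θ'
  · have h1 : Filter.Tendsto (slope Real.cos θ) (nhdsWithin θ (Ioi θ)) (nhds (-Real.sin θ)) :=
      (hasDerivAt_iff_tendsto_slope.1 (Real.hasDerivAt_cos θ)).mono_left
        (nhdsWithin_mono _ fun y hy => ne_of_gt hy)
    filter_upwards [h1.eventually (gt_mem_nhds (neg_lt_zero.2 h)), self_mem_nhdsWithin]
      with θ' h2 h3
    rw [slope_def_field] at h2
    by_contra hcon
    exact absurd h2 (not_lt.2 (div_nonneg (by linarith [not_le.1 hcon]) (sub_pos.2 h3).le))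

theorem cross_le_of_φEng_le {P : Params} (hP : P.Regime) {θ θ' : ℝ} (h0 : 0 < P.engPt θ 0)
    (h0' : 0 < P.engPt θ' 0) (h : φEng P (P.engTime θ', θ') ≤ φEng P (P.engTime θ, θ)) :
    P.engPt θ' 1 * P.engPt θ 0 - P.engPt θ' 0 * P.engPt θ 1 ≤ 0 := by
  have hE := norm_engPt_pos h0
  have hE' := norm_engPt_pos h0'
  rw [← norm_mul_sin_φEng hP hE, ← norm_mul_sin_φEng hP hE', ← norm_mul_cos_φEng hP hE h0.le,
    ← norm_mul_cos_φEng hP hE' h0'.le]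
  have h1 : 0 ≤ Real.sin (φEng P (P.engTime θ, θ) - φEng P (P.engTime θ', θ')) := by
    refine Real.sin_nonneg_of_nonneg_of_le_pi (sub_nonneg.2 h) ?_
    have h2 := φEng_le P (P.engTime θ, θ)
    have h3 : -(Real.pi / 2) ≤ φEng P (P.engTime θ', θ') := Real.neg_pi_div_two_le_arcsin _
    linarith
  rw [Real.sin_sub] at h1
  have := mul_nonneg (mul_pos hE hE').le h1
  linarith

/-- If the best engagement point is in reach via the center, it lies in front of the intruder. -/
theorem IsBestEngagement.dist_mul_cos_le {P : Params} (hP : P.Regime) {r θ : ℝ} (hr : 0 < r)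
    (h : IsBestEngagement P r (P.engTime θ, θ)) (h0 : 0 < P.engPt θ 0) (hc1 : -1 < Real.cos θ)
    (hc : cosArg P r (P.engTime θ, θ) ≤ -1) : P.engDist θ * Real.cos θ + P.ρA ≤ 0 := by
  have hE := norm_engPt_pos h0
  have hs := h.sin_nonneg hP hE
  have hρ := hP.ρA_pos
  have hreach := (cosArg_le_neg_one_iff hP hE hr).1 hc
  have hder := ((hasDerivAt_engPt_one P θ).mul_const (P.engPt θ 0)).sub
    ((hasDerivAt_engPt_zero hP θ).mul_const (P.engPt θ 1))
  have hev : ∀ᶠ θ' in nhdsWithin θ (Ioi θ), 0 < P.engPt θ' 0 := mem_nhdsWithin_of_mem_nhds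
    ((continuous_engPt_zero hP).continuousAt.eventually (lt_mem_nhds h0))
  -- To the right of `θ` the engagement point is no farther from the centre and its time no shorter,
  -- so the arccosine stays at `π` and optimality forbids `φEng` to grow.
  have hle := deriv_nonpos_of_eventually_le hder (by
    filter_upwards [hev, eventually_cos_le hs hc1] with θ' h1 h2
    have hc' : cosArg P r (P.engTime θ', θ') ≤ -1 :=
      (cosArg_le_neg_one_iff hP (norm_engPt_pos h1) hr).2 (by
        linarith [hP.norm_engPt_mono h2, hP.engTime_anti h2])
    have h3 := h.2.2 _ (engTime_mem hP θ') (hc'.trans (by norm_num))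
    rw [θmax, θmax, Real.arccos_of_le_neg_one hc', Real.arccos_of_le_neg_one hc] at h3
    have h4 := cross_le_of_φEng_le hP h0 h1 (by linarith)
    simp only [Pi.sub_apply]
    linarith)
  rw [Params.engPt_zero, Params.engPt_one] at hle
  have hq : 0 ≤ P.β * P.ρA * Real.sin θ * P.engDist θ / P.engRoot θ * (P.ρA * Real.sin θ) := by
    have ha := hP.engDist_pos θ
    have hQ := hP.engRoot_pos θ
    have hβ := hP.β_pos
    positivity
  have h5 := Real.sin_sq_add_cos_sq θ
  refine nonpos_of_mul_nonpos_right (a := P.ρA) ?_ hρ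
  linear_combination hle + hq - P.ρA ^ 2 * h5

theorem norm_engPt_sub_lt_iff {P : Params} (hP : P.Regime) {θ : ℝ} (hE : 0 < ‖P.engPt θ‖)
    (h0 : 0 ≤ P.engPt θ 0) {r : ℝ} (hr : 0 < r) (Θ : ℝ) :
    ‖P.engPt θ - r • dir Θ‖ < P.engTime θ ↔
      cosArg P r (P.engTime θ, θ) < Real.cos (Θ - φEng P (P.engTime θ, θ)) := by
  rw [← sq_lt_sq₀ (norm_nonneg _) (hP.engTime_pos θ).le, norm_engPt_sub_sq hP hE h0, cosArg_eq hP,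
    div_lt_iff₀ (by positivity)]
  constructor <;> intro h <;> linarith

/-- If a best engagement point is not in reach via the center, then the position of the extreme
bearing is at the distance of reach from it, on its left, and this is critical. -/
theorem IsBestEngagement.critical {P : Params} (hP : P.Regime) {r θ Θ : ℝ} (hr : 0 < r)
    (h : IsBestEngagement P r (P.engTime θ, θ)) (h0 : 0 < P.engPt θ 0)
    (hc : -1 < cosArg P r (P.engTime θ, θ)) (hΘ : θmax P r (P.engTime θ, θ) = Θ) :
    (r * Real.cos Θ - P.engPt θ 0) ^ 2 + (r * Real.sin Θ - P.engPt θ 1) ^ 2 = P.engTime θ ^ 2 ∧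
    0 ≤ P.engPt θ 0 * (r * Real.sin Θ) - P.engPt θ 1 * (r * Real.cos Θ) ∧
    P.engTime θ * (P.γ * P.ρA * Real.sin θ * P.engDist θ / P.engRoot θ) +
      ((r * Real.cos Θ - P.engPt θ 0) *
        (-(P.β * P.ρA * Real.sin θ * P.engDist θ / P.engRoot θ) - P.ρA * Real.sin θ) +
      (r * Real.sin Θ - P.engPt θ 1) * (P.ρA * Real.cos θ)) = 0 := by
  have hE := norm_engPt_pos h0
  set φ := φEng P (P.engTime θ, θ) with hφ
  have hsub : Θ - φ = Real.arccos (cosArg P r (P.engTime θ, θ)) := by rw [← hΘ, θmax]; ring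
  have hcos : Real.cos (Θ - φ) = cosArg P r (P.engTime θ, θ) := by
    rw [hsub, Real.cos_arccos hc.le h.2.1]
  have hdist : ‖P.engPt θ - r • dir Θ‖ = P.engTime θ := by
    refine le_antisymm ((norm_engPt_sub_le_iff hP hE h0.le hr Θ).2 hcos.ge) ?_
    by_contra hcon
    exact absurd ((norm_engPt_sub_lt_iff hP hE h0.le hr Θ).1 (not_le.1 hcon)) (by
      rw [← hφ, hcos]; exact lt_irrefl _)
  have hsq : ∀ θ', ‖P.engPt θ' - r • dir Θ‖ ^ 2 =
      (r * Real.cos Θ - P.engPt θ' 0) ^ 2 + (r * Real.sin Θ - P.engPt θ' 1) ^ 2 := fun θ' => by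
    rw [Plane.norm_sq]
    simp only [PiLp.sub_apply, PiLp.smul_apply, smul_eq_mul, dir, Matrix.cons_val_zero,
      Matrix.cons_val_one]
    ring
  refine ⟨by rw [← hsq, hdist], ?_, ?_⟩
  · have h1 : 0 ≤ Real.sin (Θ - φ) := by
      rw [hsub]; exact Real.sin_nonneg_of_nonneg_of_le_pi (Real.arccos_nonneg _) (Real.arccos_le_pi _)
    rw [Real.sin_sub] at h1
    rw [← norm_mul_sin_φEng hP hE, ← norm_mul_cos_φEng hP hE h0.le]
    have := mul_nonneg (mul_pos hE hr).le h1
    linarith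
  · have hder := ((hasDerivAt_engTime hP θ).pow 2).sub
      ((((hasDerivAt_engPt_zero hP θ).const_sub (r * Real.cos Θ)).pow 2).add
        (((hasDerivAt_engPt_one P θ).const_sub (r * Real.sin Θ)).pow 2))
    have ev1 : ∀ᶠ θ' in nhds θ, 0 < P.engPt θ' 0 :=
      (continuous_engPt_zero hP).continuousAt.eventually (lt_mem_nhds h0)
    have ev2 : ∀ᶠ θ' in nhds θ, P.engTime θ' < r + ‖P.engPt θ'‖ := by
      refine (continuous_engTime hP).continuousAt.eventually_lt
        (continuous_const.add (continuous_norm_engPt hP)).continuousAt ?_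
      by_contra hcon
      exact absurd ((cosArg_le_neg_one_iff hP hE hr).2 (not_lt.1 hcon)) (not_le.2 hc)
    have ev3 : ∀ᶠ θ' in nhds θ, Θ - φEng P (P.engTime θ', θ') < Real.pi := by
      refine (continuousAt_const.sub (continuousAt_φEng hP hE)).eventually_lt
        continuousAt_const ?_
      simp only [Pi.sub_apply]
      rw [← hφ, hsub]
      refine lt_of_le_of_ne (Real.arccos_le_pi _) fun h' => ?_
      exact absurd (Real.arccos_eq_pi.1 h') (not_le.2 hc)
    -- If a nearby disc of reach contained the extreme position in its interior, its extreme bearing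
    -- would exceed `Θ`. So squared reach minus squared distance has the local maximum `0` at `θ`.
    have hmax : IsLocalMax ((P.engTime ^ 2) - ((fun θ' => r * Real.cos Θ - P.engPt θ' 0) ^ 2 +
        (fun θ' => r * Real.sin Θ - P.engPt θ' 1) ^ 2)) θ := by
      filter_upwards [ev1, ev2, ev3] with θ' h1 h2 h3
      simp only [Pi.sub_apply, Pi.add_apply, Pi.pow_apply]
      rw [← hsq, ← hsq, hdist, sub_self, sub_nonpos]
      by_contra hcon
      have hE' := norm_engPt_pos h1
      have h4 := (norm_engPt_sub_lt_iff hP hE' h1.le hr Θ).1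
        ((sq_lt_sq₀ (norm_nonneg _) (hP.engTime_pos θ').le).1 (not_le.1 hcon))
      have h5 := h4.le.trans (Real.cos_le_one _)
      have h6 := h.2.2 _ (engTime_mem hP θ') h5
      rw [hΘ, θmax] at h6
      have h7 : -1 < cosArg P r (P.engTime θ', θ') := by
        by_contra h'
        exact absurd ((cosArg_le_neg_one_iff hP hE' hr).1 (not_lt.1 h')) (not_le.2 h2)
      have h8 := Real.cos_le_cos_of_nonneg_of_le_pi (Real.arccos_nonneg _) h3.le
        (show _ ≤ Θ - φEng P (P.engTime θ', θ') by linarith)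
      rw [Real.cos_arccos h7.le h5] at h8
      linarith
    have := hmax.hasDerivAt_eq_zero hder
    simp only [Nat.cast_ofNat, Nat.add_one_sub_one, pow_one] at this
    linarith

/-- The sign pattern at a critical configuration: `u` is the direction from the engagement point
to the position of the extreme bearing. -/
theorem critical_signs {P : Params} (hP : P.Regime) {θ u₀ u₁ : ℝ} (hs : 0 ≤ Real.sin θ)
    (hc1 : -1 < Real.cos θ) (hu : u₀ ^ 2 + u₁ ^ 2 = 1) (hu0 : u₀ < P.ν)
    (hcross : 0 ≤ P.engPt θ 0 * u₁ - P.engPt θ 1 * u₀)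
    (hcrit : P.γ * Real.sin θ * P.engDist θ * (1 - P.ν * u₀) =
      P.engRoot θ * (Real.sin θ * u₀ - Real.cos θ * u₁)) :
    (Real.sin θ = 0 ∧ u₁ = 0) ∨
      (Real.cos θ ≤ 0 ∧ 0 < u₁ ∧ (u₀ < 0 → Real.sin θ ≤ u₁)) := by
  have hρ := hP.ρA_pos
  have hν := hP.ν_pos
  have hν1 := hP.ν_lt_one
  have ha := hP.engDist_pos θ
  have hQ := hP.engRoot_pos θ
  have hγ := hP.γ_pos
  have hS := Real.sin_sq_add_cos_sq θ
  rw [Params.engPt_zero, Params.engPt_one] at hcross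
  have hQa : P.engRoot θ = P.engDist θ - P.β * P.ρA * Real.cos θ := by rw [Params.engDist]; ring
  set s := Real.sin θ
  set κ := Real.cos θ
  have hνu : 0 < 1 - P.ν * u₀ := by nlinarith
  have hX : 0 ≤ s * u₀ - κ * u₁ := by
    have : 0 ≤ P.engRoot θ * (s * u₀ - κ * u₁) := by rw [← hcrit]; positivity
    exact nonneg_of_mul_nonneg_right this hQ
  have hau : 0 ≤ P.engDist θ * u₁ := by
    have := mul_nonneg hρ.le hX
    linarith
  have hu1 : 0 ≤ u₁ := nonneg_of_mul_nonneg_right hau ha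
  -- For `κ > 0` one has `engRoot ≤ engDist`, and with `γ (1 - ν u₀) - u₀ = (1 + β)(ν - u₀)` the
  -- critical equation bounds a sum of two nonnegative terms by zero.
  rcases lt_or_ge 0 κ with hκ | hκ
  · left
    have h1 : P.γ * s * (1 - P.ν * u₀) ≤ s * u₀ - κ * u₁ := by
      have h2 : P.engRoot θ ≤ P.engDist θ := by
        rw [hQa]; linarith [mul_pos hP.βρ_pos hκ]
      have h3 : P.engRoot θ * (P.γ * s * (1 - P.ν * u₀)) ≤
          P.engRoot θ * (s * u₀ - κ * u₁) := by
        rw [← hcrit]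
        have : 0 ≤ P.γ * s * (1 - P.ν * u₀) := by positivity
        nlinarith
      exact le_of_mul_le_mul_left h3 hQ
    have h4 : P.γ * (1 - P.ν * u₀) - u₀ = (1 + P.β) * (P.ν - u₀) := by
      rw [hP.β_eq]
      have := hP.γ_eq
      rw [hP.β_eq] at this
      linear_combination this
    have h5 : 0 < (1 + P.β) * (P.ν - u₀) := mul_pos (by linarith [hP.β_pos]) (sub_pos.2 hu0)
    have h6 : s * ((1 + P.β) * (P.ν - u₀)) + κ * u₁ ≤ 0 := by rw [← h4]; linarith
    have h7 := mul_nonneg hs h5.le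
    have h8 := mul_nonneg hκ.le hu1
    constructor
    · exact (mul_eq_zero.1 (le_antisymm (by linarith) h7)).resolve_right h5.ne'
    · exact (mul_eq_zero.1 (le_antisymm (by linarith) h8)).resolve_left hκ.ne'
  · right
    have hs0 : 0 < s := by
      refine lt_of_le_of_ne hs fun h' => ?_
      rw [← h'] at hS
      nlinarith
    have hXpos : 0 < s * u₀ - κ * u₁ := by
      have : 0 < P.engRoot θ * (s * u₀ - κ * u₁) := by rw [← hcrit]; positivity
      exact pos_of_mul_pos_right this hQ.le
    have hau' : 0 < P.engDist θ * u₁ := by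
      have := mul_pos hρ hXpos
      linarith
    refine ⟨hκ, pos_of_mul_pos_right hau' ha.le, fun h' => ?_⟩
    have h1 : s * (-u₀) < -κ * u₁ := by linarith
    have h2 := pow_lt_pow_left₀ h1 (mul_nonneg hs (by linarith)) two_ne_zero
    exact (sq_le_sq₀ hs hu1).1 (by nlinarith)

/-- In a critical configuration, positions behind and below the engagement point are close. -/
theorem critical_bound {P : Params} (hP : P.Regime) {θ u₀ u₁ : ℝ} (hs : 0 ≤ Real.sin θ)
    (hκ : Real.cos θ ≤ 0) (h0 : 0 < P.engPt θ 0) (hu : u₀ ^ 2 + u₁ ^ 2 = 1) (hu1 : 0 ≤ u₁)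
    (hsu : u₀ < 0 → Real.sin θ ≤ u₁) :
    P.engPt θ 0 * P.engPt θ 1 ≤
      P.engTime θ * (P.engPt θ 0 * (1 + u₀) + P.engPt θ 1 * (1 + u₁)) := by
  have hρ := hP.ρA_pos
  have hν := hP.ν_pos
  have hν1 := hP.ν_lt_one
  have ht := hP.ρ_lt_engTime θ
  have ht0 := hP.engTime_pos θ
  have hS := Real.sin_sq_add_cos_sq θ
  have hE1 : 0 ≤ P.engPt θ 1 := by rw [Params.engPt_one]; exact mul_nonneg hρ.le hs
  have hE1ρ : P.engPt θ 1 ≤ P.ρA := by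
    rw [Params.engPt_one]; exact mul_le_of_le_one_right hρ.le (Real.sin_le_one θ)
  rcases le_or_gt 0 u₀ with hu0 | hu0
  · have h1 : P.engPt θ 0 * P.engPt θ 1 ≤ P.engPt θ 0 * P.engTime θ :=
      mul_le_mul_of_nonneg_left (by linarith) h0.le
    have h2 := mul_nonneg (mul_nonneg ht0.le h0.le) hu0
    have h3 := mul_nonneg ht0.le (mul_nonneg hE1 (by linarith : 0 ≤ 1 + u₁))
    linarith
  have hu0' : -1 ≤ u₀ := by nlinarith [sq_nonneg u₁]
  have key : P.engPt θ 0 ≤ P.engTime θ * (1 + Real.sin θ) := by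
    have h1 := hP.engTime_ge' θ
    have h2 := hP.engDist_le θ
    have h3 := Params.engPt_zero P θ
    set κ := -Real.cos θ with hκdef
    have hcos : Real.cos θ = -κ := by rw [hκdef, neg_neg]
    rw [hcos] at h1 h2 h3 hS
    set s := Real.sin θ
    have hκ0 : 0 ≤ κ := by rw [hκdef]; linarith
    have hk := hP.k_pos
    have hγk := hP.γ_mul
    have hβ := hP.β_eq
    -- `ν (1 - ν²) (t - E₀) ≥ ν ρ ((1 + ν) κ - (1 - ν))`
    have h4 : P.ν * P.ρA * ((1 + P.ν) * κ - (1 - P.ν)) ≤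
        P.ν * (1 - P.ν ^ 2) * (P.engTime θ - P.engPt θ 0) := by
      have e1 := mul_le_mul_of_nonneg_left h1 hk.le
      have e2 := mul_le_mul_of_nonneg_left h2 (mul_pos hν hk).le
      rw [hβ] at e1 e2
      have f1 : (1 - P.ν ^ 2) * (P.ν * P.rT + 2 * (P.ν * P.γ) * P.ρA -
          (P.γ + P.ν * P.γ * -κ) * P.ρA) = P.ν * ((1 - P.ν ^ 2) * P.rT) + 2 * P.ν ^ 2 * P.ρA -
            (P.ν - P.ν ^ 2 * κ) * P.ρA := by
        linear_combination (2 * P.ν * P.ρA - P.ρA + P.ν * κ * P.ρA) * hγk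
      have f2 : P.ν * (1 - P.ν ^ 2) * (P.rT + (P.γ + P.ν * P.γ * -κ) * P.ρA) =
          P.ν * ((1 - P.ν ^ 2) * P.rT) + P.ν * (P.ν - P.ν ^ 2 * κ) * P.ρA := by
        linear_combination (P.ν * P.ρA - P.ν ^ 2 * κ * P.ρA) * hγk
      rw [f1] at e1
      rw [f2] at e2
      rw [h3]
      nlinarith
    -- For large `κ`, `h4` gives `E₀ ≤ t` outright. For small `κ` the sine is at least `ν`, and then
    -- `t sin θ ≥ (1 + γ) ρA` outweighs the excess of `E₀` over `t`, which is at most `ρA`.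
    rcases le_or_gt (1 - P.ν) ((1 + P.ν) * κ) with h5 | h5
    · have h6 : 0 ≤ P.ν * (1 - P.ν ^ 2) * (P.engTime θ - P.engPt θ 0) :=
        le_trans (mul_nonneg (mul_pos hν hρ).le (sub_nonneg.2 h5)) h4
      have h7 := nonneg_of_mul_nonneg_right h6 (mul_pos hν hk)
      have := mul_nonneg ht0.le hs
      linarith
    · have hsν : P.ν ≤ s := by
        have h6 := pow_lt_pow_left₀ h5 (mul_nonneg (by linarith) hκ0) two_ne_zero
        refine (sq_le_sq₀ hν.le hs).1 ?_
        have h7 : (1 + P.ν) ^ 2 * P.ν ^ 2 ≤ (1 + P.ν) ^ 2 * s ^ 2 := by nlinarith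
        exact le_of_mul_le_mul_left h7 (by positivity)
      have h8 := hP.engTime_ge θ
      rw [hcos] at h8
      have h9 : P.engTime θ * P.ν ≤ P.engTime θ * s := mul_le_mul_of_nonneg_left hsν ht0.le
      have h10 : (1 + P.γ) * P.ρA ≤ P.engTime θ * s := by
        have := mul_nonneg (mul_nonneg hP.β_pos.le hκ0) hρ.le
        linarith
      have h11 : P.engPt θ 0 - P.engTime θ ≤ P.ρA := by
        have h12 : P.ν * (1 - P.ν ^ 2) * (P.engPt θ 0 - P.engTime θ) ≤
            P.ν * (1 - P.ν ^ 2) * P.ρA := by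
          have h13 : P.ν * P.ρA * (1 - P.ν) ≤ P.ν * P.ρA * (1 - P.ν ^ 2) :=
            mul_le_mul_of_nonneg_left (by nlinarith) (mul_pos hν hρ).le
          have h14 := mul_nonneg (mul_pos hν hρ).le (mul_nonneg (by linarith : 0 ≤ 1 + P.ν) hκ0)
          linarith
        exact le_of_mul_le_mul_left h12 (mul_pos hν hk)
      have := mul_pos hP.γ_pos hρ
      linarith
  have h1 := mul_nonneg (mul_nonneg ht0.le h0.le) (by linarith : 0 ≤ 1 + u₀)
  have h2 := mul_le_mul_of_nonneg_left key hE1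
  have h3 := mul_nonneg (mul_nonneg ht0.le hE1) (sub_nonneg.2 (hsu hu0))
  linarith

theorem norm_smul_dir {r : ℝ} (hr : 0 ≤ r) (ψ : ℝ) : ‖r • dir ψ‖ = r := by
  rw [norm_smul, norm_dir, mul_one, Real.norm_of_nonneg hr]

/-- The distance of a point of the engagement surface to a position of reach at the same side. -/
theorem norm_engPt_sub_le_of_le {P : Params} (hP : P.Regime) {r θ Θ ψ : ℝ} (hr : 0 < r)
    (h0 : 0 < P.engPt θ 0) (hc : cosArg P r (P.engTime θ, θ) ≤ 1)
    (hΘ : θmax P r (P.engTime θ, θ) = Θ) (h1 : φEng P (P.engTime θ, θ) ≤ ψ) (h2 : ψ ≤ Θ) :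
    ‖P.engPt θ - r • dir ψ‖ ≤ P.engTime θ := by
  refine (norm_engPt_sub_le_iff hP (norm_engPt_pos h0) h0.le hr ψ).2 ?_
  rcases le_or_gt (cosArg P r (P.engTime θ, θ)) (-1) with h | h
  · exact h.trans (Real.neg_one_le_cos _)
  rw [θmax] at hΘ
  have h3 := Real.cos_le_cos_of_nonneg_of_le_pi (sub_nonneg.2 h1) (Real.arccos_le_pi _)
    (show ψ - φEng P (P.engTime θ, θ) ≤ Real.arccos (cosArg P r (P.engTime θ, θ)) by linarith)
  rwa [Real.cos_arccos h.le hc] at h3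

/-- The critical equations, divided by the time, concern the unit vector `u` from the engagement
point to the extreme position. `critical_signs` leaves the case in front of the intruder and a
degenerate one with `Θ = 0`; `critical_bound` gives the last inequality, which `sneak_up` needs. -/
theorem IsBestEngagement.cos_le_and_extreme {P : Params} (hP : P.Regime) {r θ Θ : ℝ} (hr : 0 < r)
    (hrR : r ≤ P.R - P.ρA) (h : IsBestEngagement P r (P.engTime θ, θ)) (h0 : 0 < P.engPt θ 0)
    (hc1 : -1 < Real.cos θ) (hc : -1 < cosArg P r (P.engTime θ, θ))
    (hΘ : θmax P r (P.engTime θ, θ) = Θ) :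
    Real.cos θ ≤ 0 ∧ P.engPt θ 1 < r * Real.sin Θ ∧
      P.engPt θ 0 + P.engPt θ 1 - P.engTime θ ≤ r := by
  obtain ⟨g1, g2, g3⟩ := h.critical hP hr h0 hc hΘ
  have hs := h.sin_nonneg hP (norm_engPt_pos h0)
  have ht := hP.engTime_pos θ
  have hρ := hP.ρA_pos
  have hQ := hP.engRoot_pos θ
  set t := P.engTime θ with htdef
  set u₀ := (r * Real.cos Θ - P.engPt θ 0) / t with hu₀
  set u₁ := (r * Real.sin Θ - P.engPt θ 1) / t with hu₁
  have e0 : r * Real.cos Θ - P.engPt θ 0 = t * u₀ := (mul_div_cancel₀ _ ht.ne').symm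
  have e1 : r * Real.sin Θ - P.engPt θ 1 = t * u₁ := (mul_div_cancel₀ _ ht.ne').symm
  have hu : u₀ ^ 2 + u₁ ^ 2 = 1 := by
    rw [hu₀, hu₁, div_pow, div_pow, ← add_div, g1, div_self (pow_ne_zero 2 ht.ne')]
  have hu0 : u₀ < P.ν := by
    have h1 : r * Real.cos Θ ≤ r := mul_le_of_le_one_right hr.le (Real.cos_le_one _)
    have h2 := Params.engTime_mul hP θ
    have h3 := Params.engPt_zero P θ
    have h4 : t * u₀ < t * P.ν := by
      have := mul_pos hρ (by linarith : 0 < 1 + Real.cos θ)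
      linarith
    exact lt_of_mul_lt_mul_left h4 ht.le
  have hcross : 0 ≤ P.engPt θ 0 * u₁ - P.engPt θ 1 * u₀ := by
    refine nonneg_of_mul_nonneg_right (a := t) ?_ ht
    have : t * (P.engPt θ 0 * u₁ - P.engPt θ 1 * u₀) =
        P.engPt θ 0 * (t * u₁) - P.engPt θ 1 * (t * u₀) := by ring
    rw [this, ← e0, ← e1]; linarith
  have hcrit : P.γ * Real.sin θ * P.engDist θ * (1 - P.ν * u₀) =
      P.engRoot θ * (Real.sin θ * u₀ - Real.cos θ * u₁) := by
    rw [e0, e1, hP.β_eq] at g3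
    have h1 : t * P.ρA ≠ 0 := (mul_pos ht hρ).ne'
    refine mul_left_cancel₀ h1 ?_
    have h2 : (P.engRoot θ) * (P.γ * P.ρA * Real.sin θ * P.engDist θ / P.engRoot θ) =
        P.γ * P.ρA * Real.sin θ * P.engDist θ := mul_div_cancel₀ _ hQ.ne'
    have h3 : (P.engRoot θ) * (P.ν * P.γ * P.ρA * Real.sin θ * P.engDist θ / P.engRoot θ) =
        P.ν * P.γ * P.ρA * Real.sin θ * P.engDist θ := mul_div_cancel₀ _ hQ.ne'
    linear_combination P.engRoot θ * g3 - t * h2 + t * u₀ * h3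
  rcases critical_signs hP hs hc1 hu hu0 hcross hcrit with ⟨hs0, hu1⟩ | ⟨hκ, hu1, hsu⟩
  · exfalso
    have hE := norm_engPt_pos h0
    have hφ : φEng P (P.engTime θ, θ) = 0 := by
      rw [φEng_eq hP, Params.engPt_one, hs0, mul_zero, zero_div, Real.arcsin_zero]
    rw [Params.engPt_one, hs0, mul_zero, sub_zero, hu1, mul_zero] at e1
    have h1 : Real.sin Θ = 0 := (mul_eq_zero.1 e1).resolve_left hr.ne'
    have h2 : Real.arccos (cosArg P r (P.engTime θ, θ)) = Θ := by rw [← hΘ, θmax, hφ, add_zero]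
    have h3 : Θ < Real.pi := by
      rw [← h2]
      refine lt_of_le_of_ne (Real.arccos_le_pi _) fun h' => ?_
      exact absurd (Real.arccos_eq_pi.1 h') (not_le.2 hc)
    have h4 : 0 ≤ Θ := by rw [← h2]; exact Real.arccos_nonneg _
    have h5 : Θ = 0 := by
      rcases h4.eq_or_lt with h' | h'
      · exact h'.symm
      · exact absurd h1 (Real.sin_pos_of_pos_of_lt_pi h' h3).ne'
    have hcos := Real.cos_pi
    have hm := Params.engTime_mul hP Real.pi
    have hd := hP.engDist_pi hcos
    have hn := norm_engPt_pi P hP hcos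
    -- The front engagement point has a positive `θmax`, which rules out `Θ = 0`. If it is the
    -- origin, `cosArg` is `0` by default.
    have hlt : cosArg P r (P.engTime Real.pi, Real.pi) < 1 := by
      rcases (norm_nonneg (P.engPt Real.pi)).eq_or_lt with h' | h'
      · rw [cosArg_eq hP, ← h']; norm_num
      rw [cosArg_eq hP, div_lt_one (by positivity)]
      have hab : |‖P.engPt Real.pi‖ - r| < P.engTime Real.pi := by
        rcases le_or_gt P.rT P.ρA with hrT | hrT
        · have := norm_add_lt_engTime hP hrT hrR hcos
          rw [abs_lt]; constructor <;> linarith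
        · have h6 := norm_engPt_pi_le hP hrT.le hcos
          rw [abs_lt]
          refine ⟨?_, by linarith⟩
          have h7 := mul_lt_mul_of_pos_right hP.ν_lt_one (hP.engTime_pos Real.pi)
          rw [hn]
          have h8 := le_abs_self (P.rT + (P.γ - P.β) * P.ρA - P.ρA)
          linarith
      have := sq_lt_sq' (neg_lt_of_abs_lt hab) (lt_of_abs_lt hab)
      linarith
    have h6 := h.2.2 _ (engTime_mem hP Real.pi) hlt.le
    rw [hΘ, h5, θmax] at h6
    have h7 := Real.arccos_pos.2 hlt
    have h8 := φEng_nonneg hP (θ := Real.pi) (by rw [Real.sin_pi])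
    linarith
  · refine ⟨hκ, by nlinarith [mul_pos ht hu1], ?_⟩
    have hb := critical_bound hP hs hκ h0 hu hu1.le hsu
    rcases le_or_gt (P.engPt θ 0 + P.engPt θ 1) t with h' | h'
    · linarith
    refine (sq_le_sq₀ (sub_pos.2 h').le hr.le).1 ?_
    have h1 : r ^ 2 = (P.engPt θ 0 + t * u₀) ^ 2 + (P.engPt θ 1 + t * u₁) ^ 2 := by
      rw [← e0, ← e1]
      have := Real.sin_sq_add_cos_sq Θ
      linear_combination -r ^ 2 * this
    rw [h1]
    have h2 : t ^ 2 * (u₀ ^ 2 + u₁ ^ 2) = t ^ 2 := by rw [hu, mul_one]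
    nlinarith

/-! ### Undetected paths to a best engagement point -/

theorem sneak_of_best_of_pos {P : Params} (hP : P.Regime) {r θD θ : ℝ} (hr : 0 < r)
    (hrR : r ≤ P.R - P.ρA) (hθD : θD ∈ Icc 0 Real.pi)
    (hsep : P.ρA < ‖radial P 0 0 - r • dir θD‖)
    (h : IsBestEngagement P r (P.engTime θ, θ)) (h0 : 0 < P.engPt θ 0) (hc1 : -1 < Real.cos θ)
    (hle : θD ≤ θmax P r (P.engTime θ, θ)) :
    Sneak P 0 (r • dir θD) (P.engTime θ) (P.engPt θ) := by
  have hE := norm_engPt_pos h0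
  have hn : ‖r • dir θD‖ = r := norm_smul_dir hr.le θD
  -- `cosArg ≤ -1` means that there is time to pass through the centre; otherwise the engagement is
  -- in front of the intruder and `sneak_front` applies.
  rcases le_or_gt (cosArg P r (P.engTime θ, θ)) (-1) with hc | hc
  · exact sneak_home hP (by rw [hn]; exact hr) (by rw [hn]; exact hrR) hsep hE
      (by rw [hn]; exact (cosArg_le_neg_one_iff hP hE hr).1 hc) (h.dist_mul_cos_le hP hr h0 hc1 hc)
  obtain ⟨hκ, hy1, hb⟩ := h.cos_le_and_extreme hP hr hrR h0 hc1 hc rfl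
  set Θ := θmax P r (P.engTime θ, θ) with hΘ
  have hs := h.sin_nonneg hP hE
  have hρ := hP.ρA_pos
  have ht := hP.engTime_pos θ
  set φ := φEng P (P.engTime θ, θ) with hφ
  have hφ0 : 0 ≤ φ := φEng_nonneg hP hs
  have hφ1 : φ ≤ Real.pi / 2 := φEng_le P _
  have y0 : (r • dir θD) 0 = r * Real.cos θD := by simp [dir]
  have y1 : (r • dir θD) 1 = r * Real.sin θD := by simp [dir]
  have hE1 : 0 ≤ P.engPt θ 1 := by rw [Params.engPt_one]; exact mul_nonneg hρ.le hs
  -- The extreme position lies strictly above the engagement point, so `sin Θ > 0`.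
  have hΘπ : Θ < Real.pi := by
    by_contra hcon
    have h1 : Θ ≤ 2 * Real.pi := by
      have : Θ = Real.arccos _ + φ := hΘ
      linarith [Real.arccos_le_pi (cosArg P r (P.engTime θ, θ)), Real.pi_pos]
    have h2 : 0 ≤ Real.sin (Θ - Real.pi) :=
      Real.sin_nonneg_of_nonneg_of_le_pi (sub_nonneg.2 (not_lt.1 hcon)) (by linarith)
    rw [Real.sin_sub_pi] at h2
    nlinarith
  refine sneak_front hP hκ hs hsep ?_ ?_ ?_ ?_
  · rw [y1]; exact mul_nonneg hr.le (Real.sin_nonneg_of_nonneg_of_le_pi hθD.1 hθD.2)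
  · rw [y0]; exact (mul_le_of_le_one_right hr.le (Real.cos_le_one _)).trans hrR
  · intro hy
    rcases le_or_gt φ θD with h1 | h1
    · exact norm_engPt_sub_le_of_le hP hr h0 h.2.1 hΘ.symm h1 hle
    -- Below the bearing `φ` the distance is largest at bearing `0`; there the horizontal part is at
    -- most `ν t` and the vertical part at most `√(1 - ν²) t`.
    have h2 : ‖P.engPt θ - r • dir θD‖ ^ 2 ≤ ‖P.engPt θ - r • dir 0‖ ^ 2 := by
      rw [norm_engPt_sub_sq hP hE h0.le, norm_engPt_sub_sq hP hE h0.le, ← hφ, zero_sub,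
        ← neg_sub φ θD, Real.cos_neg, Real.cos_neg]
      have h3 := Real.cos_le_cos_of_nonneg_of_le_pi (sub_nonneg.2 h1.le) (by linarith [Real.pi_pos])
        (sub_le_self φ hθD.1)
      have := mul_nonneg (mul_pos hE hr).le (sub_nonneg.2 h3)
      linarith
    refine (sq_le_sq₀ (norm_nonneg _) ht.le).1 (h2.trans ?_)
    rw [Plane.norm_sq]
    simp only [PiLp.sub_apply, PiLp.smul_apply, smul_eq_mul, dir, Matrix.cons_val_zero,
      Matrix.cons_val_one, Real.cos_zero, Real.sin_zero, mul_zero, mul_one, sub_zero]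
    have hEr : P.engPt θ 0 ≤ r := by
      have h4 := norm_mul_sin_φEng hP hE
      have h5 := norm_mul_cos_φEng hP hE h0.le
      rw [← hφ] at h4 h5
      have h6 : 0 < Real.cos φ := by
        refine pos_of_mul_pos_right ?_ hE.le
        rw [h5]; exact h0
      rw [y1] at hy
      have h7 : 0 < Real.sin (φ - θD) :=
        Real.sin_pos_of_pos_of_lt_pi (sub_pos.2 h1) (by linarith [hθD.1, Real.pi_pos])
      rw [Real.sin_sub] at h7
      have h8 : 0 ≤ Real.cos θD := Real.cos_nonneg_of_neg_pi_div_two_le_of_le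
        (by linarith [hθD.1, Real.pi_pos]) (by linarith)
      have h9 := Real.sin_nonneg_of_nonneg_of_le_pi hφ0 (by linarith [Real.pi_pos])
      have h10 := Real.sin_nonneg_of_nonneg_of_le_pi hθD.1 hθD.2
      have h11 : Real.sin θD ≤ Real.sin φ := Real.sin_le_sin_of_le_of_le_pi_div_two
        (by linarith [hθD.1, Real.pi_pos]) hφ1 h1.le
      have h12 : 0 < Real.sin φ := by
        rcases h9.eq_or_lt with h' | h'
        · rw [← h', zero_mul, zero_sub] at h7
          exact absurd h7 (not_lt.2 (neg_nonpos.2 (mul_nonneg h6.le h10)))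
        · exact h'
      have h13 : ‖P.engPt θ‖ ≤ r := by
        rw [← h4] at hy
        refine le_of_mul_le_mul_right (hy.trans (mul_le_mul_of_nonneg_left h11 hr.le)) h12
      exact (le_trans (by rw [← h5]; exact mul_le_of_le_one_right hE.le (Real.cos_le_one _)) h13)
    have h3 := Params.engPt_zero P θ
    have h4 := Params.engTime_mul hP θ
    have h5 : r - P.engPt θ 0 ≤ P.ν * P.engTime θ := by
      have := mul_nonneg hρ.le (by linarith : 0 ≤ 1 + Real.cos θ)
      linarith
    have h6 := pow_le_pow_left₀ (sub_nonneg.2 hEr) h5 2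
    have h7 : P.engPt θ 1 ^ 2 ≤ (1 - P.ν ^ 2) * P.engTime θ ^ 2 := by
      have h8 := hP.engTime_ge θ
      have h9 : P.γ * P.ρA ≤ P.ν * P.engTime θ := by
        have := mul_nonneg (mul_nonneg hP.β_pos.le (neg_nonneg.2 hκ)) hρ.le
        linarith
      have h10 : P.ν * P.ρA ≤ P.ν * ((1 - P.ν ^ 2) * P.engTime θ) := by
        have := mul_le_mul_of_nonneg_left h9 hP.k_pos.le
        have e : (1 - P.ν ^ 2) * (P.γ * P.ρA) = P.ν * P.ρA := by
          linear_combination P.ρA * hP.γ_mul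
        linarith
      have h11 := le_of_mul_le_mul_left h10 hP.ν_pos
      have h12 : P.engPt θ 1 ≤ P.ρA := by
        rw [Params.engPt_one]; exact mul_le_of_le_one_right hρ.le (Real.sin_le_one θ)
      have h13 := pow_le_pow_left₀ hE1 (h12.trans h11) 2
      have h14 : 0 ≤ (1 - P.ν ^ 2) * P.ν ^ 2 * P.engTime θ ^ 2 := by
        have := hP.k_pos; positivity
      nlinarith
    nlinarith
  · intro h1 _
    rw [y1] at h1
    rw [y0, y1]
    -- The position is lower than the extreme one although `θD ≤ Θ`, so `θD` is acute. Then `cos θD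
    -- + sin θD ≥ 1`, and the `ℓ¹` distance is at most `E₀ + E₁ - r ≤ t`.
    have h2 : θD ≤ Real.pi / 2 := by
      by_contra hcon
      have h3 := Real.sin_le_sin_of_le_of_le_pi_div_two (x := Real.pi - Θ) (y := Real.pi - θD)
        (by linarith [Real.pi_pos]) (by linarith [not_le.1 hcon]) (by linarith)
      rw [Real.sin_pi_sub, Real.sin_pi_sub] at h3
      have := mul_le_mul_of_nonneg_left h3 hr.le
      linarith
    have h3 : 0 ≤ Real.cos θD := Real.cos_nonneg_of_neg_pi_div_two_le_of_le
      (by linarith [hθD.1, Real.pi_pos]) h2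
    have h4 := Real.sin_nonneg_of_nonneg_of_le_pi hθD.1 hθD.2
    have h5 : 1 ≤ Real.cos θD + Real.sin θD := by
      nlinarith [Real.sin_sq_add_cos_sq θD, mul_nonneg h3 h4]
    have := mul_le_mul_of_nonneg_left h5 hr.le
    linarith

theorem sin_eq_zero_of_cos_eq {θ : ℝ} (h : Real.cos θ = -1) : Real.sin θ = 0 := by
  have := Real.sin_sq_add_cos_sq θ
  rw [h] at this
  exact pow_eq_zero_iff two_ne_zero |>.1 (by linarith)

/-- When the front engagement point lies past the centre, some engagement point is straight above
the centre and in reach through it. Its `θmax` is `π + π/2`, the largest conceivable value. -/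
theorem exists_engPt_zero_eq_zero {P : Params} (hP : P.Regime) {r : ℝ} (hr : r ≤ P.R - P.ρA)
    (h : P.engPt Real.pi 0 < 0) :
    ∃ θ, P.engPt θ 0 = 0 ∧ 0 < P.engPt θ 1 ∧ r + P.engPt θ 1 ≤ P.engTime θ := by
  have hρ := hP.ρA_pos
  have hν := hP.ν_pos
  have h0 : 0 < P.engPt 0 0 := by
    rw [Params.engPt_zero, Real.cos_zero]; linarith [hP.engDist_pos 0]
  obtain ⟨θ, hθ, hθ0⟩ := intermediate_value_Icc' Real.pi_pos.le
    (continuous_engPt_zero hP).continuousOn (show (0 : ℝ) ∈ Icc _ _ from ⟨h.le, h0.le⟩)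
  have h1 : 0 < θ := lt_of_le_of_ne hθ.1 fun h' => by
    rw [← h'] at hθ0; exact h0.ne' hθ0
  have h2 : θ < Real.pi := lt_of_le_of_ne hθ.2 fun h' => by
    rw [h'] at hθ0; exact h.ne hθ0
  refine ⟨θ, hθ0, by rw [Params.engPt_one]; exact mul_pos hρ (Real.sin_pos_of_pos_of_lt_pi h1 h2), ?_⟩
  have hm := Params.engTime_mul hP θ
  simp only [Params.engPt_zero] at hθ0
  rw [Params.engPt_one]
  refine le_of_mul_le_mul_left (a := P.ν) ?_ hν
  rw [hm]
  have h3 : P.ν * (P.ρA * Real.sin θ) ≤ P.ν * P.ρA :=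
    mul_le_mul_of_nonneg_left (mul_le_of_le_one_right hρ.le (Real.sin_le_one θ)) hν.le
  have h4 : P.engDist θ ≤ P.ρA := by nlinarith [Real.neg_one_le_cos θ]
  have h5 := mul_le_mul_of_nonneg_left hr hν.le
  have h6 : P.ρA ≤ (1 - P.ν) * P.R := by
    have h7 := hP.ρT_ge
    have h8 : (1 - P.ν) * ((1 + 2 * P.γ) * P.ρA) ≤ (1 - P.ν) * P.R :=
      mul_le_mul_of_nonneg_left (by rw [Params.R]; linarith [hP.rT_pos])
        (sub_nonneg.2 hP.ν_lt_one.le)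
    have h9 : 2 * P.γ * (1 - P.ν) = 2 * (P.γ - P.β) := by rw [hP.β_eq]; ring
    have h10 := hP.γ_sub_β
    have h11 : P.ν ≤ 2 * (P.γ - P.β) := by
      nlinarith [hP.ν_lt_one, sub_pos.2 hP.β_lt_γ]
    have h12 := mul_le_mul_of_nonneg_right h11 hρ.le
    have h13 : (1 - P.ν) * ((1 + 2 * P.γ) * P.ρA) =
        (1 - P.ν) * P.ρA + 2 * (P.γ - P.β) * P.ρA := by rw [← h9]; ring
    linarith
  linarith

theorem sneak_of_best {P : Params} (hP : P.Regime) {r θD θ : ℝ} (hr : 0 < r)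
    (hrR : r ≤ P.R - P.ρA) (hθD : θD ∈ Icc 0 Real.pi)
    (hsep : P.ρA < ‖radial P 0 0 - r • dir θD‖)
    (h : IsBestEngagement P r (P.engTime θ, θ)) (hle : θD ≤ θmax P r (P.engTime θ, θ)) :
    Sneak P 0 (r • dir θD) (P.engTime θ) (P.engPt θ) := by
  have hρ := hP.ρA_pos
  have hn : ‖r • dir θD‖ = r := norm_smul_dir hr.le θD
  have y0 : (r • dir θD) 0 = r * Real.cos θD := by simp [dir]
  have y1 : (r • dir θD) 1 = r * Real.sin θD := by simp [dir]
  have hy0 : r * Real.cos θD ≤ P.R - P.ρA :=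
    (mul_le_of_le_one_right hr.le (Real.cos_le_one _)).trans hrR
  have hy1 : 0 ≤ r * Real.sin θD :=
    mul_nonneg hr.le (Real.sin_nonneg_of_nonneg_of_le_pi hθD.1 hθD.2)
  rcases (Real.neg_one_le_cos θ).eq_or_lt with hc | hc
  · have hs := sin_eq_zero_of_cos_eq hc.symm
    refine sneak_straight hP ?_ ?_ ?_
    · have h1 := (Plane.lt_norm_iff hρ.le).1 hsep
      simp only [PiLp.sub_apply, radial_zero_apply_zero, radial_zero_apply_one, mul_zero,
        sub_zero, zero_sub, neg_sq] at h1
      exact h1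
    · rw [← hc, hs, y0]; linarith
    · rcases le_or_gt P.rT P.ρA with hrT | hrT
      · have h1 := norm_add_lt_engTime hP hrT hrR hc.symm
        have h2 := norm_sub_le (P.engPt θ) (r • dir θD)
        rw [hn] at h2
        linarith
      · refine norm_engPt_sub_le_of_le hP hr (engPt_zero_pos hP hrT.le θ) h.2.1 rfl ?_ hle
        rw [φEng_eq hP, Params.engPt_one, hs, mul_zero, zero_div, Real.arcsin_zero]
        exact hθD.1
  rcases lt_or_ge 0 (P.engPt θ 0) with h0 | h0
  · exact sneak_of_best_of_pos hP hr hrR hθD hsep h h0 hc hle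
  have hπ : P.engPt Real.pi 0 < 0 := by
    refine lt_of_lt_of_le ?_ h0
    rw [Params.engPt_zero, Params.engPt_zero]
    have h1 := hP.engDist_mono (θ := Real.pi) (θ' := θ) (by rw [Real.cos_pi]; exact hc.le)
    have h2 := mul_lt_mul_of_pos_left hc hρ
    rw [Real.cos_pi]
    linarith
  obtain ⟨θ₀, g0, g1, g2⟩ := exists_engPt_zero_eq_zero hP hrR hπ
  have gn : ‖P.engPt θ₀‖ = P.engPt θ₀ 1 := by
    rw [← sq_eq_sq₀ (norm_nonneg _) g1.le, Plane.norm_sq, g0]; ring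
  have gpos : 0 < ‖P.engPt θ₀‖ := by rw [gn]; exact g1
  have gc : cosArg P r (P.engTime θ₀, θ₀) ≤ -1 :=
    (cosArg_le_neg_one_iff hP gpos hr).2 (by rw [gn]; exact g2)
  -- Comparison with `θ₀` makes both summands of the best `θmax` extremal, so the best point itself
  -- is straight above the centre and in reach through it.
  have h1 := h.2.2 _ (engTime_mem hP θ₀) (gc.trans (by norm_num))
  rw [θmax, θmax, Real.arccos_of_le_neg_one gc, φEng_eq hP θ₀, gn, div_self g1.ne',
    Real.arcsin_one] at h1
  have h2 := φEng_le P (P.engTime θ, θ)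
  have h3 := Real.arccos_le_pi (cosArg P r (P.engTime θ, θ))
  have h4 : cosArg P r (P.engTime θ, θ) ≤ -1 := Real.arccos_eq_pi.1 (by linarith)
  have h5 : φEng P (P.engTime θ, θ) = Real.pi / 2 := by linarith
  rw [φEng_eq hP, Real.arcsin_eq_pi_div_two] at h5
  have hE : 0 < ‖P.engPt θ‖ := by
    refine lt_of_le_of_ne (norm_nonneg _) fun h' => ?_
    rw [← h', div_zero] at h5
    exact absurd h5 (by norm_num)
  rw [le_div_iff₀ hE, one_mul] at h5
  have h6 := (cosArg_le_neg_one_iff hP hE hr).1 h4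
  have hE1 : 0 < P.engPt θ 1 := hE.trans_le h5
  have hE0 : P.engPt θ 0 = 0 := by
    have h7 := Plane.norm_sq (P.engPt θ)
    have h8 := pow_le_pow_left₀ hE.le h5 2
    exact pow_eq_zero_iff two_ne_zero |>.1 (by nlinarith [sq_nonneg (P.engPt θ 0)])
  have hEn : P.engPt θ 1 = ‖P.engPt θ‖ := by
    rw [← sq_eq_sq₀ hE1.le hE.le, Plane.norm_sq, hE0]; ring
  refine sneak_front hP ?_ ?_ hsep ?_ ?_ ?_ ?_
  · have h7 := Params.engPt_zero P θ
    rw [hE0] at h7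
    have h8 : P.ρA * Real.cos θ < 0 := by linarith [hP.engDist_pos θ]
    by_contra hcon
    exact absurd h8 (not_lt.2 (mul_nonneg hρ.le (not_le.1 hcon).le))
  · exact nonneg_of_mul_nonneg_right (by rw [← Params.engPt_one]; exact hE1.le) hρ
  · rw [y1]; exact hy1
  · rw [y0]; exact hy0
  · intro _
    have h7 := norm_sub_le (P.engPt θ) (r • dir θD)
    rw [hn] at h7
    linarith
  · intro _ _
    rw [y0, y1, hE0, hEn]
    nlinarith [Real.neg_one_le_cos θD]

/-! ### Reachable positions in terms of the maximal separation -/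

theorem pi_le_θmax_of_small {P : Params} (hP : P.Regime) (hrT : P.rT ≤ P.ρA) {r : ℝ} (hr : 0 < r)
    (hrR : r ≤ P.R - P.ρA) {p : ℝ × ℝ} (h : IsBestEngagement P r p) :
    Real.pi ≤ θmax P r p := by
  have h1 := norm_add_lt_engTime hP hrT hrR Real.cos_pi
  -- At `π` the engagement point may be the origin, where the quotients take default values; an
  -- angle slightly below `π` avoids this.
  have h2 : ∀ᶠ θ in nhdsWithin Real.pi (Iio Real.pi), r + ‖P.engPt θ‖ < P.engTime θ :=
    mem_nhdsWithin_of_mem_nhds ((continuous_const.add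
      (continuous_norm_engPt hP)).continuousAt.eventually_lt (continuous_engTime hP).continuousAt h1)
  have h3 : ∀ᶠ θ in nhdsWithin Real.pi (Iio Real.pi), 0 < θ :=
    mem_nhdsWithin_of_mem_nhds (lt_mem_nhds Real.pi_pos)
  obtain ⟨θ, ⟨g1, g2⟩, g3⟩ := ((h2.and h3).and self_mem_nhdsWithin).exists
  have hs := Real.sin_pos_of_pos_of_lt_pi g2 g3
  have hE : 0 < ‖P.engPt θ‖ := by
    refine norm_pos_iff.2 fun h' => ?_
    have h4 := mul_pos hP.ρA_pos hs
    rw [← Params.engPt_one, h'] at h4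
    simp at h4
  have hc := (cosArg_le_neg_one_iff hP hE hr).2 g1.le
  have h5 := h.2.2 _ (engTime_mem hP θ) (hc.trans (by norm_num))
  rw [θmax, Real.arccos_of_le_neg_one hc] at h5
  linarith [φEng_nonneg hP hs.le]

theorem Reach.exists_le_θmax {P : Params} (hP : P.Regime) (hrT : P.ρA < P.rT) {r θD : ℝ}
    (hr : 0 < r) (hθD : θD ∈ Icc 0 Real.pi) (h : Reach P (r • dir θD)) :
    ∃ θ ∈ Icc 0 Real.pi, cosArg P r (P.engTime θ, θ) ≤ 1 ∧
      θD ≤ θmax P r (P.engTime θ, θ) := by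
  obtain ⟨θ₀, hθ₀⟩ := h
  set θ := Real.arccos (Real.cos θ₀) with hθ
  have hcos : Real.cos θ = Real.cos θ₀ :=
    Real.cos_arccos (Real.neg_one_le_cos _) (Real.cos_le_one _)
  have hmem : θ ∈ Icc 0 Real.pi := ⟨Real.arccos_nonneg _, Real.arccos_le_pi _⟩
  have hsin : 0 ≤ Real.sin θ := Real.sin_nonneg_of_nonneg_of_le_pi hmem.1 hmem.2
  have h0 := engPt_zero_pos hP hrT.le θ
  have hin : ‖P.engPt θ - r • dir θD‖ ≤ P.engTime θ := by
    obtain ⟨-, e2, e3⟩ := eq_of_cos_eq (P := P) hcos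
    rw [e2]
    refine le_trans ?_ hθ₀
    refine (sq_le_sq₀ (norm_nonneg _) (norm_nonneg _)).1 ?_
    have hss : Real.sin θ ^ 2 = Real.sin θ₀ ^ 2 := by rw [Real.sin_sq, Real.sin_sq, hcos]
    have hle : Real.sin θ₀ ≤ Real.sin θ := le_of_abs_le (abs_le_of_sq_le_sq hss.ge hsin)
    rw [Plane.norm_sq, Plane.norm_sq]
    simp only [PiLp.sub_apply, e3, Params.engPt_one, PiLp.smul_apply, smul_eq_mul, dir,
      Matrix.cons_val_zero, Matrix.cons_val_one]
    have h2 := mul_nonneg (mul_nonneg hP.ρA_pos.le (mul_nonneg hr.le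
      (Real.sin_nonneg_of_nonneg_of_le_pi hθD.1 hθD.2))) (sub_nonneg.2 hle)
    have h3 : (P.ρA * Real.sin θ) ^ 2 = (P.ρA * Real.sin θ₀) ^ 2 := by
      rw [mul_pow, mul_pow, hss]
    nlinarith only [h2, h3]
  have h1 := (norm_engPt_sub_le_iff hP (norm_engPt_pos h0) h0.le hr θD).1 hin
  refine ⟨θ, hmem, h1.trans (Real.cos_le_one _), ?_⟩
  rw [θmax]
  rcases le_or_gt (φEng P (P.engTime θ, θ)) θD with h2 | h2
  · have h3 := Real.arccos_le_arccos h1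
    rw [Real.arccos_cos (sub_nonneg.2 h2) (by linarith [hθD.2, φEng_nonneg hP hsin])] at h3
    linarith
  · linarith [Real.arccos_nonneg (cosArg P r (P.engTime θ, θ))]

/-- For `ρA < rT` engagement points stay off the origin, so `θmax` is continuous in `θ`. Folding
angles into `[0, π]` keeps `cosArg` and does not lower `φEng`, which reduces the maximization to a
compact set. -/
theorem exists_best {P : Params} (hP : P.Regime) (hrT : P.ρA < P.rT) {r : ℝ} (hr : 0 < r)
    (h : ∃ θ ∈ Icc 0 Real.pi, cosArg P r (P.engTime θ, θ) ≤ 1) :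
    ∃ θ, IsBestEngagement P r (P.engTime θ, θ) := by
  have hE : ∀ θ, 0 < ‖P.engPt θ‖ := fun θ => norm_engPt_pos (engPt_zero_pos hP hrT.le θ)
  have hcos : Continuous fun θ => cosArg P r (P.engTime θ, θ) := by
    simp only [cosArg_eq hP]
    refine Continuous.div ?_ ?_ fun θ => (mul_pos (mul_pos two_pos (hE θ)) hr).ne'
    · exact (((continuous_norm_engPt hP).pow 2).add continuous_const).sub
        ((continuous_engTime hP).pow 2)
    · exact (continuous_const.mul (continuous_norm_engPt hP)).mul continuous_const
  have hφ : Continuous fun θ => φEng P (P.engTime θ, θ) :=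
    continuous_iff_continuousAt.2 fun θ => continuousAt_φEng hP (hE θ)
  have hθ : Continuous fun θ => θmax P r (P.engTime θ, θ) :=
    (Real.continuous_arccos.comp hcos).add hφ
  obtain ⟨θ₀, hθ₀, hc₀⟩ := h
  obtain ⟨θ, ⟨-, hc⟩, hmax⟩ := (isCompact_Icc.inter_right
    (isClosed_le hcos continuous_const)).exists_isMaxOn ⟨θ₀, hθ₀, hc₀⟩ hθ.continuousOn
  refine ⟨θ, engTime_mem hP θ, hc, fun q hq hqc => ?_⟩
  obtain ⟨τ, ψ⟩ := q
  rw [hP.mem_engagementSurface] at hq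
  subst hq
  set ψ' := Real.arccos (Real.cos ψ) with hψ
  have hcos' : Real.cos ψ' = Real.cos ψ :=
    Real.cos_arccos (Real.neg_one_le_cos _) (Real.cos_le_one _)
  have hmem : ψ' ∈ Icc 0 Real.pi := ⟨Real.arccos_nonneg _, Real.arccos_le_pi _⟩
  have hce := cosArg_eq_of_cos_eq hP (r := r) hcos'
  have h1 : θmax P r (P.engTime ψ', ψ') ≤ θmax P r (P.engTime θ, θ) :=
    hmax ⟨hmem, hce.trans_le hqc⟩
  refine le_trans ?_ h1
  rw [θmax, θmax, hce, φEng_eq hP, φEng_eq hP, norm_engPt_eq_of_cos_eq hcos']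
  refine add_le_add_right (Real.monotone_arcsin ?_) _
  refine div_le_div_of_nonneg_right ?_ (norm_nonneg _)
  rw [Params.engPt_one, Params.engPt_one]
  refine mul_le_mul_of_nonneg_left ?_ hP.ρA_pos.le
  have hss : Real.sin ψ' ^ 2 = Real.sin ψ ^ 2 := by rw [Real.sin_sq, Real.sin_sq, hcos']
  exact le_of_abs_le (abs_le_of_sq_le_sq hss.ge
    (Real.sin_nonneg_of_nonneg_of_le_pi hmem.1 hmem.2))

/-! ### Undetected paths from reachable positions -/

theorem refl_radial (P : Params) (t : ℝ) : refl (radial P 0 t) = radial P 0 t := by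
  rw [refl_apply]
  refine Plane.ext ?_ ?_ <;> simp [radial, dir]

theorem Sneak.refl {P : Params} {t₀ t₁ : ℝ} {y z : Plane} (h : Sneak P t₀ y t₁ z) :
    Sneak P t₀ (refl y) t₁ (refl z) := by
  obtain ⟨p, h0, h1, hp, hfar⟩ := h
  refine ⟨fun s => TargetDefense.refl (p s), congrArg _ h0, congrArg _ h1,
    fun s t hs hst ht => ?_, fun s hs hst => ?_⟩
  · rw [← map_sub, LinearIsometryEquiv.norm_map]; exact hp s t hs hst ht
  · rw [← refl_radial, ← map_sub, LinearIsometryEquiv.norm_map]; exact hfar s hs hst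

theorem Reach.exists_sneak_of_nonneg {P : Params} (hP : P.Regime) {y : Plane} (h : Reach P y)
    (hyR : ‖y‖ ≤ P.R - P.ρA) (hsep : P.ρA < ‖radial P 0 0 - y‖) (hy1 : 0 ≤ y 1) :
    ∃ θ, Sneak P 0 y (P.engTime θ) (P.engPt θ) := by
  have hfront : ‖P.engPt Real.pi - y‖ ≤ P.engTime Real.pi →
      Sneak P 0 y (P.engTime Real.pi) (P.engPt Real.pi) := by
    refine sneak_straight hP ?_ ?_
    · have h1 := (Plane.lt_norm_iff hP.ρA_pos.le).1 hsep
      simp only [PiLp.sub_apply, radial_zero_apply_zero, radial_zero_apply_one, mul_zero,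
        sub_zero, zero_sub, neg_sq] at h1
      exact h1
    · have h1 : y 0 ≤ ‖y‖ := le_of_abs_le (abs_le_of_sq_le_sq (by
        rw [Plane.norm_sq]; nlinarith [sq_nonneg (y 1)]) (norm_nonneg _))
      rw [Real.cos_pi, Real.sin_pi]
      linarith
  rcases le_or_gt P.rT P.ρA with hrT | hrT
  · have h1 := norm_add_lt_engTime hP hrT hyR Real.cos_pi
    exact ⟨_, hfront (by linarith [norm_sub_le (P.engPt Real.pi) y])⟩
  rcases eq_or_ne y 0 with rfl | hy0
  · exact ⟨_, hfront (by rw [sub_zero]; exact norm_engPt_pi_le hP hrT.le Real.cos_pi)⟩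
  have hr : 0 < ‖y‖ := norm_pos_iff.2 hy0
  obtain ⟨ψ₀, hψ₀⟩ := Plane.exists_polar y
  obtain ⟨ψ, hψ, hyψ⟩ : ∃ ψ ∈ Icc 0 Real.pi, y = ‖y‖ • dir ψ := by
    have hcos : Real.cos (Real.arccos (Real.cos ψ₀)) = Real.cos ψ₀ :=
      Real.cos_arccos (Real.neg_one_le_cos _) (Real.cos_le_one _)
    refine ⟨Real.arccos (Real.cos ψ₀), ⟨Real.arccos_nonneg _, Real.arccos_le_pi _⟩, ?_⟩
    have h1 : y 1 = ‖y‖ * Real.sin ψ₀ := by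
      conv_lhs => rw [hψ₀]
      simp [dir]
    have h2 : 0 ≤ Real.sin ψ₀ := nonneg_of_mul_nonneg_right (by rw [← h1]; exact hy1) hr
    have h3 : Real.sin (Real.arccos (Real.cos ψ₀)) = Real.sin ψ₀ := by
      rw [← sq_eq_sq₀ (Real.sin_nonneg_of_nonneg_of_le_pi (Real.arccos_nonneg _)
        (Real.arccos_le_pi _)) h2, Real.sin_sq, Real.sin_sq, hcos]
    rw [dir, hcos, h3]
    exact hψ₀
  set r := ‖y‖ with hrdef
  rw [hyψ] at h hsep ⊢
  obtain ⟨θ₀, hθ₀, hc₀, hle₀⟩ := h.exists_le_θmax hP hrT hr hψ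
  obtain ⟨θ, hθ⟩ := exists_best hP hrT hr ⟨θ₀, hθ₀, hc₀⟩
  exact ⟨θ, sneak_of_best hP hr hyR hψ hsep hθ (hle₀.trans (hθ.2.2 _ (engTime_mem hP θ₀) hc₀))⟩

theorem Reach.exists_sneak {P : Params} (hP : P.Regime) {y : Plane} (h : Reach P y)
    (hyR : ‖y‖ ≤ P.R - P.ρA) (hsep : P.ρA < ‖radial P 0 0 - y‖) :
    ∃ θ, Sneak P 0 y (P.engTime θ) (P.engPt θ) := by
  rcases le_total 0 (y 1) with h1 | h1
  · exact h.exists_sneak_of_nonneg hP hyR hsep h1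
  · obtain ⟨θ, hθ⟩ := Reach.exists_sneak_of_nonneg hP h.refl
      (by rw [LinearIsometryEquiv.norm_map]; exact hyR)
      (by rw [← refl_radial, ← map_sub, LinearIsometryEquiv.norm_map]; exact hsep)
      (by rw [refl_apply]; simpa using h1)
    refine ⟨-θ, ?_⟩
    have h2 := hθ.refl
    rwa [refl_refl, ← engPt_neg, ← engTime_neg] at h2

/-! ### Averages over the angle of arrival -/

/-- Average over the angle of arrival. -/
def angleAverage (f : ℝ → ENNReal) : ENNReal :=
  (ENNReal.ofReal (2 * Real.pi))⁻¹ * ∫⁻ φ in Ioc (-Real.pi) Real.pi, f φ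

theorem angleAverage_mono_ae {f g : ℝ → ENNReal}
    (h : ∀ᵐ φ ∂(volume.restrict (Ioc (-Real.pi) Real.pi)), f φ ≤ g φ) :
    angleAverage f ≤ angleAverage g := mul_le_mul_right (lintegral_mono_ae h) _

theorem angleAverage_mono {f g : ℝ → ENNReal} (h : ∀ φ, f φ ≤ g φ) :
    angleAverage f ≤ angleAverage g := angleAverage_mono_ae (Filter.Eventually.of_forall h)

theorem angleAverage_const (c : ENNReal) : angleAverage (fun _ => c) = c := by
  have h : ENNReal.ofReal (2 * Real.pi) ≠ 0 := by
    rw [ne_eq, ENNReal.ofReal_eq_zero, not_le]; exact Real.two_pi_pos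
  rw [angleAverage, setLIntegral_const, Real.volume_Ioc, sub_neg_eq_add, ← two_mul, mul_comm c,
    ← mul_assoc, ENNReal.inv_mul_cancel h ENNReal.ofReal_ne_top, one_mul]

/-- Half-open intervals of length `2π` are fundamental domains for the translations by multiples of
`2π`; this way no measurability of `f`, hence of the stage values, is required. -/
theorem angleAverage_shift {f : ℝ → ENNReal} (hf : ∀ φ, f (φ + 2 * Real.pi) = f φ) (ψ : ℝ) :
    angleAverage (fun φ => f (φ - ψ)) = angleAverage f := by
  rw [angleAverage, angleAverage]
  congr 1
  have h1 : (fun φ : ℝ => φ - ψ) ⁻¹' Ioc (-Real.pi - ψ) (Real.pi - ψ) =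
      Ioc (-Real.pi) Real.pi := by
    ext φ; simp
  conv_lhs => rw [← h1]
  rw [(measurePreserving_sub_right volume ψ).setLIntegral_comp_preimage_emb
    (MeasurableEquiv.subRight ψ).measurableEmbedding f]
  have hd1 := isAddFundamentalDomain_Ioc Real.two_pi_pos (-Real.pi - ψ)
  have hd2 := isAddFundamentalDomain_Ioc Real.two_pi_pos (-Real.pi)
  rw [show -Real.pi - ψ + 2 * Real.pi = Real.pi - ψ by ring] at hd1
  rw [show -Real.pi + 2 * Real.pi = Real.pi by ring] at hd2
  refine hd1.setLIntegral_eq hd2 f fun g φ => ?_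
  obtain ⟨g, hg⟩ := g
  obtain ⟨k, rfl⟩ := AddSubgroup.mem_zmultiples_iff.1 hg
  have hper : Function.Periodic f (2 * Real.pi) := hf
  have := hper.zsmul k φ
  rw [add_comm] at this
  exact this

theorem value_succ (P : Params) (n : ℕ) (y : Plane) :
    value P (n + 1) y = angleAverage fun φ => stageValue P (value P n) φ y := rfl

/-! ### The shape of the value function -/

/-- The future value `U` is largest at the center, at least `m` where intruders can be captured,
and at most `m` outside. -/
structure IsTargetLike (P : Params) (U : Plane → ENNReal) (m : ENNReal) : Prop where
  le_center : ∀ x, U x ≤ U 0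
  ge_inside : ∀ x, ‖x‖ ≤ P.c → m ≤ U x
  le_outside : ∀ x, P.c ≤ ‖x‖ → U x ≤ m
  center_le : U 0 ≤ 1 + m

namespace IsTargetLike

theorem comp {P : Params} {U : Plane → ENNReal} {m : ENNReal} (h : IsTargetLike P U m)
    (g : Plane ≃ₗᵢ[ℝ] Plane) : IsTargetLike P (fun x => U (g x)) m where
  le_center x := by rw [map_zero]; exact h.le_center _
  ge_inside x hx := h.ge_inside _ (by rwa [LinearIsometryEquiv.norm_map])
  le_outside x hx := h.le_outside _ (by rwa [LinearIsometryEquiv.norm_map])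
  center_le := by rw [map_zero]; exact h.center_le

theorem stageValue_le {P : Params} (hP : P.Regime) {U : Plane → ENNReal} {m : ENNReal}
    (h : IsTargetLike P U m) (y : Plane) : stageValue P U 0 y ≤ 1 + m :=
  iSup_le fun σ => guarantee_le_one_add hP h.le_outside
    (fun x => (h.le_center x).trans h.center_le) σ

theorem le_stageValue {P : Params} (hP : P.Regime) {U : Plane → ENNReal} {m : ENNReal}
    (h : IsTargetLike P U m) {y : Plane} (hy : Reach P y) (hyR : ‖y‖ ≤ P.R - P.ρA)
    (hsep : P.ρA < ‖radial P 0 0 - y‖) : 1 + m ≤ stageValue P U 0 y := by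
  obtain ⟨θ, hθ⟩ := hy.exists_sneak hP hyR hsep
  obtain ⟨σ, -, hσ⟩ := exists_strategy_of_sneak hP hθ
  exact (hσ U m h.ge_inside).trans (le_iSup (fun σ => guarantee P U 0 σ) σ)

theorem stageValue_le_center {P : Params} (hP : P.Regime) {U : Plane → ENNReal} {m : ENNReal}
    (h : IsTargetLike P U m) {y : Plane} (hy : ¬ Reach P y)
    (hsep : P.ρA < ‖radial P 0 0 - y‖) : stageValue P U 0 y ≤ U 0 :=
  iSup_le fun σ => guarantee_le_of_not_reach hP h.le_center hsep hy σ

end IsTargetLike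

theorem center_le_stageValue {P : Params} (hP : P.Regime) (U : Plane → ENNReal) {y : Plane}
    (hrT : P.ρA < P.rT) (hyR : ‖y‖ ≤ P.R - P.ρA) (hsep : P.ρA < ‖radial P 0 0 - y‖)
    (hyT : ‖y‖ ≤ P.ρT / P.ν) : U 0 ≤ stageValue P U 0 y :=
  (le_guarantee_goHome hP hrT hyR hsep hyT U).trans
    (le_iSup (fun σ => guarantee P U 0 σ) (goHome P y))

theorem stageValue_smul_dir (P : Params) (U : Plane → ENNReal) (s φ ψ : ℝ) :
    stageValue P U φ (s • dir ψ) =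
      stageValue P (fun x => U (rot φ x)) 0 (s • dir (ψ - φ)) := by
  have h1 : rot φ (dir 0) = dir φ := by rw [rot_dir, zero_add]
  rw [← stageValue_comp (rot φ) h1, map_smul, rot_dir, sub_add_cancel]

theorem dir_add_two_pi (φ : ℝ) : dir (φ + 2 * Real.pi) = dir φ := by simp [dir]

/-- Positions on the way to the annulus of arrival are detected at once only from one angle. -/
theorem dir_eq_of_near {P : Params} (hP : P.Regime) {s φ ψ : ℝ} (hs : 0 ≤ s) (hsR : s ≤ P.R - P.ρA)
    (h : ‖radial P 0 0 - s • dir (ψ - φ)‖ ≤ P.ρA) : dir φ = dir ψ := by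
  have hρ := hP.ρA_pos
  have h1 := (Plane.norm_le_iff hρ.le).1 h
  simp only [PiLp.sub_apply, radial_zero_apply_zero, radial_zero_apply_one, mul_zero,
    sub_zero, zero_sub, neg_sq, PiLp.smul_apply, smul_eq_mul, dir, Matrix.cons_val_zero,
    Matrix.cons_val_one] at h1
  have h2 := Real.sin_sq_add_cos_sq (ψ - φ)
  have hR : 0 < P.R - P.ρA := hP.c_pos.trans_le hP.c_le
  have h3 : P.R ^ 2 + s ^ 2 - P.ρA ^ 2 ≤ 2 * P.R * s * Real.cos (ψ - φ) := by
    linear_combination h1 - s ^ 2 * h2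
  have hs0 : 0 < s := by
    refine lt_of_le_of_ne hs fun h' => ?_
    rw [← h'] at h3
    nlinarith
  have h4 : 2 * P.R * s * 1 ≤ 2 * P.R * s * Real.cos (ψ - φ) := by nlinarith
  have h5 : 1 ≤ Real.cos (ψ - φ) :=
    le_of_mul_le_mul_left h4 (mul_pos (mul_pos two_pos (by linarith)) hs0)
  rw [Real.cos_sub] at h5
  have h6 := Real.sin_sq_add_cos_sq ψ
  have h7 := Real.sin_sq_add_cos_sq φ
  have h8 : (Real.cos φ - Real.cos ψ) ^ 2 + (Real.sin φ - Real.sin ψ) ^ 2 ≤ 0 := by linarith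
  have h9 := sq_nonneg (Real.cos φ - Real.cos ψ)
  have h10 := sq_nonneg (Real.sin φ - Real.sin ψ)
  have h11 : Real.cos φ - Real.cos ψ = 0 :=
    (pow_eq_zero_iff two_ne_zero).1 (le_antisymm (by linarith) h9)
  have h12 : Real.sin φ - Real.sin ψ = 0 :=
    (pow_eq_zero_iff two_ne_zero).1 (le_antisymm (by linarith) h10)
  rw [dir, dir, sub_eq_zero.1 h11, sub_eq_zero.1 h12]

/-- At most one arrival angle leads to immediate detection, so such arrivals do not affect the
average. -/
theorem ae_sep {P : Params} (hP : P.Regime) {s : ℝ} (hs : 0 ≤ s) (hsR : s ≤ P.R - P.ρA) (ψ : ℝ) :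
    ∀ᵐ φ ∂(volume.restrict (Ioc (-Real.pi) Real.pi)),
      P.ρA < ‖radial P 0 0 - s • dir (ψ - φ)‖ := by
  rw [ae_restrict_iff' measurableSet_Ioc, ae_iff]
  refine Set.Subsingleton.measure_zero (fun φ₁ h1 φ₂ h2 => ?_) volume
  simp only [mem_ofPred_eq, Classical.not_imp, not_lt] at h1 h2
  exact dir_injOn h1.1 h2.1
    ((dir_eq_of_near hP hs hsR h1.2).trans (dir_eq_of_near hP hs hsR h2.2).symm)

open Classical in
/-- The value of the next game for a defender at distance `c` from the center and bearing `α`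
from the intruder. -/
def rimValue (P : Params) (U : Plane → ENNReal) (m : ENNReal) (α : ℝ) : ENNReal :=
  if Reach P (P.c • dir α) then 1 + m else U 0

theorem rimValue_add_two_pi (P : Params) (U : Plane → ENNReal) (m : ENNReal) (α : ℝ) :
    rimValue P U m (α + 2 * Real.pi) = rimValue P U m α := by
  rw [rimValue, rimValue, dir_add_two_pi]

theorem rimValue_neg (P : Params) (U : Plane → ENNReal) (m : ENNReal) (α : ℝ) :
    rimValue P U m (-α) = rimValue P U m α := by
  have h : Reach P (P.c • dir (-α)) ↔ Reach P (P.c • dir α) := by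
    rw [← refl_dir, ← map_smul]
    refine ⟨fun h => ?_, fun h => h.refl⟩
    have := h.refl
    rwa [refl_refl] at this
  by_cases hr : Reach P (P.c • dir α)
  · rw [rimValue, rimValue, if_pos hr, if_pos (h.2 hr)]
  · rw [rimValue, rimValue, if_neg hr, if_neg (h.not.2 hr)]

theorem angleAverage_rimValue (P : Params) (U : Plane → ENNReal) (m : ENNReal) (ψ : ℝ) :
    angleAverage (fun φ => rimValue P U m (ψ - φ)) = angleAverage (rimValue P U m) := by
  rw [← angleAverage_shift (rimValue_add_two_pi P U m) ψ]
  congr 1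
  funext φ
  rw [← rimValue_neg, neg_sub]

/-- Reachability survives scaling from the rim inwards; where the rim position does not reach, going
home still secures `U 0`. -/
theorem rimValue_le_stageValue {P : Params} (hP : P.Regime) {U : Plane → ENNReal} {m : ENNReal}
    (h : IsTargetLike P U m) {s φ ψ : ℝ} (hs : 0 ≤ s) (hsc : s ≤ P.c)
    (hsep : P.ρA < ‖radial P 0 0 - s • dir (ψ - φ)‖) :
    rimValue P U m (ψ - φ) ≤ stageValue P U φ (s • dir ψ) := by
  rw [stageValue_smul_dir]
  have hn := norm_smul_dir hs (ψ - φ)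
  have hc := hP.c_pos
  have hsR : ‖s • dir (ψ - φ)‖ ≤ P.R - P.ρA := by rw [hn]; exact hsc.trans hP.c_le
  rw [rimValue]
  rcases le_or_gt P.rT P.ρA with hrT | hrT
  · rw [if_pos (reach_of_small hP hrT (by rw [norm_smul_dir hc.le]; exact hP.c_le))]
    exact (h.comp (rot φ)).le_stageValue hP (reach_of_small hP hrT hsR) hsR hsep
  split_ifs with hreach
  · refine (h.comp (rot φ)).le_stageValue hP ?_ hsR hsep
    have h1 := hreach.smul hP hrT.le (l := s / P.c) (div_nonneg hs hc.le) ((div_le_one hc).2 hsc)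
    rwa [smul_smul, div_mul_cancel₀ _ hc.ne'] at h1
  · have h1 := center_le_stageValue hP (fun x => U (rot φ x)) hrT hsR hsep
      (by rw [hn]; exact hsc.trans hP.c_le')
    rwa [map_zero] at h1

/-- If the rim position does not reach, neither does any position further out, by star-shapedness.
Nor can such a position be detected at once, by `reach_of_near`. -/
theorem stageValue_le_rimValue {P : Params} (hP : P.Regime) {U : Plane → ENNReal} {m : ENNReal}
    (h : IsTargetLike P U m) {s : ℝ} (φ ψ : ℝ) (hsc : P.c ≤ s) :
    stageValue P U φ (s • dir ψ) ≤ rimValue P U m (ψ - φ) := by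
  rw [stageValue_smul_dir]
  have hc := hP.c_pos
  have hs : 0 < s := hc.trans_le hsc
  have hn := norm_smul_dir hs.le (ψ - φ)
  have hscale : (P.c / s) • s • dir (ψ - φ) = P.c • dir (ψ - φ) := by
    rw [smul_smul, div_mul_cancel₀ _ hs.ne']
  rw [rimValue]
  split_ifs with hreach
  · exact (h.comp (rot φ)).stageValue_le hP _
  have hrT : P.ρA < P.rT := by
    by_contra hcon
    exact hreach (reach_of_small hP (not_lt.1 hcon) (by rw [norm_smul_dir hc.le]; exact hP.c_le))
  have h1 : ¬ Reach P (s • dir (ψ - φ)) := fun h' => hreach (by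
    rw [← hscale]
    exact h'.smul hP hrT.le (div_nonneg hc.le hs.le) ((div_le_one hs).2 hsc))
  have hsep : P.ρA < ‖radial P 0 0 - s • dir (ψ - φ)‖ := by
    by_contra hcon
    have h2 := reach_of_near hP (z := s • dir (ψ - φ)) (by rw [hn]; exact hsc) (not_lt.1 hcon)
    rw [hn, hscale] at h2
    exact hreach h2
  have h2 := (h.comp (rot φ)).stageValue_le_center hP h1 hsep
  rwa [map_zero] at h2

/-- The new `m` is the average of `rimValue`, which does not depend on the bearing. The centre
always reaches the surface, so its new value is the upper bound `1 + m` for the old `m`. -/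
theorem exists_isTargetLike_value {P : Params} (hP : P.Regime) (n : ℕ) :
    ∃ m, IsTargetLike P (value P n) m := by
  induction n with
  | zero => exact ⟨0, fun _ => le_rfl, fun _ _ => le_rfl, fun _ _ => le_rfl, zero_le⟩
  | succ n ih =>
    obtain ⟨m, h⟩ := ih
    set U := value P n
    have hle : ∀ y, value P (n + 1) y ≤ 1 + m := fun y => by
      rw [value_succ, ← angleAverage_const (1 + m)]
      refine angleAverage_mono fun φ => ?_
      obtain ⟨ψ, hψ⟩ := Plane.exists_polar y
      rw [hψ, stageValue_smul_dir]
      exact (h.comp (rot φ)).stageValue_le hP _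
    have hcenter : value P (n + 1) 0 = 1 + m := by
      refine le_antisymm (hle 0) ?_
      rw [value_succ, ← angleAverage_const (1 + m)]
      refine angleAverage_mono fun φ => ?_
      have h0 : (0 : Plane) = (0 : ℝ) • dir 0 := (zero_smul ℝ _).symm
      rw [h0, stageValue_smul_dir, zero_smul]
      have hR : 0 < P.R - P.ρA := hP.c_pos.trans_le hP.c_le
      refine (h.comp (rot φ)).le_stageValue hP (reach_zero hP) (by rw [norm_zero]; exact hR.le) ?_
      rw [sub_zero, norm_radial P 0 0 (by linarith [hP.ρA_pos])]
      linarith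
    refine ⟨angleAverage (rimValue P U m), fun x => (hle x).trans hcenter.ge, fun x hx => ?_,
      fun x hx => ?_, ?_⟩
    · obtain ⟨ψ, hψ⟩ := Plane.exists_polar x
      rw [value_succ, ← angleAverage_rimValue P U m ψ]
      refine angleAverage_mono_ae ?_
      filter_upwards [ae_sep hP (norm_nonneg x) (hx.trans hP.c_le) ψ] with φ hφ
      conv_rhs => rw [hψ]
      exact rimValue_le_stageValue hP h (norm_nonneg x) hx hφ
    · obtain ⟨ψ, hψ⟩ := Plane.exists_polar x
      rw [value_succ, ← angleAverage_rimValue P U m ψ]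
      refine angleAverage_mono fun φ => ?_
      conv_lhs => rw [hψ]
      exact stageValue_le_rimValue hP h φ ψ hx
    · rw [hcenter]
      -- It remains that `rimValue` is at least the old `m`, which holds for both of its values.
      gcongr
      refine (angleAverage_const m).ge.trans (angleAverage_mono fun φ => ?_)
      rw [rimValue]
      split_ifs
      · exact le_add_self
      · exact h.ge_inside 0 (by rw [norm_zero]; exact hP.c_pos.le)

end TargetDefense

end

/-! ### Optimality of both strategies -/

theorem mainTheorem8 (P : TargetDefense.Params) (hP : P.Regime) (r θD τ θ : ℝ)
    (hr : 0 < r) (hr_le : r ≤ P.rT + P.ρT - P.ρA)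
    (hθD : θD ∈ Set.Icc 0 Real.pi)
    (hsep : P.ρA < ‖r • TargetDefense.dir θD - TargetDefense.radial P 0 0‖)
    (hbest : TargetDefense.IsBestEngagement P r (τ, θ)) :
    (TargetDefense.θmax P r (τ, θ) < θD → r ≤ P.ρT / P.ν →
      ∀ n : ℕ, TargetDefense.IsOptimal P n 0
        (TargetDefense.goHome P (r • TargetDefense.dir θD))) ∧
    (θD ≤ TargetDefense.θmax P r (τ, θ) →
      ∃ σ : TargetDefense.DefenderStrategy P (r • TargetDefense.dir θD),
        TargetDefense.EngagesAt P σ (τ, θ) ∧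
        ∀ n : ℕ, TargetDefense.IsOptimal P n 0 σ) := by
  obtain rfl : τ = P.engTime θ := hP.mem_engagementSurface.1 hbest.1
  rw [norm_sub_rev] at hsep
  have hn := TargetDefense.norm_smul_dir hr.le θD
  refine ⟨fun hlt hrT n => ?_, fun hle => ?_⟩
  -- For a small target `θmax ≥ π ≥ θD`, which the present case excludes.
  · have hρ : P.ρA < P.rT := by
      by_contra hcon
      have := TargetDefense.pi_le_θmax_of_small hP (not_lt.1 hcon) hr hr_le hbest
      linarith [hθD.2]
    have hreach : ¬ TargetDefense.Reach P (r • TargetDefense.dir θD) := fun h => by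
      obtain ⟨θ₀, -, h1, h2⟩ := h.exists_le_θmax hP hρ hr hθD
      linarith [hbest.2.2 _ (TargetDefense.engTime_mem hP θ₀) h1]
    obtain ⟨m, hm⟩ := TargetDefense.exists_isTargetLike_value hP n
    refine le_antisymm (le_iSup (fun σ => TargetDefense.guarantee P _ 0 σ) _) ?_
    exact (hm.stageValue_le_center hP hreach hsep).trans
      (TargetDefense.le_guarantee_goHome hP hρ (by rw [hn]; exact hr_le) hsep
        (by rw [hn]; exact hrT) _)
  -- `σ` comes from geometry alone and its guarantee is uniform in `U` and `m`; only `m` depends on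
  -- `n`.
  · obtain ⟨σ, hσ, hσ'⟩ := TargetDefense.exists_strategy_of_sneak hP
      (TargetDefense.sneak_of_best hP hr hr_le hθD hsep hbest hle)
    refine ⟨σ, hσ, fun n => ?_⟩
    obtain ⟨m, hm⟩ := TargetDefense.exists_isTargetLike_value hP n
    refine le_antisymm (le_iSup (fun σ => TargetDefense.guarantee P _ 0 σ) _) ?_
    exact (hm.stageValue_le hP _).trans (hσ' _ m hm.ge_inside)
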